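/- **Theorem 3.5.** Let $(M,g)$ be a smooth pseudo-Riemannian manifold of dimension $n$ with Levi-Civita connection $\nabla$, let $\hbar\neq 0$ be a real constant, and write $\mathbf{i}$ for the imaginary unit. Let $\mathcal{M}=T^*M\times_M\Pi TM$ be the supercotangent bundle: a chart $(x^i)$ of $M$ gives natural coordinates $(x^i,p_i,\xi^i)$ on $\mathcal M$ ($x^i,p_i$ even, $\xi^i$ odd), which transform by $p'_i=\frac{\partial x^j}{\partial x'^i}p_j$ and $\xi'^i=\frac{\partial x'^i}{\partial x^j}\xi^j$, and (super)functions on $\mathcal M$ are locally the smooth complex functions of $(x,p)$ with values in the Grassmann algebra generated by the $\xi^i$. With $\Gamma^k_{ij}$ the Christoffel symbols and $d^\nabla\xi^i=d\xi^i+\Gamma^i_{jk}\xi^j dx^k$, consider the $1$-forms $$\alpha=p_i\,dx^i+\frac{\hbar}{2\mathbf{i}}\,g_{ij}\,\xi^i d^\nabla\xi^j,\qquad \beta=g_{ij}\,\xi^i dx^j .$$ A lift of a smooth vector field $X$ on $M$ is an even vector field $\tilde X$ on $\mathcal M$ that projects onto $X$, i.e. $\tilde X(x^i)=X^i$. It preserves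 $\alpha$ if $L_{\tilde X}\alpha=0$, and it preserves the direction of $\beta$ if $L_{\tilde X}\beta=f\beta$ for some $f\in C^\infty(M)$. Let $\mathrm{conf}(M,g)$ be the set of smooth vector fields $X$ on $M$ with $L_Xg=\lambda g$ for some $\lambda\in C^\infty(M)$. 1. A smooth vector field $X$ on $M$ has a lift that preserves $\alpha$ and the direction of $\beta$ if and only if $X\in\mathrm{conf}(M,g)$. 2. If $X\in\mathrm{conf}(M,g)$, this lift $\tilde X$ is unique, and in all natural coordinates $$\tilde X=X^i\partial^\nabla_i+\partial_{[j}X_{i]}\,\xi^j\partial_{\xi_i}-p_j\nabla_iX^j\,\partial_{p_i}+\frac{\hbar}{2\mathbf{i}}\Big(R^k_{lij}\,\xi_k\xi^lX^j-(\nabla_i\partial_{[l}X_{k]})\,\xi^k\xi^l\Big)\partial_{p_i},$$ where $\partial^\nabla_i=\partial_i+\Gamma^k_{ij}p_k\partial_{p_j}-\Gamma^k_{ij}\xi^j\partial_{\xi^k}$, $X_i=g_{ij}X^j$, $\xi_i=g_{ij}\xi^j$, $\partial_{\xi_i}=g^{ij}\partial_{\xi^j}$, $\partial_{[j}X_{i]}=\frac12(\partial_jX_i-\partial_iX_j)$,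 and $R^c_{aij}=\partial_i\Gamma^c_{aj}-\partial_j\Gamma^c_{ai}+\Gamma^c_{ik}\Gamma^k_{aj}-\Gamma^c_{jk}\Gamma^k_{ai}$ is the Riemann tensor. 3. $\mathrm{conf}(M,g)$ is a Lie algebra under the bracket of vector fields, and $X\mapsto\tilde X$ is a morphism of real Lie algebras $\mathrm{conf}(M,g)\to\mathrm{Vect}(\mathcal M)$: it is $\mathbb R$-linear and $\widetilde{[X,Y]}=[\tilde X,\tilde Y]$. -/

import Mathlib

open scoped Manifold ContDiff

noncomputable section

namespace Supercotangent

/-! ### The Grassmann algebra and superfunctions on a chart -/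

/-- The model of the coordinate charts of `M`. -/
abbrev Coord (n : ℕ) : Type := EuclideanSpace ℝ (Fin n)

/-- The complex Grassmann algebra on the `n` odd generators `ξ¹, …, ξⁿ`. -/
def Grassmann (n : ℕ) : Type := ExteriorAlgebra ℂ (Fin n → ℂ)

instance (n : ℕ) : Ring (Grassmann n) := inferInstanceAs (Ring (ExteriorAlgebra ℂ (Fin n → ℂ)))

instance (n : ℕ) : Algebra ℂ (Grassmann n) :=
  inferInstanceAs (Algebra ℂ (ExteriorAlgebra ℂ (Fin n → ℂ)))

/-- The odd generator `ξⁱ`. -/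
def xi {n : ℕ} (i : Fin n) : Grassmann n := ExteriorAlgebra.ι ℂ (Pi.single i 1)

/-- A real number, seen as an element of degree zero of the Grassmann algebra. -/
def real {n : ℕ} (r : ℝ) : Grassmann n := algebraMap ℂ (Grassmann n) (r : ℂ)

/-- The coefficients of an element of the Grassmann algebra on the monomials
`ξ^{i₁} ⋯ ξ^{i_k}`, `i₁ < ⋯ < i_k`. -/
def coeffs (n : ℕ) : Grassmann n ≃ₗ[ℂ] (Finset (Fin n) → ℂ) :=
  (Pi.basisFun ℂ (Fin n)).ExteriorAlgebra.equivFun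

/-- The (finite dimensional) Grassmann algebra is normed by the maximum of the coefficients, so
that a Grassmann valued map is smooth, or is differentiated, coefficient by coefficient. -/
instance (n : ℕ) : NormedAddCommGroup (Grassmann n) :=
  NormedAddCommGroup.induced (Grassmann n) (Finset (Fin n) → ℂ) (coeffs n) (coeffs n).injective

instance (n : ℕ) : NormedSpace ℂ (Grassmann n) :=
  NormedSpace.induced ℂ (Grassmann n) (Finset (Fin n) → ℂ) (coeffs n).toLinearMap

/-- The elements of parity `a` (`0` is even, `1` is odd) of the Grassmann algebra. -/
def parity (n : ℕ) (a : ZMod 2) : Submodule ℂ (Grassmann n) :=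
  CliffordAlgebra.evenOdd (0 : QuadraticForm ℂ (Fin n → ℂ)) a

/-- Superfunctions in natural coordinates `(x, p, ξ)`: maps `(x, p) ↦ F(x, p)` with values in the
Grassmann algebra in the `ξⁱ`. Only the values over the domain of a chart matter. -/
abbrev SFun (n : ℕ) : Type := Coord n × Coord n → Grassmann n

variable {n : ℕ}

/-- `∂F/∂xⁱ`. -/
def dX (i : Fin n) (F : SFun n) : SFun n :=
  fun z ↦ fderiv ℝ F z (EuclideanSpace.single i 1, 0)

/-- `∂F/∂pᵢ`. -/
def dP (i : Fin n) (F : SFun n) : SFun n :=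
  fun z ↦ fderiv ℝ F z (0, EuclideanSpace.single i 1)

/-- The left derivative `∂F/∂ξⁱ`: contraction with the linear form dual to `ξⁱ`. -/
def dXi (i : Fin n) (F : SFun n) : SFun n :=
  fun z ↦ CliffordAlgebra.contractLeft (Q := (0 : QuadraticForm ℂ (Fin n → ℂ)))
    (LinearMap.proj i) (F z)

/-- The coordinate superfunction `xⁱ`. -/
def coordX (i : Fin n) : SFun n := fun z ↦ real (z.1 i)

/-- The coordinate superfunction `pᵢ`. -/
def coordP (i : Fin n) : SFun n := fun z ↦ real (z.2 i)

/-- The coordinate superfunction `ξⁱ`. -/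
def coordXi (i : Fin n) : SFun n := fun _ ↦ xi i

/-- The vector field `∑ Xⁱ ∂/∂xⁱ + Pᵢ ∂/∂pᵢ + Ξⁱ ∂/∂ξⁱ` in natural coordinates, given by its
components. -/
@[ext]
structure LocalField (n : ℕ) where
  x : Fin n → SFun n
  p : Fin n → SFun n
  xi : Fin n → SFun n

/-- The action of a vector field on superfunctions. -/
def LocalField.apply (V : LocalField n) (F : SFun n) : SFun n := fun z ↦
  ∑ i, (V.x i z * dX i F z + V.p i z * dP i F z + V.xi i z * dXi i F z)

/-- The `1`-form `∑ aᵢ dxⁱ + bⁱ dpᵢ + cᵢ dξⁱ` in natural coordinates, given by its coefficients,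
written on the left of the differentials. -/
@[ext]
structure LocalForm (n : ℕ) where
  x : Fin n → SFun n
  p : Fin n → SFun n
  xi : Fin n → SFun n

/-- The Lie derivative of a `1`-form along an *even* vector field `V`. The operator `L_V` is the even
derivation of differential forms that extends `V` and commutes with `d`, so that
`L_V (a dz) = V(a) dz + a d(V(z))` for each of the coordinates `z`.
Here `d h = ∑ dxʲ ∂h/∂xʲ + dpⱼ ∂h/∂pⱼ + dξʲ ∂h/∂ξʲ`, and moving the coefficient `∂h/∂ξʲ` to the left
of the odd symbol `dξʲ` costs a sign exactly when `∂h/∂ξʲ` is odd, that is, when `h` is even: this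
is the case for `h = V(xⁱ)` and `h = V(pᵢ)`, but not for `h = V(ξⁱ)`. -/
def LocalField.lieDeriv (V : LocalField n) (a : LocalForm n) : LocalForm n where
  x j := fun z ↦ V.apply (a.x j) z +
    ∑ i, (a.x i z * dX j (V.x i) z + a.p i z * dX j (V.p i) z + a.xi i z * dX j (V.xi i) z)
  p j := fun z ↦ V.apply (a.p j) z +
    ∑ i, (a.x i z * dP j (V.x i) z + a.p i z * dP j (V.p i) z + a.xi i z * dP j (V.xi i) z)
  xi j := fun z ↦ V.apply (a.xi j) z +
    ∑ i, (-(a.x i z * dXi j (V.x i) z) - a.p i z * dXi j (V.p i) z + a.xi i z * dXi j (V.xi i) z)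

/-! ### The supercotangent bundle of a manifold -/

section Manifold

variable (n) (M : Type*) [TopologicalSpace M] [ChartedSpace (Coord n) M]

/-- The charts of the smooth manifold `M`. -/
abbrev Chart : Type _ :=
  {φ : OpenPartialHomeomorph M (Coord n) // φ ∈ IsManifold.maximalAtlas (𝓡 n) ∞ M}

variable {n M}

/-- The domain, in natural coordinates `(x, p)`, of the part of `T*M` over a chart. -/
def Chart.domain (φ : Chart n M) : Set (Coord n × Coord n) := φ.1.target ×ˢ Set.univ

/-- The change of coordinates `ψ ∘ φ⁻¹` of `M`. -/
def Chart.transition (φ ψ : Chart n M) : Coord n → Coord n := fun y ↦ ψ.1 (φ.1.symm y)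

/-- The Jacobian matrix `∂x'ⁱ/∂xʲ` (row `i`, column `j`) of the change of coordinates `x' = ψ ∘ φ⁻¹`
at a point of coordinates `y` in the chart `φ`. -/
def Chart.jacobian (φ ψ : Chart n M) (y : Coord n) : Matrix (Fin n) (Fin n) ℝ :=
  fun i j ↦ fderiv ℝ (φ.transition ψ) y (EuclideanSpace.single j 1) i

/-- A superfunction written in the natural coordinates `(x', p', ξ')` of the chart `ψ` is rewritten in
the natural coordinates `(x, p, ξ)` of the chart `φ`, by the substitutions `x' = (ψ ∘ φ⁻¹)(x)`,
`p'ᵢ = ∑ⱼ pⱼ ∂xʲ/∂x'ⁱ` and `ξ'ⁱ = ∑ⱼ (∂x'ⁱ/∂xʲ) ξʲ`. These are the transition maps that define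
`T*M ×_M ΠTM`. -/
def Chart.pullback (φ ψ : Chart n M) (F : SFun n) : SFun n := fun z ↦
  ExteriorAlgebra.map
    (Matrix.vecMulLinear ((φ.jacobian ψ z.1).map ((↑) : ℝ → ℂ)))
    (F (φ.transition ψ z.1,
      WithLp.toLp 2 (Matrix.vecMul z.2.ofLp (ψ.jacobian φ (φ.transition ψ z.1)))))

variable (n M)

/-- Even vector fields on the supercotangent bundle `T*M ×_M ΠTM`: smooth components in each system
of natural coordinates, even along `∂/∂x` and `∂/∂p` and odd along `∂/∂ξ`, which are related by
the transformation law `V(z') = V'(z')` for the coordinates `z'` of another chart. The components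
are defined over the domain of the chart only; they are set to `0` elsewhere, so that two vector
fields are equal when their components are equal over the domains of all charts. -/
@[ext]
structure SuperVectorField where
  comp : Chart n M → LocalField n
  smooth_x : ∀ φ i, ContDiffOn ℝ ∞ ((comp φ).x i) φ.domain
  smooth_p : ∀ φ i, ContDiffOn ℝ ∞ ((comp φ).p i) φ.domain
  smooth_xi : ∀ φ i, ContDiffOn ℝ ∞ ((comp φ).xi i) φ.domain
  even_x : ∀ φ i z, (comp φ).x i z ∈ parity n 0
  even_p : ∀ φ i z, (comp φ).p i z ∈ parity n 0
  odd_xi : ∀ φ i z, (comp φ).xi i z ∈ parity n 1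
  transform_x : ∀ (φ ψ : Chart n M) (i : Fin n), ∀ z ∈ φ.domain, φ.1.symm z.1 ∈ ψ.1.source →
    (comp φ).apply (φ.pullback ψ (coordX i)) z = φ.pullback ψ ((comp ψ).x i) z
  transform_p : ∀ (φ ψ : Chart n M) (i : Fin n), ∀ z ∈ φ.domain, φ.1.symm z.1 ∈ ψ.1.source →
    (comp φ).apply (φ.pullback ψ (coordP i)) z = φ.pullback ψ ((comp ψ).p i) z
  transform_xi : ∀ (φ ψ : Chart n M) (i : Fin n), ∀ z ∈ φ.domain, φ.1.symm z.1 ∈ ψ.1.source →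
    (comp φ).apply (φ.pullback ψ (coordXi i)) z = φ.pullback ψ ((comp ψ).xi i) z
  off_x : ∀ φ i, ∀ z ∉ φ.domain, (comp φ).x i z = 0
  off_p : ∀ φ i, ∀ z ∉ φ.domain, (comp φ).p i z = 0
  off_xi : ∀ φ i, ∀ z ∉ φ.domain, (comp φ).xi i z = 0

/-! ### Pseudo-Riemannian geometry in coordinates -/

/-- A vector field on `M`, without any smoothness requirement. -/
abbrev VField : Type _ := ∀ q : M, TangentSpace (𝓡 n) q

variable {n M}

/-- Smoothness of a vector field on `M`. -/
def IsSmooth [IsManifold (𝓡 n) ∞ M] (X : VField n M) : Prop :=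
  ContMDiff (𝓡 n) (𝓡 n).tangent ∞ (fun q ↦ (⟨q, X q⟩ : TangentBundle (𝓡 n) M))

variable (n M)

/-- A smooth pseudo-Riemannian metric. -/
structure PseudoRiemannianMetric [IsManifold (𝓡 n) ∞ M] where
  inner (q : M) : TangentSpace (𝓡 n) q →L[ℝ] TangentSpace (𝓡 n) q →L[ℝ] ℝ
  symm (q : M) (v w : TangentSpace (𝓡 n) q) : inner q v w = inner q w v
  nondegenerate (q : M) (v : TangentSpace (𝓡 n) q) : (∀ w, inner q v w = 0) → v = 0
  contMDiff : ContMDiff (𝓡 n) ((𝓡 n).prod 𝓘(ℝ, Coord n →L[ℝ] Coord n →L[ℝ] ℝ)) ∞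
    (fun q ↦ Bundle.TotalSpace.mk' (Coord n →L[ℝ] Coord n →L[ℝ] ℝ)
      (E := fun q : M ↦ TangentSpace (𝓡 n) q →L[ℝ] TangentSpace (𝓡 n) q →L[ℝ] ℝ) q (inner q))

variable {n M}

/-- The partial derivative `∂ᵢ f` of a function of the coordinates on `M`. -/
def pd (i : Fin n) (f : Coord n → ℝ) : Coord n → ℝ :=
  fun y ↦ fderiv ℝ f y (EuclideanSpace.single i 1)

/-- The component `Xⁱ` of a vector field on `M` in a chart. -/
def vcomp (X : VField n M) (φ : Chart n M) (i : Fin n) : Coord n → ℝ :=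
  fun y ↦ EuclideanSpace.proj (𝕜 := ℝ) i (mfderiv (𝓡 n) (𝓡 n) φ.1 (φ.1.symm y) (X (φ.1.symm y)))

namespace PseudoRiemannianMetric

variable [IsManifold (𝓡 n) ∞ M] (g : PseudoRiemannianMetric n M) (φ : Chart n M)

/-- The coefficient `g_{ij}` of the metric in a chart. -/
def coef (i j : Fin n) : Coord n → ℝ := fun y ↦
  g.inner (φ.1.symm y)
    (mfderiv (𝓡 n) (𝓡 n) φ.1.symm y (EuclideanSpace.single i 1 : Coord n))
    (mfderiv (𝓡 n) (𝓡 n) φ.1.symm y (EuclideanSpace.single j 1 : Coord n))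

/-- The coefficient `g^{ij}` of the inverse metric. -/
def inv (i j : Fin n) : Coord n → ℝ := fun y ↦
  ((Matrix.of fun a b ↦ g.coef φ a b y)⁻¹ : Matrix (Fin n) (Fin n) ℝ) i j

/-- The Christoffel symbol `Γᵏ_{ij}` of the Levi-Civita connection. -/
def christoffel (k i j : Fin n) : Coord n → ℝ := fun y ↦
  (1 / 2) * ∑ l, g.inv φ k l y *
    (pd i (g.coef φ j l) y + pd j (g.coef φ i l) y - pd l (g.coef φ i j) y)

/-- The Riemann tensor
`Rᶜ_{aij} = ∂ᵢΓᶜ_{aj} - ∂ⱼΓᶜ_{ai} + Γᶜ_{ik}Γᵏ_{aj} - Γᶜ_{jk}Γᵏ_{ai}`. -/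
def riemann (c a i j : Fin n) : Coord n → ℝ := fun y ↦
  pd i (g.christoffel φ c a j) y - pd j (g.christoffel φ c a i) y +
    ∑ k, (g.christoffel φ c i k y * g.christoffel φ k a j y
      - g.christoffel φ c j k y * g.christoffel φ k a i y)

variable (X : VField n M)

/-- `X_i = g_{ik} Xᵏ`. -/
def lower (i : Fin n) : Coord n → ℝ := fun y ↦ ∑ k, g.coef φ i k y * vcomp X φ k y

/-- `∂_{[j} X_{i]} = (∂_j X_i - ∂_i X_j) / 2`, the entry `Y_{ij}` of a skew-symmetric tensor. -/
def rot (i j : Fin n) : Coord n → ℝ := fun y ↦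
  (1 / 2) * (pd j (g.lower φ X i) y - pd i (g.lower φ X j) y)

/-- `∇_i Xʲ`. -/
def nablaX (i j : Fin n) : Coord n → ℝ := fun y ↦
  pd i (vcomp X φ j) y + ∑ k, g.christoffel φ j i k y * vcomp X φ k y

/-- `∇_i Y_{kl}` for `Y_{kl} = ∂_{[l} X_{k]}`. -/
def nablaRot (i k l : Fin n) : Coord n → ℝ := fun y ↦
  pd i (g.rot φ X k l) y
    - ∑ m, (g.christoffel φ m i k y * g.rot φ X m l y + g.christoffel φ m i l y * g.rot φ X k m y)

/-- The coefficient `(L_X g)_{ij} = Xᵏ ∂ₖ g_{ij} + g_{kj} ∂ᵢ Xᵏ + g_{ik} ∂ⱼ Xᵏ`. -/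
def lieCoef (i j : Fin n) : Coord n → ℝ := fun y ↦
  ∑ k, (vcomp X φ k y * pd k (g.coef φ i j) y + g.coef φ k j y * pd i (vcomp X φ k) y
    + g.coef φ i k y * pd j (vcomp X φ k) y)

/-- The smooth conformal vector fields: `L_X g = lam g` for a smooth function `lam` on `M`. -/
def conf : Set (VField n M) :=
  {X | IsSmooth X ∧ ∃ lam : M → ℝ, ContMDiff (𝓡 n) 𝓘(ℝ, ℝ) ∞ lam ∧
    ∀ (φ : Chart n M) (i j : Fin n), ∀ y ∈ φ.1.target,
      g.lieCoef φ X i j y = lam (φ.1.symm y) * g.coef φ i j y}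

/-! ### The forms `α` and `β`, and lifts of vector fields -/

/-- `ξ_i = g_{ij} ξʲ` at the point of coordinates `y`. -/
def xiLower (i : Fin n) (y : Coord n) : Grassmann n := ∑ j, real (g.coef φ i j y) * xi j

/-- The constant `ħ / (2 i)`. -/
def planck (hbar : ℝ) : ℂ := (hbar : ℂ) / (2 * Complex.I)

/-- `α = pᵢ dxⁱ + (ħ/2i) g_{ij} ξⁱ d^∇ξʲ`, where `d^∇ξʲ = dξʲ + Γʲ_{kl} ξᵏ dxˡ`. -/
def alpha (hbar : ℝ) : LocalForm n where
  x l := fun z ↦ real (z.2 l) + planck hbar • ∑ i, ∑ j, ∑ k,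
    real (g.coef φ i j z.1) * xi i * (real (g.christoffel φ j k l z.1) * xi k)
  p _ := fun _ ↦ 0
  xi j := fun z ↦ planck hbar • ∑ i, real (g.coef φ i j z.1) * xi i

/-- `β = g_{ij} ξⁱ dxʲ`. -/
def beta : LocalForm n where
  x j := fun z ↦ ∑ i, real (g.coef φ i j z.1) * xi i
  p _ := fun _ ↦ 0
  xi _ := fun _ ↦ 0

/-- `L_V α = 0`. -/
def PreservesAlpha (hbar : ℝ) (V : SuperVectorField n M) : Prop :=
  ∀ (φ : Chart n M) (j : Fin n), ∀ z ∈ φ.domain,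
    ((V.comp φ).lieDeriv (g.alpha φ hbar)).x j z = 0 ∧
    ((V.comp φ).lieDeriv (g.alpha φ hbar)).p j z = 0 ∧
    ((V.comp φ).lieDeriv (g.alpha φ hbar)).xi j z = 0

/-- `L_V β = f β` for some smooth function `f` on `M`. -/
def PreservesDirectionBeta (V : SuperVectorField n M) : Prop :=
  ∃ f : M → ℂ, ContMDiff (𝓡 n) 𝓘(ℝ, ℂ) ∞ f ∧
    ∀ (φ : Chart n M) (j : Fin n), ∀ z ∈ φ.domain,
      ((V.comp φ).lieDeriv (g.beta φ)).x j z = f (φ.1.symm z.1) • (g.beta φ).x j z ∧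
      ((V.comp φ).lieDeriv (g.beta φ)).p j z = f (φ.1.symm z.1) • (g.beta φ).p j z ∧
      ((V.comp φ).lieDeriv (g.beta φ)).xi j z = f (φ.1.symm z.1) • (g.beta φ).xi j z

/-- The vector field `V` projects onto the vector field `X` of `M`: `V(xⁱ) = Xⁱ(x)`. -/
def IsLift (X : VField n M) (V : SuperVectorField n M) : Prop :=
  ∀ (φ : Chart n M) (i : Fin n), ∀ z ∈ φ.domain, (V.comp φ).x i z = real (vcomp X φ i z.1)

/-- The lifts of `X` that preserve `α` and the direction of `β`. -/
def IsConformalLift (hbar : ℝ) (X : VField n M) (V : SuperVectorField n M) : Prop :=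
  IsLift X V ∧ g.PreservesAlpha hbar V ∧ g.PreservesDirectionBeta V

/-- The components in natural coordinates of
`Xⁱ ∂^∇_i + ∂_{[j} X_{i]} ξʲ ∂_{ξ_i} - pⱼ ∇_i Xʲ ∂_{p_i}
  + (ħ/2i) (Rᵏ_{lij} ξ_k ξˡ Xʲ - (∇_i ∂_{[l} X_{k]}) ξᵏ ξˡ) ∂_{p_i}`,
where `∂^∇_i = ∂_i + Γᵏ_{ij} p_k ∂_{p_j} - Γᵏ_{ij} ξʲ ∂_{ξᵏ}` and `∂_{ξ_i} = g^{ij} ∂_{ξʲ}`. -/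
def explicitLift (hbar : ℝ) : LocalField n where
  x i := fun z ↦ real (vcomp X φ i z.1)
  p i := fun z ↦
    (∑ j, ∑ k, real (vcomp X φ j z.1 * g.christoffel φ k j i z.1 * z.2 k))
    - (∑ j, real (z.2 j * g.nablaX φ X i j z.1))
    + planck hbar • ((∑ k, ∑ l, ∑ j,
        real (g.riemann φ k l i j z.1) * g.xiLower φ k z.1 * xi l * real (vcomp X φ j z.1))
      - ∑ k, ∑ l, real (g.nablaRot φ X i k l z.1) * xi k * xi l)
  xi k := fun z ↦
    (∑ i, ∑ j, real (g.inv φ i k z.1 * g.rot φ X i j z.1) * xi j)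
    - ∑ i, ∑ j, real (vcomp X φ i z.1 * g.christoffel φ k i j z.1) * xi j

/-- The vector field `V` is given by the explicit formula in all natural coordinates. -/
def IsExplicitLift (hbar : ℝ) (X : VField n M) (V : SuperVectorField n M) : Prop :=
  ∀ (φ : Chart n M) (i : Fin n), ∀ z ∈ φ.domain,
    (V.comp φ).x i z = (g.explicitLift φ X hbar).x i z ∧
    (V.comp φ).p i z = (g.explicitLift φ X hbar).p i z ∧
    (V.comp φ).xi i z = (g.explicitLift φ X hbar).xi i z

end PseudoRiemannianMetric

end Manifold

end Supercotangent

end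

noncomputable section

namespace Supercotangent
variable {n : ℕ}

/-! ### Algebra of the Grassmann algebra -/

/-! A lift V has V(xⁱ) = Xⁱ, so its unknowns are the odd components V(ξᵏ) and the momentum
components V(pₗ). The dx part of L_V β = f β is a linear system for the V(ξᵏ) with matrix g; hence
they are linear in ξ and determined by f (`sum_coef_mul_xi_of_lieDeriv_beta`). Inserted in the dξ
part of L_V α = 0, where ħ ≠ 0 allows cancelling ħ/2i, this leaves exactly L_X g = 2 f g
(`lieCoef_of_lieDeriv`). So X is conformal, with factor λ = 2 Re f, and V(ξᵏ) = Aᵏₘ ξᵐ with A = ∂X −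
½λ (`confMatrix`, `xi_eq`). The dx part of L_V α = 0 contains V(pₗ) with coefficient 1 and no other
unknown, so it determines V(pₗ) (`lieDeriv_alpha_x_eq_zero_iff`). This is uniqueness.

The ξξ-term of V(pₗ) is governed by `lieChristoffel`, which is evaluated in two ways. The Koszul
combination of the differentiated Killing equation reduces it to g and dλ
(`lieChristoffel_conformal`); this is the compact form `confLift`, with V(pⱼ) = −pᵢ ∂ⱼXⁱ − (ħ/2i) ξⱼ
∂ₘλ ξᵐ. Lowering an index of A and using ∇g = 0 turns it instead into ∇ of the rotation of X minus a
curvature term (`lieChristoffel_eq_curvature`), which is the explicit formula. Existence rests on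
the compact form: ξⱼ and dλ are tensorial, so the local fields agree on overlaps of charts
(`confLift_transform_p`, `IsConformalFactor.lift`).

For the Lie algebra statement, the Killing equation is read as X(G) + AᵀG + GA = 0, a condition on
the pair (X, A) that is stable under brackets (`bracket_skew`, `confMatrix_mlieBracket`); the
bracket has conformal factor Xμ − Yλ. The commutator of two even fields is again a first-order
operator, determined by its values on the coordinates (`IsEvenAt.commutator_apply`), so the morphism
property is a comparison of components (`confLift_mlieBracket_apply`). Uniqueness transfers it from
`confLift` to any choice of conformal lifts. -/

/-- The left derivative along `ξⁱ` on the Grassmann algebra. -/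
def leftDeriv (i : Fin n) : Grassmann n →ₗ[ℂ] Grassmann n :=
  CliffordAlgebra.contractLeft (Q := (0 : QuadraticForm ℂ (Fin n → ℂ))) (LinearMap.proj i)

/-- The odd linear element `∑ mᵢ ξⁱ`. -/
def iota : (Fin n → ℂ) →ₗ[ℂ] Grassmann n := ExteriorAlgebra.ι ℂ

lemma xi_eq_iota (i : Fin n) : (xi i : Grassmann n) = iota (Pi.single i 1) := rfl

/-- The grading automorphism of the Grassmann algebra. -/
def grade : Grassmann n →ₐ[ℂ] Grassmann n :=
  CliffordAlgebra.involute (Q := (0 : QuadraticForm ℂ (Fin n → ℂ)))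

lemma dXi_apply (i : Fin n) (F : SFun n) (z : Coord n × Coord n) :
    dXi i F z = leftDeriv i (F z) := rfl

lemma grassmann_induction {P : Grassmann n → Prop}
    (scalar : ∀ r : ℂ, P (algebraMap ℂ (Grassmann n) r))
    (add : ∀ a b, P a → P b → P (a + b))
    (mul : ∀ (m : Fin n → ℂ) (a : Grassmann n), P a → P (iota m * a))
    (a : Grassmann n) : P a :=
  CliffordAlgebra.left_induction (Q := (0 : QuadraticForm ℂ (Fin n → ℂ)))
    (P := P) scalar add (fun x m h ↦ mul m x h) a

lemma leftDeriv_iota_mul (i : Fin n) (m : Fin n → ℂ) (a : Grassmann n) :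
    leftDeriv i (iota m * a)
      = m i • a - iota m * leftDeriv i a :=
  CliffordAlgebra.contractLeft_ι_mul (Q := (0 : QuadraticForm ℂ (Fin n → ℂ))) _ _ _

lemma leftDeriv_algebraMap_mul (i : Fin n) (r : ℂ) (a : Grassmann n) :
    leftDeriv i (algebraMap ℂ (Grassmann n) r * a) = algebraMap ℂ (Grassmann n) r * leftDeriv i a :=
  CliffordAlgebra.contractLeft_algebraMap_mul (Q := (0 : QuadraticForm ℂ (Fin n → ℂ))) _ _ _

lemma leftDeriv_algebraMap (i : Fin n) (r : ℂ) :
    leftDeriv i (algebraMap ℂ (Grassmann n) r) = 0 :=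
  CliffordAlgebra.contractLeft_algebraMap (Q := (0 : QuadraticForm ℂ (Fin n → ℂ))) _ _

lemma leftDeriv_comm (i j : Fin n) (a : Grassmann n) :
    leftDeriv i (leftDeriv j a) = -leftDeriv j (leftDeriv i a) :=
  CliffordAlgebra.contractLeft_comm (Q := (0 : QuadraticForm ℂ (Fin n → ℂ))) _ _ _

lemma grade_iota (m : Fin n → ℂ) :
    grade (iota m) = -iota m :=
  CliffordAlgebra.involute_ι (Q := (0 : QuadraticForm ℂ (Fin n → ℂ))) _

lemma grade_even {a : Grassmann n} (h : a ∈ parity n 0) : grade a = a :=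
  CliffordAlgebra.involute_eq_of_mem_even (Q := (0 : QuadraticForm ℂ (Fin n → ℂ))) h

lemma grade_odd {a : Grassmann n} (h : a ∈ parity n 1) : grade a = -a :=
  CliffordAlgebra.involute_eq_of_mem_odd (Q := (0 : QuadraticForm ℂ (Fin n → ℂ))) h

lemma iota_mul_iota (m m' : Fin n → ℂ) :
    iota m * iota m'
      = -(iota m' * iota m) :=
  eq_neg_of_add_eq_zero_left (ExteriorAlgebra.ι_add_mul_swap (R := ℂ) m m')

/-- The left derivatives are odd derivations. -/
lemma leftDeriv_mul (i : Fin n) (a b : Grassmann n) :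
    leftDeriv i (a * b) = leftDeriv i a * b + grade a * leftDeriv i b := by
  induction a using grassmann_induction with
  | scalar r => simp [leftDeriv_algebraMap_mul, leftDeriv_algebraMap]
  | add a a' h h' => simp only [add_mul, map_add, h, h']; abel
  | mul m a h =>
    rw [mul_assoc, leftDeriv_iota_mul, leftDeriv_iota_mul, h, map_mul, grade_iota]
    simp only [mul_add, sub_mul, smul_mul_assoc, neg_mul, mul_assoc]
    abel

/-- Each generator crossed costs one sign, and `grade` records them all at once. The commutation
rules `even_mul_comm` and `odd_mul` follow by moving one generator at a time. -/
lemma iota_mul (m : Fin n → ℂ) (a : Grassmann n) :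
    iota m * a = grade a * iota m := by
  induction a using grassmann_induction with
  | scalar r => simp [Algebra.commutes]
  | add a a' h h' => simp only [add_mul, mul_add, map_add, h, h']
  | mul m' a h =>
    rw [← mul_assoc, iota_mul_iota, map_mul, grade_iota, neg_mul, mul_assoc, h]
    simp [mul_assoc]

lemma even_mul_comm {a : Grassmann n} (h : a ∈ parity n 0) (b : Grassmann n) : a * b = b * a := by
  induction b using grassmann_induction with
  | scalar r => exact (Algebra.commutes r a).symm
  | add b b' h h' => simp only [add_mul, mul_add, h, h']
  | mul m b hb =>
    rw [mul_assoc, ← hb, ← mul_assoc, ← mul_assoc, iota_mul, grade_even h]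

lemma odd_mul {a : Grassmann n} (h : a ∈ parity n 1) (b : Grassmann n) :
    a * b = grade b * a := by
  induction b using grassmann_induction with
  | scalar r => simpa using (Algebra.commutes r a).symm
  | add b b' h h' => simp only [add_mul, mul_add, map_add, h, h']
  | mul m b hb =>
    rw [map_mul, mul_assoc, ← hb, ← mul_assoc, ← mul_assoc, grade_iota, neg_mul, iota_mul,
      grade_odd h]
    simp

lemma xi_mem_parity (i : Fin n) : (xi i : Grassmann n) ∈ parity n 1 :=
  CliffordAlgebra.ι_mem_evenOdd_one (0 : QuadraticForm ℂ (Fin n → ℂ)) _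

lemma algebraMap_mem_parity (r : ℂ) : algebraMap ℂ (Grassmann n) r ∈ parity n 0 :=
  (SetLike.algebraMap_mem_graded (CliffordAlgebra.evenOdd (0 : QuadraticForm ℂ (Fin n → ℂ))) r)

lemma mul_mem_parity {a b : Grassmann n} {s t : ZMod 2} (ha : a ∈ parity n s)
    (hb : b ∈ parity n t) : a * b ∈ parity n (s + t) :=
  SetLike.mul_mem_graded (A := CliffordAlgebra.evenOdd (0 : QuadraticForm ℂ (Fin n → ℂ))) ha hb

/-- `real` as a morphism of algebras. -/
def realHom : ℝ →+* Grassmann n := (algebraMap ℂ (Grassmann n)).comp Complex.ofRealHom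

lemma real_eq (r : ℝ) : (real r : Grassmann n) = realHom r := rfl

lemma real_add (r s : ℝ) : (real (r + s) : Grassmann n) = real r + real s := by simp [real_eq]
lemma real_sub (r s : ℝ) : (real (r - s) : Grassmann n) = real r - real s := by simp [real_eq]
lemma real_neg (r : ℝ) : (real (-r) : Grassmann n) = -real r := by simp [real_eq]
lemma real_mul (r s : ℝ) : (real (r * s) : Grassmann n) = real r * real s := by simp [real_eq]
lemma real_zero : (real 0 : Grassmann n) = 0 := by simp [real_eq]
lemma real_one : (real 1 : Grassmann n) = 1 := by simp [real_eq]
lemma real_sum {ι : Type*} (s : Finset ι) (f : ι → ℝ) :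
    (real (∑ i ∈ s, f i) : Grassmann n) = ∑ i ∈ s, real (f i) := by simp [real_eq]

lemma real_mem_parity (r : ℝ) : (real r : Grassmann n) ∈ parity n 0 := algebraMap_mem_parity _

lemma real_comm (r : ℝ) (a : Grassmann n) : a * real r = real r * a :=
  (Algebra.commutes (r : ℂ) a).symm

lemma real_mul_eq_smul (r : ℝ) (a : Grassmann n) : real r * a = (r : ℂ) • a :=
  (Algebra.smul_def (r : ℂ) a).symm

lemma real_smul_eq (r : ℝ) (a : Grassmann n) : r • a = real r * a := by
  rw [real_mul_eq_smul]; rfl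

lemma leftDeriv_real (i : Fin n) (r : ℝ) : leftDeriv i (real r : Grassmann n) = 0 :=
  leftDeriv_algebraMap _ _

lemma leftDeriv_real_mul (i : Fin n) (r : ℝ) (a : Grassmann n) :
    leftDeriv i (real r * a) = real r * leftDeriv i a :=
  leftDeriv_algebraMap_mul _ _ _

lemma leftDeriv_xi (i j : Fin n) :
    leftDeriv i (xi j : Grassmann n) = if i = j then 1 else 0 := by
  have := leftDeriv_iota_mul i (Pi.single j 1) 1
  have h1 : leftDeriv i (1 : Grassmann n) = 0 := by simpa using leftDeriv_algebraMap i (1 : ℂ)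
  rw [mul_one, h1, mul_zero, sub_zero] at this
  rw [xi_eq_iota, this, Pi.single_apply]
  split_ifs <;> simp

/-- Linear combinations of the `ξⁱ` with different coefficients are different. -/
lemma sum_real_mul_xi_injective {a b : Fin n → ℂ}
    (h : ∑ i, a i • (xi i : Grassmann n) = ∑ i, b i • xi i) (i : Fin n) : a i = b i := by
  -- The left derivative along ξⁱ turns a linear combination of the generators into its i-th
  -- coefficient, as a scalar.
  have h2 := congrArg (leftDeriv i) h
  simp only [map_sum, map_smul, leftDeriv_xi, smul_ite, smul_zero, Finset.sum_ite_eq,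
    Finset.mem_univ, if_true] at h2
  rw [← Algebra.algebraMap_eq_smul_one, ← Algebra.algebraMap_eq_smul_one] at h2
  exact (ExteriorAlgebra.algebraMap_leftInverse (R := ℂ) (Fin n → ℂ)).injective h2

/-- Finite dimension makes multiplication and all linear endomorphisms continuous, so the usual
product and chain rules apply to Grassmann valued maps. -/
instance : FiniteDimensional ℂ (Grassmann n) :=
  Module.Finite.equiv (coeffs n).symm

/-- The multiplication of the Grassmann algebra is a continuous bilinear map. -/
lemma isBoundedBilinearMap_mul :
    IsBoundedBilinearMap ℝ (fun p : Grassmann n × Grassmann n ↦ p.1 * p.2) := by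
  have : FiniteDimensional ℝ (Grassmann n) := FiniteDimensional.complexToReal _
  let f : Grassmann n →ₗ[ℝ] (Grassmann n →L[ℝ] Grassmann n) :=
    LinearMap.toContinuousLinearMap.toLinearMap ∘ₗ LinearMap.mul ℝ (Grassmann n)
  exact (LinearMap.toContinuousLinearMap f).isBoundedBilinearMap

/-- `realHom` as a continuous linear map. -/
def realCLM : ℝ →L[ℝ] Grassmann n :=
  LinearMap.toContinuousLinearMap
    { toFun := real
      map_add' := real_add
      map_smul' := fun r s ↦ by simp [real_smul_eq, real_mul] }

/-- A complex linear endomorphism of the Grassmann algebra is continuous and real linear. -/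
def realLinear (f : Grassmann n →ₗ[ℂ] Grassmann n) : Grassmann n →L[ℝ] Grassmann n :=
  (LinearMap.toContinuousLinearMap f).restrictScalars ℝ

end Supercotangent

namespace Supercotangent
variable {n : ℕ}

/-! ### Calculus of superfunctions in natural coordinates -/

open Filter Topology

lemma fderiv_grassmann_mul {E : Type*} [NormedAddCommGroup E] [NormedSpace ℝ E]
    {F G : E → Grassmann n} {z : E} (hF : DifferentiableAt ℝ F z) (hG : DifferentiableAt ℝ G z)
    (v : E) :
    fderiv ℝ (fun z ↦ F z * G z) z v = fderiv ℝ F z v * G z + F z * fderiv ℝ G z v := by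
  have h := (isBoundedBilinearMap_mul (n := n).hasFDerivAt (F z, G z)).comp z
    (hF.hasFDerivAt.prodMk hG.hasFDerivAt)
  have h2 : HasFDerivAt (fun z ↦ F z * G z) _ z := h
  rw [h2.fderiv]
  simp [add_comm]

lemma grassmann_mul_differentiableAt {E : Type*} [NormedAddCommGroup E] [NormedSpace ℝ E]
    {F G : E → Grassmann n} {z : E} (hF : DifferentiableAt ℝ F z) (hG : DifferentiableAt ℝ G z) :
    DifferentiableAt ℝ (fun z ↦ F z * G z) z :=
  DifferentiableAt.comp (g := fun p : Grassmann n × Grassmann n ↦ p.1 * p.2) z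
    ((isBoundedBilinearMap_mul (n := n)).differentiableAt (F z, G z)) (hF.prodMk hG)

lemma grassmann_mul_contDiffOn {E : Type*} [NormedAddCommGroup E] [NormedSpace ℝ E]
    {F G : E → Grassmann n} {s : Set E} (hF : ContDiffOn ℝ ∞ F s) (hG : ContDiffOn ℝ ∞ G s) :
    ContDiffOn ℝ ∞ (fun z ↦ F z * G z) s :=
  (isBoundedBilinearMap_mul (n := n)).contDiff.comp_contDiffOn (hF.prodMk hG)

lemma real_contDiffOn {E : Type*} [NormedAddCommGroup E] [NormedSpace ℝ E]
    {f : E → ℝ} {s : Set E} (hf : ContDiffOn ℝ ∞ f s) :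
    ContDiffOn ℝ ∞ (fun z ↦ (real (f z) : Grassmann n)) s :=
  (realCLM (n := n)).contDiff.comp_contDiffOn hf

lemma real_differentiableAt {E : Type*} [NormedAddCommGroup E] [NormedSpace ℝ E]
    {f : E → ℝ} {z : E} (hf : DifferentiableAt ℝ f z) :
    DifferentiableAt ℝ (fun z ↦ (real (f z) : Grassmann n)) z :=
  (realCLM (n := n)).differentiableAt.comp z hf

lemma fderiv_real {E : Type*} [NormedAddCommGroup E] [NormedSpace ℝ E]
    {f : E → ℝ} {z : E} (hf : DifferentiableAt ℝ f z) (v : E) :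
    fderiv ℝ (fun z ↦ (real (f z) : Grassmann n)) z v = real (fderiv ℝ f z v) := by
  have h : HasFDerivAt (fun z ↦ (real (f z) : Grassmann n)) _ z :=
    (realCLM (n := n)).hasFDerivAt.comp z hf.hasFDerivAt
  rw [h.fderiv]
  rfl

lemma leftDeriv_differentiableAt {E : Type*} [NormedAddCommGroup E] [NormedSpace ℝ E]
    {F : E → Grassmann n} {z : E} (hF : DifferentiableAt ℝ F z) (i : Fin n) :
    DifferentiableAt ℝ (fun z ↦ leftDeriv i (F z)) z :=
  (realLinear (leftDeriv i)).differentiableAt.comp z hF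

lemma fderiv_leftDeriv {E : Type*} [NormedAddCommGroup E] [NormedSpace ℝ E]
    {F : E → Grassmann n} {z : E} (hF : DifferentiableAt ℝ F z) (i : Fin n) (v : E) :
    fderiv ℝ (fun z ↦ leftDeriv i (F z)) z v = leftDeriv i (fderiv ℝ F z v) := by
  have h : HasFDerivAt (fun z ↦ leftDeriv i (F z)) _ z :=
    (realLinear (leftDeriv i)).hasFDerivAt.comp z hF.hasFDerivAt
  rw [h.fderiv]
  rfl

/-- A local vector field is even at a point if its components have the parities of the
coordinates. -/
structure LocalField.IsEvenAt (V : LocalField n) (z : Coord n × Coord n) : Prop where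
  x (i : Fin n) : V.x i z ∈ parity n 0
  p (i : Fin n) : V.p i z ∈ parity n 0
  xi (i : Fin n) : V.xi i z ∈ parity n 1

/-- The components of a local vector field are differentiable at a point. -/
structure LocalField.DiffAt (V : LocalField n) (z : Coord n × Coord n) : Prop where
  x (i : Fin n) : DifferentiableAt ℝ (V.x i) z
  p (i : Fin n) : DifferentiableAt ℝ (V.p i) z
  xi (i : Fin n) : DifferentiableAt ℝ (V.xi i) z

namespace LocalField

variable (V W : LocalField n) {F G : SFun n} {z : Coord n × Coord n}

lemma apply_congr (h : F =ᶠ[𝓝 z] G) : V.apply F z = V.apply G z := by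
  simp only [apply, dX, dP, dXi, h.fderiv_eq, h.eq_of_nhds]

lemma apply_add (hF : DifferentiableAt ℝ F z) (hG : DifferentiableAt ℝ G z) :
    V.apply (fun z ↦ F z + G z) z = V.apply F z + V.apply G z := by
  simp only [apply, dX, dP, dXi_apply, fderiv_fun_add hF hG, _root_.add_apply, map_add,
    ← Finset.sum_add_distrib]
  refine Finset.sum_congr rfl fun i _ ↦ ?_
  simp only [mul_add]
  abel

lemma apply_sum {ι : Type*} (s : Finset ι) {F : ι → SFun n}
    (hF : ∀ i ∈ s, DifferentiableAt ℝ (F i) z) :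
    V.apply (fun z ↦ ∑ i ∈ s, F i z) z = ∑ i ∈ s, V.apply (F i) z := by
  simp only [apply, dX, dP, dXi_apply, fderiv_fun_sum hF, _root_.sum_apply, map_sum,
    Finset.mul_sum, ← Finset.sum_add_distrib]
  exact Finset.sum_comm

lemma apply_smul (c : ℂ) (hF : DifferentiableAt ℝ F z) :
    V.apply (fun z ↦ c • F z) z = c • V.apply F z := by
  simp only [apply, dX, dP, dXi_apply, fderiv_fun_const_smul hF c, _root_.smul_apply,
    map_smul, Finset.smul_sum, smul_add, mul_smul_comm]

lemma apply_neg : V.apply (fun z ↦ -F z) z = -V.apply F z := by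
  simp only [apply, dX, dP, dXi_apply, fderiv_fun_neg, _root_.neg_apply,
    map_neg, mul_neg, ← neg_add, Finset.sum_neg_distrib]

lemma apply_sub (hF : DifferentiableAt ℝ F z) (hG : DifferentiableAt ℝ G z) :
    V.apply (fun z ↦ F z - G z) z = V.apply F z - V.apply G z := by
  simp only [sub_eq_add_neg]
  rw [V.apply_add hF hG.fun_neg, apply_neg]

variable {V} in
/-- Even vector fields are derivations. -/
lemma IsEvenAt.apply_mul (hV : V.IsEvenAt z) (hF : DifferentiableAt ℝ F z)
    (hG : DifferentiableAt ℝ G z) :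
    V.apply (fun z ↦ F z * G z) z = V.apply F z * G z + F z * V.apply G z := by
  simp only [apply, dX, dP, dXi_apply, fderiv_grassmann_mul hF hG, leftDeriv_mul, Finset.sum_mul,
    Finset.mul_sum, ← Finset.sum_add_distrib]
  refine Finset.sum_congr rfl fun i _ ↦ ?_
  have h1 := even_mul_comm (hV.x i) (F z)
  have h2 := even_mul_comm (hV.p i) (F z)
  -- The `grade` in the odd Leibniz rule of ∂/∂ξ is undone by moving the odd coefficient of V across
  -- `F`; this is why an even field has no sign in its Leibniz rule.
  have h3 : V.xi i z * grade (F z) = F z * V.xi i z := by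
    rw [odd_mul (hV.xi i)]
    congr 1
    exact CliffordAlgebra.involute_involute (Q := (0 : QuadraticForm ℂ (Fin n → ℂ))) (F z)
  simp only [mul_add, add_mul, ← mul_assoc, h1, h2, h3]
  abel

lemma apply_real {h : Coord n → ℝ} (hh : DifferentiableAt ℝ h z.1) :
    V.apply (fun z ↦ real (h z.1)) z = ∑ i, V.x i z * real (pd i h z.1) := by
  have h0 : HasFDerivAt (fun z : Coord n × Coord n ↦ h z.1) _ z :=
    hh.hasFDerivAt.comp z hasFDerivAt_fst
  simp only [apply, dX, dP, dXi_apply, fderiv_real h0.differentiableAt, h0.fderiv, leftDeriv_real,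
    mul_zero, add_zero, pd]
  simp [real_zero]

lemma apply_real_p (i : Fin n) : V.apply (fun z ↦ real (z.2 i)) z = V.p i z := by
  have h0 : HasFDerivAt (fun z : Coord n × Coord n ↦ z.2 i) _ z :=
    ((EuclideanSpace.proj (𝕜 := ℝ) i).hasFDerivAt).comp z hasFDerivAt_snd
  simp only [apply, dX, dP, dXi_apply, fderiv_real h0.differentiableAt, h0.fderiv, leftDeriv_real,
    mul_zero, add_zero]
  simp only [ContinuousLinearMap.comp_apply, ContinuousLinearMap.coe_snd', map_zero, real_zero,
    mul_zero, zero_add]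
  rw [Finset.sum_eq_single i]
  · simp [real_one]
  · intro j _ hj
    simp [hj.symm, real_zero]
  · simp

lemma apply_const (a : Grassmann n) :
    V.apply (fun _ ↦ a) z = ∑ i, V.xi i z * leftDeriv i a := by
  simp [apply, dX, dP, dXi_apply]

lemma apply_xi (i : Fin n) : V.apply (fun _ ↦ Supercotangent.xi i) z = V.xi i z := by
  simp [apply_const, leftDeriv_xi]

/-- Symmetry of second derivatives, together with the fact that ∂/∂ξ is a constant linear map and so
commutes with the derivatives in x and p. -/
lemma apply_fderiv_comm {v : Coord n × Coord n} (hF : ContDiffAt ℝ ∞ F z) :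
    V.apply (fun w ↦ fderiv ℝ F w v) z =
      ∑ i, (V.x i z * fderiv ℝ (dX i F) z v + V.p i z * fderiv ℝ (dP i F) z v
        + V.xi i z * fderiv ℝ (dXi i F) z v) := by
  have h1 : DifferentiableAt ℝ (fderiv ℝ F) z :=
    (hF.fderiv_right (m := 1) (by norm_cast)).differentiableAt (by simp)
  have h2 (v w : Coord n × Coord n) :
      fderiv ℝ (fun z ↦ fderiv ℝ F z v) z w = fderiv ℝ (fderiv ℝ F) z w v := by
    rw [fderiv_clm_apply h1 (differentiableAt_const v)]
    simp
  have h3 : IsSymmSndFDerivAt ℝ F z := hF.isSymmSndFDerivAt (by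
    rw [minSmoothness_of_isRCLikeNormedField]
    exact WithTop.coe_le_coe.2 (le_top : (2 : ℕ∞) ≤ ⊤))
  have h4 : DifferentiableAt ℝ F z := hF.differentiableAt (by simp)
  refine Finset.sum_congr rfl fun i _ ↦ ?_
  have h5 : fderiv ℝ (dXi i F) z v = leftDeriv i (fderiv ℝ F z v) := fderiv_leftDeriv h4 i v
  rw [h5]
  unfold dX dP
  rw [h2, h2, h2, h2, h3.eq v (EuclideanSpace.single i 1, 0), h3.eq v (0, EuclideanSpace.single i 1)]
  rfl

/-- The odd counterpart: ∂/∂ξᵏ commutes with the even derivatives but anticommutes with ∂/∂ξⁱ, hence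
the minus sign on the last term. -/
lemma apply_leftDeriv_comm {k : Fin n} (hF : DifferentiableAt ℝ F z) :
    V.apply (dXi k F) z =
      ∑ i, (V.x i z * leftDeriv k (dX i F z) + V.p i z * leftDeriv k (dP i F z)
        - V.xi i z * leftDeriv k (dXi i F z)) := by
  refine Finset.sum_congr rfl fun i _ ↦ ?_
  have h (v) : fderiv ℝ (dXi k F) z v = leftDeriv k (fderiv ℝ F z v) := fderiv_leftDeriv hF k v
  simp only [dX, dP, h, dXi_apply, leftDeriv_comm i k]
  simp [sub_eq_add_neg]

variable {V W} in
/-- The second order part of the composition of two even vector fields is symmetric. -/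
lemma IsEvenAt.second_order_comm (hV : V.IsEvenAt z) (hW : W.IsEvenAt z)
    (hF : ContDiffAt ℝ ∞ F z) :
    ∑ i, (W.x i z * V.apply (dX i F) z + W.p i z * V.apply (dP i F) z
        + W.xi i z * V.apply (dXi i F) z) =
      ∑ i, (V.x i z * W.apply (dX i F) z + V.p i z * W.apply (dP i F) z
        + V.xi i z * W.apply (dXi i F) z) := by
  have hd : DifferentiableAt ℝ F z := hF.differentiableAt (by simp)
  have key (i j : Fin n) :
      (W.x i z * (V.x j z * dX i (dX j F) z + V.p j z * dX i (dP j F) z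
        + V.xi j z * dX i (dXi j F) z) +
      W.p i z * (V.x j z * dP i (dX j F) z + V.p j z * dP i (dP j F) z
        + V.xi j z * dP i (dXi j F) z) +
      W.xi i z * (V.x j z * leftDeriv i (dX j F z) + V.p j z * leftDeriv i (dP j F z)
        - V.xi j z * leftDeriv i (dXi j F z))) =
      (V.x j z * (W.x i z * dX i (dX j F) z + W.p i z * dP i (dX j F) z
        + W.xi i z * leftDeriv i (dX j F z)) +
      V.p j z * (W.x i z * dX i (dP j F) z + W.p i z * dP i (dP j F) z
        + W.xi i z * leftDeriv i (dP j F z)) +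
      V.xi j z * (W.x i z * dX i (dXi j F) z + W.p i z * dP i (dXi j F) z
        + W.xi i z * leftDeriv i (dXi j F z))) := by
    -- The odd components anticommute, which compensates the anticommutation of the two
    -- ξ-derivatives.
    have o : W.xi i z * V.xi j z = -(V.xi j z * W.xi i z) := by
      rw [odd_mul (hW.xi i), grade_odd (hV.xi j), neg_mul]
    have c1 (a d : Grassmann n) : a * (V.x j z * d) = V.x j z * (a * d) := by
      rw [← mul_assoc, ← even_mul_comm (hV.x j), mul_assoc]
    have c2 (a d : Grassmann n) : a * (V.p j z * d) = V.p j z * (a * d) := by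
      rw [← mul_assoc, ← even_mul_comm (hV.p j), mul_assoc]
    have c3 (d : Grassmann n) : V.xi j z * (W.x i z * d) = W.x i z * (V.xi j z * d) := by
      rw [← mul_assoc, ← even_mul_comm (hW.x i), mul_assoc]
    have c4 (d : Grassmann n) : V.xi j z * (W.p i z * d) = W.p i z * (V.xi j z * d) := by
      rw [← mul_assoc, ← even_mul_comm (hW.p i), mul_assoc]
    have c5 (d : Grassmann n) : W.xi i z * (V.xi j z * d) = -(V.xi j z * (W.xi i z * d)) := by
      rw [← mul_assoc, o, neg_mul, mul_assoc]
    simp only [mul_add, mul_sub, c1, c2, c3, c4, c5]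
    abel
  have e1 (i : Fin n) : V.apply (dX i F) z = _ := V.apply_fderiv_comm hF
  have e2 (i : Fin n) : V.apply (dP i F) z = _ := V.apply_fderiv_comm hF
  simp only [e1, e2, V.apply_leftDeriv_comm hd, Finset.mul_sum, ← Finset.sum_add_distrib]
  rw [Finset.sum_comm]
  refine Finset.sum_congr rfl fun j _ ↦ ?_
  simp only [LocalField.apply, Finset.mul_sum, ← Finset.sum_add_distrib]
  exact Finset.sum_congr rfl fun i _ ↦ key i j

variable {V W} in
-- The Leibniz rule splits the composite into a first-order operator, with coefficients V applied to
-- the components of W, and a second-order part. The latter drops out of the commutator by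
-- `second_order_comm`.
lemma IsEvenAt.apply_apply (hV : V.IsEvenAt z) (hWd : W.DiffAt z) (hF : ContDiffAt ℝ ∞ F z) :
    V.apply (W.apply F) z = ∑ i, (V.apply (W.x i) z * dX i F z + V.apply (W.p i) z * dP i F z
        + V.apply (W.xi i) z * dXi i F z) +
      ∑ i, (W.x i z * V.apply (dX i F) z + W.p i z * V.apply (dP i F) z
        + W.xi i z * V.apply (dXi i F) z) := by
  have h1 : DifferentiableAt ℝ (fderiv ℝ F) z :=
    (hF.fderiv_right (m := 1) (by norm_cast)).differentiableAt (by simp)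
  have hd : DifferentiableAt ℝ F z := hF.differentiableAt (by simp)
  have d1 (i : Fin n) : DifferentiableAt ℝ (dX i F) z := h1.clm_apply (differentiableAt_const _)
  have d2 (i : Fin n) : DifferentiableAt ℝ (dP i F) z := h1.clm_apply (differentiableAt_const _)
  have d3 (i : Fin n) : DifferentiableAt ℝ (dXi i F) z := leftDeriv_differentiableAt hd i
  have m1 (i : Fin n) := grassmann_mul_differentiableAt (hWd.x i) (d1 i)
  have m2 (i : Fin n) := grassmann_mul_differentiableAt (hWd.p i) (d2 i)
  have m3 (i : Fin n) := grassmann_mul_differentiableAt (hWd.xi i) (d3 i)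
  have h : V.apply (W.apply F) z = V.apply (fun z ↦ ∑ i, (W.x i z * dX i F z + W.p i z * dP i F z
    + W.xi i z * dXi i F z)) z := rfl
  rw [h, V.apply_sum _ fun i _ ↦ ((m1 i).fun_add (m2 i)).fun_add (m3 i), ← Finset.sum_add_distrib]
  refine Finset.sum_congr rfl fun i _ ↦ ?_
  rw [V.apply_add ((m1 i).fun_add (m2 i)) (m3 i), V.apply_add (m1 i) (m2 i),
    hV.apply_mul (hWd.x i) (d1 i), hV.apply_mul (hWd.p i) (d2 i), hV.apply_mul (hWd.xi i) (d3 i)]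
  abel

variable {V W} in
/-- The commutator of two even vector fields is the vector field whose components are the
commutators applied to the coordinates. -/
lemma IsEvenAt.commutator_apply (hV : V.IsEvenAt z) (hW : W.IsEvenAt z) (hVd : V.DiffAt z)
    (hWd : W.DiffAt z) (hF : ContDiffAt ℝ ∞ F z) :
    V.apply (W.apply F) z - W.apply (V.apply F) z =
      ∑ i, ((V.apply (W.x i) z - W.apply (V.x i) z) * dX i F z
        + (V.apply (W.p i) z - W.apply (V.p i) z) * dP i F z
        + (V.apply (W.xi i) z - W.apply (V.xi i) z) * dXi i F z) := by
  rw [hV.apply_apply hWd hF, hW.apply_apply hVd hF, hV.second_order_comm hW hF,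
    add_sub_add_right_eq_sub, ← Finset.sum_sub_distrib]
  refine Finset.sum_congr rfl fun i _ ↦ ?_
  simp only [sub_mul]
  abel

end LocalField

end Supercotangent

namespace Supercotangent
variable {n : ℕ}

/-! ### Charts, vector fields and metrics in coordinates -/

open Filter Topology

variable {M : Type*} [TopologicalSpace M] [ChartedSpace (Coord n) M]

lemma Chart.isOpen_target (φ : Chart n M) : IsOpen φ.1.target := φ.1.open_target

lemma Chart.isOpen_domain (φ : Chart n M) : IsOpen φ.domain :=
  φ.isOpen_target.prod isOpen_univ

/-- The part of the domain of the chart `φ` where the chart `ψ` is defined. -/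
def Chart.overlap (φ ψ : Chart n M) : Set (Coord n) := (φ.1.symm.trans ψ.1).source

lemma Chart.mem_overlap {φ ψ : Chart n M} {y : Coord n} :
    y ∈ φ.overlap ψ ↔ y ∈ φ.1.target ∧ φ.1.symm y ∈ ψ.1.source := by
  simp [Chart.overlap]

lemma Chart.isOpen_overlap (φ ψ : Chart n M) : IsOpen (φ.overlap ψ) :=
  (φ.1.symm.trans ψ.1).open_source

lemma Chart.symm_transition {φ ψ : Chart n M} {y : Coord n} (hy : y ∈ φ.overlap ψ) :
    ψ.1.symm (φ.transition ψ y) = φ.1.symm y :=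
  ψ.1.left_inv (Chart.mem_overlap.1 hy).2

lemma Chart.transition_mem_target {φ ψ : Chart n M} {y : Coord n} (hy : y ∈ φ.overlap ψ) :
    φ.transition ψ y ∈ ψ.1.target :=
  ψ.1.map_source (Chart.mem_overlap.1 hy).2

lemma Chart.transition_mem_overlap {φ ψ : Chart n M} {y : Coord n} (hy : y ∈ φ.overlap ψ) :
    φ.transition ψ y ∈ ψ.overlap φ := by
  rw [Chart.mem_overlap, Chart.symm_transition hy]
  exact ⟨Chart.transition_mem_target hy, φ.1.map_target (Chart.mem_overlap.1 hy).1⟩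

lemma Chart.transition_transition {φ ψ : Chart n M} {y : Coord n} (hy : y ∈ φ.overlap ψ) :
    ψ.transition φ (φ.transition ψ y) = y := by
  rw [Chart.transition, Chart.symm_transition hy]
  exact φ.1.right_inv (Chart.mem_overlap.1 hy).1

lemma Chart.contMDiffOn (φ : Chart n M) : ContMDiffOn (𝓡 n) (𝓡 n) ∞ φ.1 φ.1.source :=
  contMDiffOn_of_mem_maximalAtlas φ.2

lemma Chart.contMDiffOn_symm (φ : Chart n M) :
    ContMDiffOn (𝓡 n) (𝓡 n) ∞ φ.1.symm φ.1.target :=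
  contMDiffOn_symm_of_mem_maximalAtlas φ.2

lemma Chart.contMDiffAt_symm (φ : Chart n M) {y : Coord n} (hy : y ∈ φ.1.target) :
    ContMDiffAt (𝓡 n) (𝓡 n) ∞ φ.1.symm y :=
  φ.contMDiffOn_symm.contMDiffAt (φ.isOpen_target.mem_nhds hy)

lemma Chart.mdifferentiable (φ : Chart n M) : φ.1.MDifferentiable (𝓡 n) (𝓡 n) :=
  ⟨φ.contMDiffOn.mdifferentiableOn (by simp), φ.contMDiffOn_symm.mdifferentiableOn (by simp)⟩

lemma Chart.contDiffOn_transition (φ ψ : Chart n M) :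
    ContDiffOn ℝ ∞ (φ.transition ψ) (φ.overlap ψ) := by
  rw [← contMDiffOn_iff_contDiffOn]
  refine ψ.contMDiffOn.comp (φ.contMDiffOn_symm.mono fun y hy ↦ (Chart.mem_overlap.1 hy).1) ?_
  exact fun y hy ↦ (Chart.mem_overlap.1 hy).2

/-- A scalar function on `M` is smooth in the charts. -/
lemma Chart.contDiffOn_scalar (φ : Chart n M) {f : M → ℝ} (hf : ContMDiff (𝓡 n) 𝓘(ℝ, ℝ) ∞ f) :
    ContDiffOn ℝ ∞ (fun y ↦ f (φ.1.symm y)) φ.1.target := by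
  rw [← contMDiffOn_iff_contDiffOn]
  exact hf.comp_contMDiffOn φ.contMDiffOn_symm

/-- The differential of the inverse of a chart. -/
abbrev Chart.push (φ : Chart n M) (y : Coord n) : Coord n →L[ℝ] TangentSpace (𝓡 n) (φ.1.symm y) :=
  mfderiv (𝓡 n) (𝓡 n) φ.1.symm y

/-- The differential of a chart. -/
abbrev Chart.pull (φ : Chart n M) (q : M) : TangentSpace (𝓡 n) q →L[ℝ] Coord n :=
  mfderiv (𝓡 n) (𝓡 n) φ.1 q

lemma Chart.pull_push (φ : Chart n M) {y : Coord n} (hy : y ∈ φ.1.target) (v : Coord n) :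
    φ.pull (φ.1.symm y) (φ.push y v) = v :=
  congrArg (fun f : Coord n →L[ℝ] Coord n ↦ f v) (φ.mdifferentiable.comp_symm_deriv hy)

lemma Chart.push_pull (φ : Chart n M) {y : Coord n} (hy : y ∈ φ.1.target)
    (v : TangentSpace (𝓡 n) (φ.1.symm y)) : φ.push y (φ.pull (φ.1.symm y) v) = v := by
  -- Tangent spaces are by definition the model space, so both differentials are endomorphisms of
  -- `Coord n`; in finite dimension a one-sided inverse is two-sided.
  let A : Coord n →ₗ[ℝ] Coord n := (φ.push y : Coord n →L[ℝ] Coord n).toLinearMap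
  let B : Coord n →ₗ[ℝ] Coord n := (φ.pull (φ.1.symm y) : Coord n →L[ℝ] Coord n).toLinearMap
  have h : B * A = 1 := LinearMap.ext fun v ↦ φ.pull_push hy v
  exact LinearMap.congr_fun (mul_eq_one_comm.1 h) v

lemma Chart.fderiv_transition {φ ψ : Chart n M} {y : Coord n} (hy : y ∈ φ.overlap ψ)
    (v : Coord n) : fderiv ℝ (φ.transition ψ) y v = ψ.pull (φ.1.symm y) (φ.push y v) := by
  have h := mfderiv_comp y (ψ.mdifferentiable.mdifferentiableAt (Chart.mem_overlap.1 hy).2)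
    (φ.mdifferentiable.mdifferentiableAt_symm (Chart.mem_overlap.1 hy).1)
  rw [mfderiv_eq_fderiv] at h
  exact congrArg (fun f : Coord n →L[ℝ] Coord n ↦ f v) h

/-- Chain rule for ψ⁻¹ ∘ (ψ ∘ φ⁻¹), which equals φ⁻¹ near the point. The two sides live in tangent
spaces at points that are equal but written differently, hence the comparison in `Coord n`. -/
lemma Chart.push_transition {φ ψ : Chart n M} {y : Coord n} (hy : y ∈ φ.overlap ψ)
    (v : Coord n) : (ψ.push (φ.transition ψ y) (fderiv ℝ (φ.transition ψ) y v) : Coord n)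
      = φ.push y v := by
  have ht : DifferentiableAt ℝ (φ.transition ψ) y :=
    ((φ.contDiffOn_transition ψ).contDiffAt ((φ.isOpen_overlap ψ).mem_nhds hy)).differentiableAt
      (by simp)
  have h := mfderiv_comp y (ψ.mdifferentiable.mdifferentiableAt_symm
    (Chart.transition_mem_target hy)) ht.mdifferentiableAt
  rw [mfderiv_eq_fderiv] at h
  have h2 : ψ.1.symm ∘ φ.transition ψ =ᶠ[𝓝 y] φ.1.symm := by
    filter_upwards [(φ.isOpen_overlap ψ).mem_nhds hy] with w hw
    exact Chart.symm_transition hw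
  have h3 : (mfderiv (𝓡 n) (𝓡 n) (ψ.1.symm ∘ φ.transition ψ) y : Coord n →L[ℝ] Coord n)
      = mfderiv (𝓡 n) (𝓡 n) φ.1.symm y := h2.mfderiv_eq
  exact congrArg (fun f : Coord n →L[ℝ] Coord n ↦ f v) (h.symm.trans h3)

lemma coord_eq_sum (v : Coord n) : v = ∑ i, v i • EuclideanSpace.single i (1 : ℝ) := by
  ext j
  simp [Finset.sum_apply, Pi.single_apply]

lemma Chart.jacobian_apply (φ ψ : Chart n M) (y v : Coord n) (i : Fin n) :
    fderiv ℝ (φ.transition ψ) y v i = ∑ j, φ.jacobian ψ y i j * v j := by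
  conv_lhs => rw [coord_eq_sum v]
  simp [Chart.jacobian, mul_comm]

/-! #### Vector fields in charts -/

lemma vcomp_transition (X : VField n M) {φ ψ : Chart n M} {y : Coord n} (hy : y ∈ φ.overlap ψ)
    (i : Fin n) :
    vcomp X ψ i (φ.transition ψ y) = ∑ j, φ.jacobian ψ y i j * vcomp X φ j y := by
  have h1 : vcomp X ψ i (φ.transition ψ y) = ψ.pull (φ.1.symm y) (X (φ.1.symm y)) i := by
    unfold vcomp
    rw [Chart.symm_transition hy]
    rfl
  have h2 := Chart.fderiv_transition hy (φ.pull (φ.1.symm y) (X (φ.1.symm y)))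
  rw [φ.push_pull (Chart.mem_overlap.1 hy).1] at h2
  rw [h1, ← h2, Chart.jacobian_apply]
  rfl

variable [IsManifold (𝓡 n) ∞ M]

/-- The components are the fibre part of the tangent map of the chart composed with the section X ∘
φ⁻¹, a composition of smooth maps. -/
lemma contDiffOn_vcomp {X : VField n M} (hX : IsSmooth X) (φ : Chart n M) (i : Fin n) :
    ContDiffOn ℝ ∞ (vcomp X φ i) φ.1.target := by
  have h1 : ContMDiffOn (𝓡 n).tangent (𝓡 n).tangent ∞
      (tangentMapWithin (𝓡 n) (𝓡 n) φ.1 φ.1.source) _ :=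
    φ.contMDiffOn.contMDiffOn_tangentMapWithin (m := ∞) (by simp) φ.1.open_source.uniqueMDiffOn
  have h2 : ContMDiffOn (𝓡 n) (𝓡 n).tangent ∞
      (fun y ↦ (⟨φ.1.symm y, X (φ.1.symm y)⟩ : TangentBundle (𝓡 n) M)) φ.1.target :=
    ContMDiff.comp_contMDiffOn hX φ.contMDiffOn_symm
  have h3 := h1.comp h2 (fun y hy ↦ φ.1.map_target hy)
  have h4 : ContMDiffOn (𝓡 n) 𝓘(ℝ, Coord n) ∞
      (fun y ↦ (tangentMapWithin (𝓡 n) (𝓡 n) φ.1 φ.1.source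
        (⟨φ.1.symm y, X (φ.1.symm y)⟩ : TangentBundle (𝓡 n) M)).2) φ.1.target := by
    exact (contMDiff_snd_tangentBundle_modelSpace (Coord n) (𝓡 n)).comp_contMDiffOn h3
  have h5 := (EuclideanSpace.proj (𝕜 := ℝ) i).contDiff.comp_contDiffOn (contMDiffOn_iff_contDiffOn.1 h4)
  refine h5.congr fun y hy ↦ ?_
  simp only [vcomp, tangentMapWithin, Function.comp]
  rw [mfderivWithin_of_isOpen φ.1.open_source (φ.1.map_target hy)]

lemma contMDiffOn_push (φ : Chart n M) (v : Coord n) :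
    ContMDiffOn (𝓡 n) (𝓡 n).tangent ∞
      (fun y ↦ (⟨φ.1.symm y, φ.push y v⟩ : TangentBundle (𝓡 n) M)) φ.1.target := by
  have h1 := φ.contMDiffOn_symm.contMDiffOn_tangentMapWithin (m := ∞) (by simp)
    φ.isOpen_target.uniqueMDiffOn
  have h2 : ContMDiffOn (𝓡 n) (𝓡 n).tangent ∞
      (fun y ↦ (⟨y, v⟩ : TangentBundle (𝓡 n) (Coord n))) φ.1.target := by
    refine (contMDiff_vectorSpace_iff_contDiff (V := fun _ : Coord n ↦ v)).2 contDiff_const |>.contMDiffOn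
  have h3 := h1.comp h2 (fun y hy ↦ hy)
  refine h3.congr fun y hy ↦ ?_
  simp only [tangentMapWithin, Function.comp]
  rw [mfderivWithin_of_isOpen φ.isOpen_target hy]
  rfl

end Supercotangent

namespace Supercotangent
variable {n : ℕ}

/-! #### Partial derivatives -/

open Filter Topology

lemma pd_congr {f g : Coord n → ℝ} {y : Coord n} (h : f =ᶠ[𝓝 y] g) (i : Fin n) :
    pd i f y = pd i g y := by
  rw [pd, pd, h.fderiv_eq]

lemma pd_add {f g : Coord n → ℝ} {y : Coord n} (hf : DifferentiableAt ℝ f y)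
    (hg : DifferentiableAt ℝ g y) (i : Fin n) :
    pd i (fun y ↦ f y + g y) y = pd i f y + pd i g y := by
  simp [pd, fderiv_fun_add hf hg]

lemma pd_sub {f g : Coord n → ℝ} {y : Coord n} (hf : DifferentiableAt ℝ f y)
    (hg : DifferentiableAt ℝ g y) (i : Fin n) :
    pd i (fun y ↦ f y - g y) y = pd i f y - pd i g y := by
  simp [pd, fderiv_fun_sub hf hg]

lemma pd_mul {f g : Coord n → ℝ} {y : Coord n} (hf : DifferentiableAt ℝ f y)
    (hg : DifferentiableAt ℝ g y) (i : Fin n) :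
    pd i (fun y ↦ f y * g y) y = pd i f y * g y + f y * pd i g y := by
  simp [pd, fderiv_fun_mul hf hg]
  ring

lemma pd_const_mul {f : Coord n → ℝ} {y : Coord n} (c : ℝ) (hf : DifferentiableAt ℝ f y)
    (i : Fin n) : pd i (fun y ↦ c * f y) y = c * pd i f y := by
  simp [pd, fderiv_const_mul hf c]

lemma pd_sum {ι : Type*} (s : Finset ι) {f : ι → Coord n → ℝ} {y : Coord n}
    (hf : ∀ k, DifferentiableAt ℝ (f k) y) (i : Fin n) :
    pd i (fun y ↦ ∑ k ∈ s, f k y) y = ∑ k ∈ s, pd i (f k) y := by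
  simp [pd, fderiv_fun_sum (fun k _ ↦ hf k), _root_.sum_apply]

lemma pd_const (c : ℝ) (i : Fin n) (y : Coord n) : pd i (fun _ ↦ c) y = 0 := by
  simp [pd]

lemma contDiffOn_pd {f : Coord n → ℝ} {s : Set (Coord n)} (hs : IsOpen s)
    (hf : ContDiffOn ℝ ∞ f s) (i : Fin n) : ContDiffOn ℝ ∞ (pd i f) s :=
  (hf.fderiv_of_isOpen (m := ∞) hs (by simp)).clm_apply contDiffOn_const

lemma pd_comm {f : Coord n → ℝ} {y : Coord n} (hf : ContDiffAt ℝ ∞ f y) (i j : Fin n) :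
    pd i (pd j f) y = pd j (pd i f) y := by
  have h1 : DifferentiableAt ℝ (fderiv ℝ f) y :=
    (hf.fderiv_right (m := 1) (by norm_cast)).differentiableAt (by simp)
  have h2 (v w : Coord n) :
      fderiv ℝ (fun z ↦ fderiv ℝ f z v) y w = fderiv ℝ (fderiv ℝ f) y w v := by
    rw [fderiv_clm_apply h1 (differentiableAt_const v)]
    simp
  have h3 : IsSymmSndFDerivAt ℝ f y := hf.isSymmSndFDerivAt (by
    rw [minSmoothness_of_isRCLikeNormedField]
    exact WithTop.coe_le_coe.2 (le_top : (2 : ℕ∞) ≤ ⊤))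
  unfold pd
  rw [h2, h2, h3.eq]

lemma fderiv_apply_eq_sum (f : Coord n → ℝ) (y v : Coord n) :
    fderiv ℝ f y v = ∑ k, v k * pd k f y := by
  conv_lhs => rw [coord_eq_sum v]
  simp [pd]

lemma differentiableAt_of_contDiffOn {E F : Type*} [NormedAddCommGroup E] [NormedSpace ℝ E]
    [NormedAddCommGroup F] [NormedSpace ℝ F] {f : E → F} {s : Set E} (hs : IsOpen s)
    (hf : ContDiffOn ℝ ∞ f s) {y : E} (hy : y ∈ s) : DifferentiableAt ℝ f y :=
  (hf.contDiffAt (hs.mem_nhds hy)).differentiableAt (by simp)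

variable {M : Type*} [TopologicalSpace M] [ChartedSpace (Coord n) M]

/-- The chain rule for a function transported to another chart. -/
lemma pd_comp_transition {φ ψ : Chart n M} {y : Coord n} (hy : y ∈ φ.overlap ψ)
    {f h : Coord n → ℝ} (hf : DifferentiableAt ℝ f (φ.transition ψ y))
    (e : ∀ w ∈ φ.overlap ψ, f (φ.transition ψ w) = h w) (j : Fin n) :
    ∑ a, pd a f (φ.transition ψ y) * φ.jacobian ψ y a j = pd j h y := by
  have ht := differentiableAt_of_contDiffOn (φ.isOpen_overlap ψ) (φ.contDiffOn_transition ψ) hy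
  have h1 : pd j (fun w ↦ f (φ.transition ψ w)) y = pd j h y := by
    refine pd_congr ?_ j
    filter_upwards [(φ.isOpen_overlap ψ).mem_nhds hy] with w hw using e w hw
  have h2 : HasFDerivAt (fun w ↦ f (φ.transition ψ w)) _ y := hf.hasFDerivAt.comp y ht.hasFDerivAt
  rw [← h1, pd, h2.fderiv, ContinuousLinearMap.comp_apply, fderiv_apply_eq_sum]
  exact Finset.sum_congr rfl fun a _ ↦ mul_comm _ _

lemma Chart.jacobian_eq_pd {φ ψ : Chart n M} {y : Coord n} (hy : y ∈ φ.overlap ψ) (i j : Fin n) :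
    φ.jacobian ψ y i j = pd j (fun w ↦ φ.transition ψ w i) y := by
  have ht := differentiableAt_of_contDiffOn (φ.isOpen_overlap ψ) (φ.contDiffOn_transition ψ) hy
  have h := ((EuclideanSpace.proj (𝕜 := ℝ) i).hasFDerivAt).comp y ht.hasFDerivAt
  have h2 : HasFDerivAt (fun w ↦ φ.transition ψ w i) _ y := h
  rw [pd, h2.fderiv]
  rfl

lemma Chart.contDiffOn_transition_apply (φ ψ : Chart n M) (i : Fin n) :
    ContDiffOn ℝ ∞ (fun w ↦ φ.transition ψ w i) (φ.overlap ψ) :=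
  (EuclideanSpace.proj (𝕜 := ℝ) i).contDiff.comp_contDiffOn (φ.contDiffOn_transition ψ)

lemma Chart.contDiffOn_jacobian (φ ψ : Chart n M) (i j : Fin n) :
    ContDiffOn ℝ ∞ (fun y ↦ φ.jacobian ψ y i j) (φ.overlap ψ) :=
  (contDiffOn_pd (φ.isOpen_overlap ψ) (φ.contDiffOn_transition_apply ψ i) j).congr
    fun _ hy ↦ Chart.jacobian_eq_pd hy i j

lemma Chart.pd_jacobian_comm {φ ψ : Chart n M} {y : Coord n} (hy : y ∈ φ.overlap ψ)
    (i j k : Fin n) :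
    pd j (fun w ↦ φ.jacobian ψ w i k) y = pd k (fun w ↦ φ.jacobian ψ w i j) y := by
  have h (j k : Fin n) : pd j (fun w ↦ φ.jacobian ψ w i k) y
      = pd j (pd k (fun w ↦ φ.transition ψ w i)) y := by
    refine pd_congr ?_ j
    filter_upwards [(φ.isOpen_overlap ψ).mem_nhds hy] with w hw
    exact Chart.jacobian_eq_pd hw i k
  rw [h, h, pd_comm]
  exact (φ.contDiffOn_transition_apply ψ i).contDiffAt ((φ.isOpen_overlap ψ).mem_nhds hy)

/-- The chain rule applied to the identity, written as the composite of the two opposite transition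
maps. -/
lemma Chart.jacobian_mul_jacobian {φ ψ : Chart n M} {y : Coord n} (hy : y ∈ φ.overlap ψ)
    (i j : Fin n) :
    ∑ a, ψ.jacobian φ (φ.transition ψ y) i a * φ.jacobian ψ y a j = if i = j then 1 else 0 := by
  have h := pd_comp_transition (f := fun w ↦ ψ.transition φ w i) (h := fun w ↦ w i) hy
    (differentiableAt_of_contDiffOn (ψ.isOpen_overlap φ) (ψ.contDiffOn_transition_apply φ i)
      (Chart.transition_mem_overlap hy))
    (fun w hw ↦ by rw [Chart.transition_transition hw]) j
  have h2 : pd j (fun w : Coord n ↦ w i) y = if i = j then 1 else 0 := by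
    rw [pd, show (fun w : Coord n ↦ w i) = EuclideanSpace.proj (𝕜 := ℝ) i from rfl,
      ContinuousLinearMap.fderiv]
    simp
  rw [← h2, ← h]
  exact Finset.sum_congr rfl fun a _ ↦ by
    rw [Chart.jacobian_eq_pd (Chart.transition_mem_overlap hy)]

lemma Chart.jacobian_mul_jacobian' {φ ψ : Chart n M} {y : Coord n} (hy : y ∈ φ.overlap ψ)
    (i j : Fin n) :
    ∑ a, φ.jacobian ψ y i a * ψ.jacobian φ (φ.transition ψ y) a j = if i = j then 1 else 0 := by
  have h := Chart.jacobian_mul_jacobian (Chart.transition_mem_overlap hy) i j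
  rwa [Chart.transition_transition hy] at h

/-! #### Lie brackets and sections in charts -/

lemma vcomp_eq (X : VField n M) (φ : Chart n M) (i : Fin n) (y : Coord n) :
    vcomp X φ i y =
      EuclideanSpace.proj (𝕜 := ℝ) i (φ.pull (φ.1.symm y) (X (φ.1.symm y))) := rfl

lemma vcomp_add (X Y : VField n M) (φ : Chart n M) (i : Fin n) (y : Coord n) :
    vcomp (X + Y) φ i y = vcomp X φ i y + vcomp Y φ i y := by
  simp only [vcomp_eq, Pi.add_apply, map_add]

lemma vcomp_smul (a : ℝ) (X : VField n M) (φ : Chart n M) (i : Fin n) (y : Coord n) :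
    vcomp (a • X) φ i y = a * vcomp X φ i y := by
  simp only [vcomp_eq, Pi.smul_apply, map_smul, smul_eq_mul]

variable [IsManifold (𝓡 n) ∞ M]

lemma isManifold_minSmoothness_two : IsManifold (𝓡 n) (minSmoothness ℝ 2) M := by
  rw [minSmoothness_of_isRCLikeNormedField]
  exact IsManifold.of_le (n := ∞) (WithTop.coe_le_coe.2 (le_top : (2 : ℕ∞) ≤ ⊤))

lemma IsSmooth.add {X Y : VField n M} (hX : IsSmooth X) (hY : IsSmooth Y) : IsSmooth (X + Y) :=
  ContMDiff.add_section hX hY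

lemma IsSmooth.smul {X : VField n M} (hX : IsSmooth X) (a : ℝ) : IsSmooth (a • X) :=
  ContMDiff.const_smul_section hX

lemma IsSmooth.mlieBracket {X Y : VField n M} (hX : IsSmooth X) (hY : IsSmooth Y) :
    IsSmooth (VectorField.mlieBracket (𝓡 n) X Y) := by
  have : IsManifold (𝓡 n) (∞ + 1) M := by simpa
  have : IsManifold (𝓡 n) (minSmoothness ℝ 2) M := isManifold_minSmoothness_two
  exact ContDiff.mlieBracket_vectorField (m := ⊤) (n := ⊤) hX hY (by simp)

/-- The Lie bracket is natural under pullback by φ⁻¹. On the vector space side it is the commutator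
of Fréchet derivatives, and the pulled back fields have the chart components as coordinates. -/
lemma vcomp_mlieBracket {X Y : VField n M} (hX : IsSmooth X) (hY : IsSmooth Y) (φ : Chart n M)
    (i : Fin n) {y : Coord n} (hy : y ∈ φ.1.target) :
    vcomp (VectorField.mlieBracket (𝓡 n) X Y) φ i y =
      ∑ k, (vcomp X φ k y * pd k (vcomp Y φ i) y - vcomp Y φ k y * pd k (vcomp X φ i) y) := by
  have : IsManifold (𝓡 n) (minSmoothness ℝ 2) M := isManifold_minSmoothness_two
  have : IsManifold (𝓡 n) 2 M := by simpa using this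
  let Z (X : VField n M) (w : Coord n) : Coord n := φ.pull (φ.1.symm w) (X (φ.1.symm w))
  have hd {X : VField n M} (hX : IsSmooth X) : DifferentiableAt ℝ (Z X) y := by
    refine differentiableAt_euclidean.2 fun i ↦ ?_
    exact differentiableAt_of_contDiffOn φ.isOpen_target (contDiffOn_vcomp hX φ i) hy
  have hf {X : VField n M} (hX : IsSmooth X) (v : Coord n) :
      (fderiv ℝ (Z X) y v) i = ∑ k, v k * pd k (vcomp X φ i) y := by
    rw [← fderiv_apply_eq_sum]
    have h : HasFDerivAt (vcomp X φ i) _ y :=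
      ((EuclideanSpace.proj (𝕜 := ℝ) i).hasFDerivAt).comp y (hd hX).hasFDerivAt
    rw [h.fderiv]
    rfl
  have hp (X : VField n M) {w : Coord n} (hw : w ∈ φ.1.target) :
      VectorField.mpullback (𝓡 n) (𝓡 n) φ.1.symm X w = Z X w := by
    have h : (φ.push w).inverse = φ.pull (φ.1.symm w) :=
      ContinuousLinearMap.inverse_eq (ContinuousLinearMap.ext fun v ↦ φ.push_pull hw v)
        (ContinuousLinearMap.ext fun v ↦ φ.pull_push hw v)
    exact congrArg (fun f : Coord n →L[ℝ] Coord n ↦ f (X (φ.1.symm w))) h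
  have he (X : VField n M) :
      VectorField.mpullback (𝓡 n) (𝓡 n) φ.1.symm X =ᶠ[𝓝 y] Z X := by
    filter_upwards [φ.isOpen_target.mem_nhds hy] with w hw using hp X hw
  have h1 := VectorField.mpullback_mlieBracket (n := ∞) (x₀ := y) (f := φ.1.symm)
    ((hX (φ.1.symm y)).mdifferentiableAt (by simp)) ((hY (φ.1.symm y)).mdifferentiableAt (by simp))
    (φ.contMDiffAt_symm hy) (by
      rw [minSmoothness_of_isRCLikeNormedField]
      exact WithTop.coe_le_coe.2 (le_top : (2 : ℕ∞) ≤ ⊤))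
  have hb (V W : ∀ w : Coord n, TangentSpace (𝓡 n) w) :
      VectorField.mlieBracket (𝓡 n) V W y = VectorField.lieBracket ℝ V W y := by
    have h := congrFun (VectorField.mlieBracketWithin_eq_lieBracketWithin (𝕜 := ℝ) (V := V)
      (W := W) (s := Set.univ)) y
    rw [VectorField.mlieBracketWithin_univ] at h
    exact h.trans (congrFun (VectorField.lieBracketWithin_univ (𝕜 := ℝ) (E := Coord n)) y)
  have h3 := (hp _ hy).symm.trans
    (h1.trans ((hb _ _).trans ((he X).lieBracket_vectorField_eq (he Y))))
  have h2 := congrArg (EuclideanSpace.proj (𝕜 := ℝ) i) h3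
  rw [VectorField.lieBracket, map_sub] at h2
  rw [Finset.sum_sub_distrib]
  exact h2.trans (congrArg₂ _ (hf hY _) (hf hX _))

end Supercotangent

namespace Supercotangent
variable {n : ℕ}

/-! #### The metric in charts -/

open Filter Topology

lemma contDiffOn_det {E : Type*} [NormedAddCommGroup E] [NormedSpace ℝ E] {s : Set E}
    {A : E → Matrix (Fin n) (Fin n) ℝ} (hA : ∀ i j, ContDiffOn ℝ ∞ (fun y ↦ A y i j) s) :
    ContDiffOn ℝ ∞ (fun y ↦ (A y).det) s := by
  simp only [Matrix.det_apply']
  exact ContDiffOn.sum fun σ _ ↦ contDiffOn_const.mul (contDiffOn_prod fun i _ ↦ hA _ _)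

lemma contDiffOn_matrix_inv {E : Type*} [NormedAddCommGroup E] [NormedSpace ℝ E] {s : Set E}
    {A : E → Matrix (Fin n) (Fin n) ℝ} (hA : ∀ i j, ContDiffOn ℝ ∞ (fun y ↦ A y i j) s)
    (h0 : ∀ y ∈ s, (A y).det ≠ 0) (i j : Fin n) : ContDiffOn ℝ ∞ (fun y ↦ (A y)⁻¹ i j) s := by
  simp only [Matrix.inv_def, Ring.inverse_eq_inv', Matrix.smul_apply, smul_eq_mul,
    Matrix.adjugate_apply]
  refine ((contDiffOn_det hA).inv h0).mul (contDiffOn_det fun a b ↦ ?_)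
  simp only [Matrix.updateRow_apply]
  split_ifs
  · exact contDiffOn_const
  · exact hA a b

variable {M : Type*} [TopologicalSpace M] [ChartedSpace (Coord n) M] [IsManifold (𝓡 n) ∞ M]

namespace PseudoRiemannianMetric

variable (g : PseudoRiemannianMetric n M) (φ : Chart n M)

lemma coef_symm (i j : Fin n) : g.coef φ i j = g.coef φ j i :=
  funext fun _ ↦ g.symm _ _ _

lemma inner_congr {q q' : M} (h : q = q') (v w : Coord n) :
    g.inner q v w = g.inner q' v w := by
  subst h
  rfl

lemma contDiffOn_coef (i j : Fin n) : ContDiffOn ℝ ∞ (g.coef φ i j) φ.1.target := by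
  rw [← contMDiffOn_iff_contDiffOn]
  have h : ContMDiffOn (𝓡 n) ((𝓡 n).prod 𝓘(ℝ)) ∞
      (fun y ↦ Bundle.TotalSpace.mk' ℝ (E := Bundle.Trivial M ℝ) (φ.1.symm y)
        (g.inner (φ.1.symm y) (φ.push y (EuclideanSpace.single i 1))
          (φ.push y (EuclideanSpace.single j 1)))) φ.1.target := by
    apply ContMDiffOn.clm_bundle_apply₂ (F₁ := Coord n) (F₂ := Coord n)
    · exact g.contMDiff.comp_contMDiffOn φ.contMDiffOn_symm
    · exact contMDiffOn_push φ _
    · exact contMDiffOn_push φ _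
  intro y hy
  have h2 := h y hy
  simp only [Bundle.contMDiffWithinAt_totalSpace] at h2
  exact h2.2

lemma inner_push (y v w : Coord n) :
    g.inner (φ.1.symm y) (φ.push y v) (φ.push y w) = ∑ i, ∑ j, g.coef φ i j y * v i * w j := by
  conv_lhs => rw [coord_eq_sum v, coord_eq_sum w]
  simp only [map_sum, map_smul, _root_.sum_apply, _root_.smul_apply, smul_eq_mul]
  simp only [Finset.mul_sum]
  rw [Finset.sum_comm]
  refine Finset.sum_congr rfl fun i _ ↦ Finset.sum_congr rfl fun j _ ↦ ?_
  change w j * (v i * g.coef φ i j y) = _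
  ring

/-- A kernel vector of the Gram matrix is pushed forward to a tangent vector orthogonal to all
others, which nondegeneracy forces to vanish. -/
lemma det_coef_ne_zero {y : Coord n} (hy : y ∈ φ.1.target) :
    (Matrix.of fun a b ↦ g.coef φ a b y).det ≠ 0 := by
  intro h0
  obtain ⟨v, hv, h⟩ := Matrix.exists_mulVec_eq_zero_iff.2 h0
  refine hv ?_
  have h1 : φ.push y (WithLp.toLp 2 v) = 0 := by
    refine g.nondegenerate _ _ fun w ↦ ?_
    rw [← φ.push_pull hy w, g.symm, inner_push]
    refine Finset.sum_eq_zero fun i _ ↦ ?_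
    have h2 := congrFun h i
    simp only [Matrix.mulVec, dotProduct, Matrix.of_apply, Pi.zero_apply] at h2
    calc _ = φ.pull (φ.1.symm y) w i * ∑ j, g.coef φ i j y * v j := by
          rw [Finset.mul_sum]
          exact Finset.sum_congr rfl fun j _ ↦ by ring
      _ = 0 := by rw [h2, mul_zero]
  have h3 := φ.pull_push hy (WithLp.toLp 2 v)
  rw [h1, map_zero] at h3
  exact (congrArg WithLp.ofLp h3).symm

lemma contDiffOn_inv (i j : Fin n) : ContDiffOn ℝ ∞ (g.inv φ i j) φ.1.target :=
  contDiffOn_matrix_inv (fun a b ↦ g.contDiffOn_coef φ a b) (fun _ hy ↦ g.det_coef_ne_zero φ hy) i j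

lemma sum_coef_mul_inv {y : Coord n} (hy : y ∈ φ.1.target) (i j : Fin n) :
    ∑ k, g.coef φ i k y * g.inv φ k j y = if i = j then 1 else 0 := by
  have h := Matrix.mul_nonsing_inv _ (g.det_coef_ne_zero φ hy).isUnit
  have h2 := congrFun (congrFun h i) j
  rwa [Matrix.mul_apply, Matrix.one_apply] at h2

lemma sum_inv_mul_coef {y : Coord n} (hy : y ∈ φ.1.target) (i j : Fin n) :
    ∑ k, g.inv φ i k y * g.coef φ k j y = if i = j then 1 else 0 := by
  have h := Matrix.nonsing_inv_mul _ (g.det_coef_ne_zero φ hy).isUnit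
  have h2 := congrFun (congrFun h i) j
  rwa [Matrix.mul_apply, Matrix.one_apply] at h2

lemma inv_symm (i j : Fin n) (y : Coord n) : g.inv φ i j y = g.inv φ j i y := by
  have h : (Matrix.of fun a b ↦ g.coef φ a b y).transpose = Matrix.of fun a b ↦ g.coef φ a b y :=
    Matrix.ext fun a b ↦ congrFun (g.coef_symm φ b a) y
  have h2 := Matrix.transpose_nonsing_inv (Matrix.of fun a b ↦ g.coef φ a b y)
  rw [h] at h2
  exact congrFun (congrFun h2 j) i

lemma contDiffOn_christoffel (k i j : Fin n) :
    ContDiffOn ℝ ∞ (g.christoffel φ k i j) φ.1.target := by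
  have h (a i j : Fin n) := contDiffOn_pd φ.isOpen_target (g.contDiffOn_coef φ i j) a
  exact contDiffOn_const.mul (ContDiffOn.sum fun l _ ↦ (g.contDiffOn_inv φ k l).mul
    (((h i j l).add (h j i l)).sub (h l i j)))

lemma christoffel_symm (k i j : Fin n) (y : Coord n) :
    g.christoffel φ k i j y = g.christoffel φ k j i y := by
  unfold christoffel
  rw [g.coef_symm φ i j]
  congr 1
  exact Finset.sum_congr rfl fun l _ ↦ by ring

/-- The Christoffel symbols of the first kind. -/
lemma sum_coef_mul_christoffel {y : Coord n} (hy : y ∈ φ.1.target) (a i j : Fin n) :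
    ∑ k, g.coef φ a k y * g.christoffel φ k i j y =
      1 / 2 * (pd i (g.coef φ j a) y + pd j (g.coef φ i a) y - pd a (g.coef φ i j) y) := by
  have h : ∑ k, g.coef φ a k y * g.christoffel φ k i j y = 1 / 2 * ∑ l,
      (∑ k, g.coef φ a k y * g.inv φ k l y) *
      (pd i (g.coef φ j l) y + pd j (g.coef φ i l) y - pd l (g.coef φ i j) y) := by
    simp only [christoffel, Finset.mul_sum, Finset.sum_mul]
    rw [Finset.sum_comm]
    exact Finset.sum_congr rfl fun l _ ↦ Finset.sum_congr rfl fun k _ ↦ by ring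
  rw [h]
  simp only [g.sum_coef_mul_inv φ hy, ite_mul, one_mul, zero_mul, Finset.sum_ite_eq,
    Finset.mem_univ, if_true]

/-- This is ∇g = 0: in the sum of the two symbols of the first kind, the terms antisymmetric in a
and b cancel. -/
lemma pd_coef {y : Coord n} (hy : y ∈ φ.1.target) (a b j : Fin n) :
    pd j (g.coef φ a b) y = ∑ k, g.coef φ a k y * g.christoffel φ k b j y
      + ∑ k, g.coef φ b k y * g.christoffel φ k a j y := by
  rw [g.sum_coef_mul_christoffel φ hy, g.sum_coef_mul_christoffel φ hy, g.coef_symm φ b a,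
    g.coef_symm φ j a, g.coef_symm φ j b]
  ring

lemma coef_transition {φ ψ : Chart n M} {y : Coord n} (hy : y ∈ φ.overlap ψ) (a b : Fin n) :
    g.coef φ a b y = ∑ i, ∑ j, g.coef ψ i j (φ.transition ψ y) * φ.jacobian ψ y i a
      * φ.jacobian ψ y j b := by
  have h1 := g.inner_push ψ (φ.transition ψ y)
    (fderiv ℝ (φ.transition ψ) y (EuclideanSpace.single a 1))
    (fderiv ℝ (φ.transition ψ) y (EuclideanSpace.single b 1))
  refine Eq.trans ?_ h1
  refine Eq.trans ?_ (g.inner_congr (Chart.symm_transition hy) _ _).symm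
  exact congrArg₂ (fun v w : Coord n ↦ g.inner (φ.1.symm y) v w)
    (Chart.push_transition hy _).symm (Chart.push_transition hy _).symm

end PseudoRiemannianMetric
end Supercotangent

namespace Supercotangent
variable {n : ℕ}

/-! ### The action of a conformal vector field on the Levi-Civita connection -/

open Filter Topology

/-! ### Matrix and tensor identities at a single point -/

section Pointwise

open Matrix

/-- Here `dA`, `dY`, `dx` are derivatives in the direction j, and `dΓ i j` stands for ∂ᵢΓⱼ. Solving
the transpose of `hA` for AᵀG and solving `hdA` for G∂ⱼA produces the covariant derivative of Y. The
terms in ∂ⱼx cancel, and the terms linear in x assemble into the curvature. -/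
lemma curvature_identity {ι : Type*} [Fintype ι] [DecidableEq ι]
    {G A Y dA dY : Matrix ι ι ℝ} {Γ dG : ι → Matrix ι ι ℝ} {dΓ : ι → ι → Matrix ι ι ℝ}
    {x dx : ι → ℝ} (j : ι) (hG : Gᵀ = G) (hY : Yᵀ = -Y)
    (hdG : ∀ i, dG i = G * Γ i + (G * Γ i)ᵀ)
    (hA : G * A = Y - ∑ i, x i • (G * Γ i))
    (hdA : dG j * A + G * dA
      = dY - ∑ i, (dx i • (G * Γ i) + x i • (dG j * Γ i + G * dΓ j i))) :
    Aᵀ * (G * Γ j) + ∑ i, x i • (dG i * Γ j + G * dΓ i j) + G * Γ j * A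
        + ∑ i, dx i • (G * Γ i) + G * dA
      = dY - (Γ j)ᵀ * Y - Y * Γ j
        - ∑ i, x i • (G * (dΓ j i - dΓ i j + Γ j * Γ i - Γ i * Γ j)) := by
  have h1 : Aᵀ * (G * Γ j) = -(Y * Γ j) - ∑ i, x i • ((Γ i)ᵀ * (G * Γ j)) := by
    have h : Aᵀ * G = -Y - ∑ i, x i • ((Γ i)ᵀ * G) := by
      have h := congrArg transpose hA
      simpa [transpose_mul, hG, hY, transpose_sum] using h
    rw [← Matrix.mul_assoc, h, Matrix.sub_mul, Matrix.neg_mul, Finset.sum_mul]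
    simp only [Matrix.smul_mul, Matrix.mul_assoc]
  have h2 : G * dA = dY - ∑ i, (dx i • (G * Γ i) + x i • (dG j * Γ i + G * dΓ j i))
      - G * Γ j * A - ((Γ j)ᵀ * Y - ∑ i, x i • ((Γ j)ᵀ * (G * Γ i))) := by
    have h : (Γ j)ᵀ * G * A = (Γ j)ᵀ * Y - ∑ i, x i • ((Γ j)ᵀ * (G * Γ i)) := by
      rw [Matrix.mul_assoc, hA, Matrix.mul_sub, Finset.mul_sum]
      simp only [Matrix.mul_smul]
    rw [← h, ← hdA, hdG j, transpose_mul, hG]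
    noncomm_ring
  rw [h1, h2, ← sub_eq_zero]
  simp only [hdG, transpose_mul, hG]
  -- What remains is linear in x. Once ∂G has been expanded by metric compatibility, each
  -- coefficient vanishes identically.
  have h3 : ∑ i, x i • ((G * Γ i + (Γ i)ᵀ * G) * Γ j + G * dΓ i j)
      - ∑ i, x i • ((Γ i)ᵀ * (G * Γ j))
      - ∑ i, x i • ((G * Γ j + (Γ j)ᵀ * G) * Γ i + G * dΓ j i)
      + ∑ i, x i • ((Γ j)ᵀ * (G * Γ i))
      + ∑ i, x i • (G * (dΓ j i - dΓ i j + Γ j * Γ i - Γ i * Γ j)) = 0 := by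
    rw [← Finset.sum_sub_distrib, ← Finset.sum_sub_distrib, ← Finset.sum_add_distrib,
      ← Finset.sum_add_distrib]
    refine Finset.sum_eq_zero fun i _ ↦ ?_
    rw [← smul_sub, ← smul_sub, ← smul_add, ← smul_add]
    convert smul_zero (x i)
    noncomm_ring
  rw [Finset.sum_add_distrib]
  rw [← h3]
  abel

/-- `D` and `DD` are derivatives of the metric `G`, `E` and `EE` those of the vector `x`, and `L`,
`dL` the conformal factor and its differential; `h` is the differentiated Killing equation. The
combination that defines the Christoffel symbols isolates the wanted expression. The two shifts by
½L remove all terms L·∂g, and the shift by ½ dL removes the term symmetric in b and m, so only a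
skew term in dL survives. -/
lemma conformal_variation {ι : Type*} [Fintype ι] [DecidableEq ι] {G : ι → ι → ℝ}
    {D : ι → ι → ι → ℝ} {DD : ι → ι → ι → ι → ℝ} {x : ι → ℝ} {E : ι → ι → ℝ} {EE : ι → ι → ι → ℝ}
    {L : ℝ} {dL : ι → ℝ} (hG : ∀ i k, G i k = G k i) (hEE : ∀ a m k, EE a m k = EE m a k)
    (hDD : ∀ a c i k, DD a c i k = DD c a i k)
    (h : ∀ a i k, ∑ c, (E a c * D c i k + x c * DD a c i k + D a c k * E i c + G c k * EE a i c
      + D a i c * E k c + G i c * EE a k c) = dL a * G i k + L * D a i k) (j b m : ι) :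
    ∑ k, (E b k - if k = b then 1 / 2 * L else 0) * (1 / 2 * (D m j k + D j m k - D k m j))
      + ∑ i, x i * (1 / 2 * (DD i m j b + DD i j m b - DD i b m j))
      + ∑ k, 1 / 2 * (D k j b + D j k b - D b k j) * (E m k - if k = m then 1 / 2 * L else 0)
      + ∑ i, E j i * (1 / 2 * (D m i b + D i m b - D b m i))
      + ∑ k, G b k * (EE j m k - if k = m then 1 / 2 * dL j else 0)
      = 1 / 2 * (G b j * dL m - G m j * dL b) := by
  -- The Koszul combination: half of the equations at (m, j, b) and (j, m, b), minus that at (b, m,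
  -- j).
  have h1 : ∑ c, (E b c * (1 / 2 * (D m j c + D j m c - D c m j))
      + x c * (1 / 2 * (DD c m j b + DD c j m b - DD c b m j))
      + 1 / 2 * (D c j b + D j c b - D b c j) * E m c
      + E j c * (1 / 2 * (D m c b + D c m b - D b m c)) + G b c * EE j m c)
      = 1 / 2 * ((dL m * G j b + L * D m j b) + (dL j * G m b + L * D j m b)
        - (dL b * G m j + L * D b m j)) := by
    rw [← h m j b, ← h j m b, ← h b m j, ← Finset.sum_add_distrib, ← Finset.sum_sub_distrib,
      Finset.mul_sum]
    refine Finset.sum_congr rfl fun c _ ↦ ?_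
    rw [hEE m j c, hEE b m c, hEE b j c, hG c b, hG c j, hDD m c j b, hDD j c m b, hDD b c m j]
    ring
  simp only [Finset.sum_add_distrib] at h1
  simp only [sub_mul, mul_sub (_ : ℝ) (E _ _), mul_sub (_ : ℝ) (EE _ _ _), ite_mul, mul_ite,
    zero_mul, mul_zero, Finset.sum_sub_distrib, Finset.sum_ite_eq', Finset.mem_univ, if_true]
  rw [hG j b] at h1
  rw [hG b m]
  linear_combination h1

end Pointwise

variable {M : Type*} [TopologicalSpace M] [ChartedSpace (Coord n) M]

namespace PseudoRiemannianMetric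

lemma differentiableAt_scalar {φ : Chart n M} {lam : M → ℝ} {y : Coord n}
    (hl : ContMDiff (𝓡 n) 𝓘(ℝ, ℝ) ∞ lam) (hy : y ∈ φ.1.target) :
    DifferentiableAt ℝ (fun y ↦ lam (φ.1.symm y)) y :=
  differentiableAt_of_contDiffOn φ.isOpen_target (φ.contDiffOn_scalar hl) hy

lemma eventually_target {φ : Chart n M} {y : Coord n} (hy : y ∈ φ.1.target) : ∀ᶠ w in 𝓝 y, w ∈ φ.1.target :=
  φ.isOpen_target.mem_nhds hy

variable [IsManifold (𝓡 n) ∞ M]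

variable (g : PseudoRiemannianMetric n M) (φ : Chart n M)

/-- The Christoffel symbols of the first kind. -/
def christoffelLower (b m j : Fin n) : Coord n → ℝ := fun y ↦
  ∑ k, g.coef φ b k y * g.christoffel φ k m j y

/-- The matrix of the infinitesimal action on the `ξⁱ` of a conformal vector field. -/
def confMatrix (φ : Chart n M) (X : VField n M) (lam : M → ℝ) (k m : Fin n) : Coord n → ℝ := fun y ↦
  pd m (vcomp X φ k) y - if k = m then 1 / 2 * lam (φ.1.symm y) else 0

/-- The coefficients of the Lie derivative of `g_{bk} Γᵏ_{mj} ξᵇ ξᵐ dxʲ + g_{bk} ξᵇ dξᵏ`. -/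
def lieChristoffel (X : VField n M) (lam : M → ℝ) (j b m : Fin n) : Coord n → ℝ := fun y ↦
  ∑ k, confMatrix φ X lam k b y * g.christoffelLower φ k m j y
    + ∑ i, vcomp X φ i y * pd i (g.christoffelLower φ b m j) y
    + ∑ k, g.christoffelLower φ b k j y * confMatrix φ X lam k m y
    + ∑ i, pd j (vcomp X φ i) y * g.christoffelLower φ b m i y
    + ∑ k, g.coef φ b k y * pd j (confMatrix φ X lam k m) y

variable {g φ} {X : VField n M} {lam : M → ℝ} {y : Coord n}

lemma differentiableAt_coef (hy : y ∈ φ.1.target) (i j : Fin n) :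
    DifferentiableAt ℝ (g.coef φ i j) y :=
  differentiableAt_of_contDiffOn φ.isOpen_target (g.contDiffOn_coef φ i j) hy

lemma differentiableAt_christoffel (hy : y ∈ φ.1.target) (k i j : Fin n) :
    DifferentiableAt ℝ (g.christoffel φ k i j) y :=
  differentiableAt_of_contDiffOn φ.isOpen_target (g.contDiffOn_christoffel φ k i j) hy

lemma differentiableAt_pd_coef (hy : y ∈ φ.1.target) (a i j : Fin n) :
    DifferentiableAt ℝ (pd a (g.coef φ i j)) y :=
  differentiableAt_of_contDiffOn φ.isOpen_target
    (contDiffOn_pd φ.isOpen_target (g.contDiffOn_coef φ i j) a) hy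

lemma differentiableAt_vcomp (hX : IsSmooth X) (hy : y ∈ φ.1.target) (i : Fin n) :
    DifferentiableAt ℝ (vcomp X φ i) y :=
  differentiableAt_of_contDiffOn φ.isOpen_target (contDiffOn_vcomp hX φ i) hy

lemma differentiableAt_pd_vcomp (hX : IsSmooth X) (hy : y ∈ φ.1.target) (a i : Fin n) :
    DifferentiableAt ℝ (pd a (vcomp X φ i)) y :=
  differentiableAt_of_contDiffOn φ.isOpen_target
    (contDiffOn_pd φ.isOpen_target (contDiffOn_vcomp hX φ i) a) hy

lemma contDiffOn_confMatrix (hX : IsSmooth X) (hl : ContMDiff (𝓡 n) 𝓘(ℝ, ℝ) ∞ lam) (k m : Fin n) :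
    ContDiffOn ℝ ∞ (confMatrix φ X lam k m) φ.1.target := by
  refine (contDiffOn_pd φ.isOpen_target (contDiffOn_vcomp hX φ k) m).sub ?_
  split_ifs
  · exact contDiffOn_const.mul (φ.contDiffOn_scalar hl)
  · exact contDiffOn_const

lemma differentiableAt_confMatrix (hX : IsSmooth X) (hl : ContMDiff (𝓡 n) 𝓘(ℝ, ℝ) ∞ lam)
    (hy : y ∈ φ.1.target) (k m : Fin n) : DifferentiableAt ℝ (confMatrix φ X lam k m) y :=
  differentiableAt_of_contDiffOn φ.isOpen_target (contDiffOn_confMatrix hX hl k m) hy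

lemma pd_confMatrix (hX : IsSmooth X) (hl : ContMDiff (𝓡 n) 𝓘(ℝ, ℝ) ∞ lam)
    (hy : y ∈ φ.1.target) (j k m : Fin n) :
    pd j (confMatrix φ X lam k m) y = pd j (pd m (vcomp X φ k)) y
      - if k = m then 1 / 2 * pd j (fun y ↦ lam (φ.1.symm y)) y else 0 := by
  unfold confMatrix
  split_ifs
  · rw [pd_sub (differentiableAt_pd_vcomp hX hy m k)
      ((differentiableAt_const _).fun_mul (differentiableAt_scalar hl hy)),
      pd_const_mul _ (differentiableAt_scalar hl hy)]
  · simp only [sub_zero]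

lemma contDiffOn_christoffelLower (b m j : Fin n) :
    ContDiffOn ℝ ∞ (g.christoffelLower φ b m j) φ.1.target :=
  ContDiffOn.sum fun k _ ↦ (g.contDiffOn_coef φ b k).mul (g.contDiffOn_christoffel φ k m j)

lemma christoffelLower_eq (hy : y ∈ φ.1.target) (b m j : Fin n) :
    g.christoffelLower φ b m j y =
      1 / 2 * (pd m (g.coef φ j b) y + pd j (g.coef φ m b) y - pd b (g.coef φ m j) y) :=
  g.sum_coef_mul_christoffel φ hy b m j

lemma pd_christoffelLower (hy : y ∈ φ.1.target) (i b m j : Fin n) :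
    pd i (g.christoffelLower φ b m j) y =
      1 / 2 * (pd i (pd m (g.coef φ j b)) y + pd i (pd j (g.coef φ m b)) y
        - pd i (pd b (g.coef φ m j)) y) := by
  rw [pd_congr ((eventually_target hy).mono fun w hw ↦ christoffelLower_eq hw b m j),
    pd_const_mul, pd_sub, pd_add]
  all_goals first
    | exact differentiableAt_pd_coef hy _ _ _
    | exact (differentiableAt_pd_coef hy _ _ _).fun_add (differentiableAt_pd_coef hy _ _ _)
    | exact ((differentiableAt_pd_coef hy _ _ _).fun_add (differentiableAt_pd_coef hy _ _ _)).fun_sub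
        (differentiableAt_pd_coef hy _ _ _)

/-- This product rule form feeds the curvature computation, whereas `pd_christoffelLower`, which
involves only second derivatives of the metric, feeds the conformal one. -/
lemma pd_christoffelLower' (hy : y ∈ φ.1.target) (i b m j : Fin n) :
    pd i (g.christoffelLower φ b m j) y =
      ∑ k, (pd i (g.coef φ b k) y * g.christoffel φ k m j y
        + g.coef φ b k y * pd i (g.christoffel φ k m j) y) := by
  unfold christoffelLower
  rw [pd_sum _ fun k ↦ (differentiableAt_coef hy b k).fun_mul (differentiableAt_christoffel hy k m j)]
  exact Finset.sum_congr rfl fun k _ ↦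
    pd_mul (differentiableAt_coef hy b k) (differentiableAt_christoffel hy k m j) i

/-- The derivative of the conformal Killing equation. -/
lemma pd_conformal (hX : IsSmooth X) (hl : ContMDiff (𝓡 n) 𝓘(ℝ, ℝ) ∞ lam)
    (h : ∀ i j : Fin n, ∀ y ∈ φ.1.target, g.lieCoef φ X i j y = lam (φ.1.symm y) * g.coef φ i j y)
    (hy : y ∈ φ.1.target) (a i k : Fin n) :
    ∑ c, (pd a (vcomp X φ c) y * pd c (g.coef φ i k) y
      + vcomp X φ c y * pd a (pd c (g.coef φ i k)) y
      + pd a (g.coef φ c k) y * pd i (vcomp X φ c) y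
      + g.coef φ c k y * pd a (pd i (vcomp X φ c)) y
      + pd a (g.coef φ i c) y * pd k (vcomp X φ c) y
      + g.coef φ i c y * pd a (pd k (vcomp X φ c)) y)
      = pd a (fun y ↦ lam (φ.1.symm y)) y * g.coef φ i k y
        + lam (φ.1.symm y) * pd a (g.coef φ i k) y := by
  have c1 (i j : Fin n) := differentiableAt_coef (g := g) hy i j
  have c2 (a i j : Fin n) := differentiableAt_pd_coef (g := g) hy a i j
  have c3 (i : Fin n) := differentiableAt_vcomp hX hy i
  have c4 (a i : Fin n) := differentiableAt_pd_vcomp hX hy a i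
  rw [← pd_mul (differentiableAt_scalar hl hy) (c1 i k),
    ← pd_congr ((eventually_target hy).mono fun w hw ↦ h i k w hw)]
  unfold lieCoef
  rw [pd_sum _ fun c ↦ (((c3 c).fun_mul (c2 c i k)).fun_add ((c1 c k).fun_mul (c4 i c))).fun_add
    ((c1 i c).fun_mul (c4 k c))]
  refine Finset.sum_congr rfl fun c _ ↦ ?_
  rw [pd_add (((c3 c).fun_mul (c2 c i k)).fun_add ((c1 c k).fun_mul (c4 i c))) ((c1 i c).fun_mul (c4 k c)),
    pd_add ((c3 c).fun_mul (c2 c i k)) ((c1 c k).fun_mul (c4 i c)), pd_mul (c3 c) (c2 c i k),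
    pd_mul (c1 c k) (c4 i c), pd_mul (c1 i c) (c4 k c)]
  ring

lemma pd_pd_coef_comm (hy : y ∈ φ.1.target) (a c i k : Fin n) :
    pd a (pd c (g.coef φ i k)) y = pd c (pd a (g.coef φ i k)) y :=
  pd_comm ((g.contDiffOn_coef φ i k).contDiffAt (φ.isOpen_target.mem_nhds hy)) a c

lemma pd_pd_vcomp_comm (hX : IsSmooth X) (hy : y ∈ φ.1.target) (a c k : Fin n) :
    pd a (pd c (vcomp X φ k)) y = pd c (pd a (vcomp X φ k)) y :=
  pd_comm ((contDiffOn_vcomp hX φ k).contDiffAt (φ.isOpen_target.mem_nhds hy)) a c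

/-- A conformal field changes the Levi-Civita connection only through dλ. Since `confMatrix` already
contains −½λ, just the part skew in b and m is left. -/
lemma lieChristoffel_conformal (hX : IsSmooth X) (hl : ContMDiff (𝓡 n) 𝓘(ℝ, ℝ) ∞ lam)
    (h : ∀ i j : Fin n, ∀ y ∈ φ.1.target, g.lieCoef φ X i j y = lam (φ.1.symm y) * g.coef φ i j y)
    (hy : y ∈ φ.1.target) (j b m : Fin n) :
    g.lieChristoffel φ X lam j b m y =
      1 / 2 * (g.coef φ b j y * pd m (fun y ↦ lam (φ.1.symm y)) y
        - g.coef φ m j y * pd b (fun y ↦ lam (φ.1.symm y)) y) := by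
  have key := conformal_variation (G := fun i k ↦ g.coef φ i k y)
    (D := fun a i k ↦ pd a (g.coef φ i k) y) (DD := fun a c i k ↦ pd a (pd c (g.coef φ i k)) y)
    (x := fun i ↦ vcomp X φ i y) (E := fun a i ↦ pd a (vcomp X φ i) y)
    (EE := fun a c i ↦ pd a (pd c (vcomp X φ i)) y) (L := lam (φ.1.symm y))
    (dL := fun a ↦ pd a (fun y ↦ lam (φ.1.symm y)) y)
    (fun i k ↦ congrFun (g.coef_symm φ i k) y) (fun a m k ↦ pd_pd_vcomp_comm hX hy a m k)
    (fun a c i k ↦ pd_pd_coef_comm hy a c i k) (fun a i k ↦ pd_conformal hX hl h hy a i k) j b m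
  rw [← key]
  simp only [lieChristoffel, christoffelLower_eq hy, pd_christoffelLower hy,
    pd_confMatrix hX hl hy, confMatrix]

/-- The matrix `confMatrix` with its first index lowered. -/
lemma sum_coef_mul_confMatrix (hX : IsSmooth X)
    (h : ∀ i j : Fin n, ∀ y ∈ φ.1.target, g.lieCoef φ X i j y = lam (φ.1.symm y) * g.coef φ i j y)
    (hy : y ∈ φ.1.target) (a m : Fin n) :
    ∑ k, g.coef φ a k y * confMatrix φ X lam k m y =
      g.rot φ X a m y - ∑ i, vcomp X φ i y * g.christoffelLower φ a m i y := by
  have hlow (a m : Fin n) : pd m (g.lower φ X a) y =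
      ∑ k, (pd m (g.coef φ a k) y * vcomp X φ k y + g.coef φ a k y * pd m (vcomp X φ k) y) := by
    unfold lower
    rw [pd_sum _ fun k ↦ (differentiableAt_coef hy a k).fun_mul (differentiableAt_vcomp hX hy k)]
    exact Finset.sum_congr rfl fun k _ ↦
      pd_mul (differentiableAt_coef hy a k) (differentiableAt_vcomp hX hy k) m
  have h1 := h a m y hy
  have h0 : ∑ k, g.coef φ a k y * confMatrix φ X lam k m y =
      ∑ k, g.coef φ a k y * pd m (vcomp X φ k) y
        - g.coef φ a m y * (1 / 2 * lam (φ.1.symm y)) := by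
    simp only [confMatrix, mul_sub, mul_ite, mul_zero, Finset.sum_sub_distrib, Finset.sum_ite_eq',
      Finset.mem_univ, if_true]
  -- Lowering the index of ∂X yields its skew part (the rotation), a Christoffel term and half of
  -- L_X g. The last equals ½λ g and cancels the shift built into `confMatrix`.
  have h2 : ∑ k, g.coef φ a k y * pd m (vcomp X φ k) y = 1 / 2 *
      (∑ k, (pd m (g.coef φ a k) y * vcomp X φ k y + g.coef φ a k y * pd m (vcomp X φ k) y)
       - ∑ k, (pd a (g.coef φ m k) y * vcomp X φ k y + g.coef φ m k y * pd a (vcomp X φ k) y))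
      - ∑ i, vcomp X φ i y * (1 / 2 * (pd m (g.coef φ i a) y + pd i (g.coef φ m a) y
        - pd a (g.coef φ m i) y)) + 1 / 2 * g.lieCoef φ X a m y := by
    rw [lieCoef, ← Finset.sum_sub_distrib, Finset.mul_sum, Finset.mul_sum, ← Finset.sum_sub_distrib,
      ← Finset.sum_add_distrib]
    refine Finset.sum_congr rfl fun k _ ↦ ?_
    rw [g.coef_symm φ k a, g.coef_symm φ k m, g.coef_symm φ m a]
    ring
  simp only [christoffelLower_eq hy]
  rw [h0, h2, h1, rot, hlow, hlow]
  ring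

lemma differentiableAt_pd_lower (hX : IsSmooth X) (hy : y ∈ φ.1.target) (i j : Fin n) :
    DifferentiableAt ℝ (pd i (g.lower φ X j)) y :=
  differentiableAt_of_contDiffOn φ.isOpen_target
    (contDiffOn_pd φ.isOpen_target (ContDiffOn.sum fun k _ ↦
      (g.contDiffOn_coef φ j k).mul (contDiffOn_vcomp hX φ k)) i) hy

lemma differentiableAt_rot (hX : IsSmooth X) (hy : y ∈ φ.1.target) (i j : Fin n) :
    DifferentiableAt ℝ (g.rot φ X i j) y :=
  (differentiableAt_const _).fun_mul
    ((differentiableAt_pd_lower hX hy j i).fun_sub (differentiableAt_pd_lower hX hy i j))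

lemma differentiableAt_christoffelLower (hy : y ∈ φ.1.target) (b m j : Fin n) :
    DifferentiableAt ℝ (g.christoffelLower φ b m j) y :=
  differentiableAt_of_contDiffOn φ.isOpen_target (contDiffOn_christoffelLower b m j) hy

/-- The derivative of `sum_coef_mul_confMatrix`, legitimate because that identity holds on the whole
open target of the chart. It supplies the hypothesis `hdA` of `curvature_identity`. -/
lemma pd_sum_coef_mul_confMatrix (hX : IsSmooth X) (hl : ContMDiff (𝓡 n) 𝓘(ℝ, ℝ) ∞ lam)
    (h : ∀ i j : Fin n, ∀ y ∈ φ.1.target, g.lieCoef φ X i j y = lam (φ.1.symm y) * g.coef φ i j y)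
    (hy : y ∈ φ.1.target) (j a m : Fin n) :
    ∑ k, (pd j (g.coef φ a k) y * confMatrix φ X lam k m y
        + g.coef φ a k y * pd j (confMatrix φ X lam k m) y) =
      pd j (g.rot φ X a m) y - ∑ i, (pd j (vcomp X φ i) y * g.christoffelLower φ a m i y
        + vcomp X φ i y * pd j (g.christoffelLower φ a m i) y) := by
  have h1 := pd_congr ((eventually_target hy).mono fun w hw ↦
    sum_coef_mul_confMatrix hX h hw a m) j
  have c1 (i : Fin n) := (differentiableAt_vcomp hX hy i).fun_mul
    (differentiableAt_christoffelLower (g := g) hy a m i)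
  rw [pd_sum _ fun k ↦ (differentiableAt_coef hy a k).fun_mul
    (differentiableAt_confMatrix hX hl hy k m), pd_sub (differentiableAt_rot hX hy a m)
    (DifferentiableAt.fun_sum fun i _ ↦ c1 i), pd_sum _ c1] at h1
  refine Eq.trans (Finset.sum_congr rfl fun k _ ↦ ?_) (h1.trans (congrArg₂ _ rfl
    (Finset.sum_congr rfl fun i _ ↦ ?_)))
  · rw [pd_mul (differentiableAt_coef hy a k) (differentiableAt_confMatrix hX hl hy k m)]
  · rw [pd_mul (differentiableAt_vcomp hX hy i) (differentiableAt_christoffelLower hy a m i)]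

/-- The second evaluation of the same quantity, by `curvature_identity` with Γⱼ the matrix of
entries Γᵏₘⱼ. It serves only to reach the explicit formula. -/
lemma lieChristoffel_eq_curvature (hX : IsSmooth X) (hl : ContMDiff (𝓡 n) 𝓘(ℝ, ℝ) ∞ lam)
    (h : ∀ i j : Fin n, ∀ y ∈ φ.1.target, g.lieCoef φ X i j y = lam (φ.1.symm y) * g.coef φ i j y)
    (hy : y ∈ φ.1.target) (j b m : Fin n) :
    g.lieChristoffel φ X lam j b m y = g.nablaRot φ X j b m y
      - ∑ i, vcomp X φ i y * ∑ k, g.coef φ b k y * g.riemann φ k m j i y := by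
  have key := curvature_identity (ι := Fin n)
    (G := Matrix.of fun a b ↦ g.coef φ a b y)
    (A := Matrix.of fun a b ↦ confMatrix φ X lam a b y)
    (Y := Matrix.of fun a b ↦ g.rot φ X a b y)
    (dA := Matrix.of fun a b ↦ pd j (confMatrix φ X lam a b) y)
    (dY := Matrix.of fun a b ↦ pd j (g.rot φ X a b) y)
    (Γ := fun j ↦ Matrix.of fun k m ↦ g.christoffel φ k m j y)
    (dG := fun j ↦ Matrix.of fun a b ↦ pd j (g.coef φ a b) y)
    (dΓ := fun i j ↦ Matrix.of fun k m ↦ pd i (g.christoffel φ k m j) y)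
    (x := fun i ↦ vcomp X φ i y) (dx := fun i ↦ pd j (vcomp X φ i) y) j
    (Matrix.ext fun a b ↦ congrFun (g.coef_symm φ b a) y)
    (Matrix.ext fun a b ↦ by
      simp only [Matrix.transpose_apply, Matrix.neg_apply, Matrix.of_apply, rot]
      ring)
    (fun i ↦ Matrix.ext fun a b ↦ by
      simp only [Matrix.add_apply, Matrix.transpose_apply, Matrix.mul_apply, Matrix.of_apply]
      exact g.pd_coef φ hy a b i)
    (Matrix.ext fun a b ↦ by
      simpa [Matrix.mul_apply, Matrix.sum_apply, christoffelLower] using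
        sum_coef_mul_confMatrix hX h hy a b)
    (Matrix.ext fun a b ↦ by
      have h1 := pd_sum_coef_mul_confMatrix hX hl h hy j a b
      simp only [pd_christoffelLower' hy, christoffelLower] at h1
      simpa [Matrix.mul_apply, Matrix.sum_apply, Finset.sum_add_distrib, mul_add] using h1)
  have key2 := congrFun (congrFun key b) m
  simp only [Matrix.add_apply, Matrix.sub_apply, Matrix.mul_apply, Matrix.sum_apply,
    Matrix.smul_apply, Matrix.transpose_apply, Matrix.of_apply, smul_eq_mul] at key2
  simp only [lieChristoffel, pd_christoffelLower' hy, christoffelLower, Finset.sum_add_distrib]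
  refine key2.trans ?_
  rw [nablaRot, Finset.sum_add_distrib, ← sub_sub]
  congr 1
  · congr 1
    · congr 1
      exact Finset.sum_congr rfl fun a _ ↦ by rw [g.christoffel_symm φ a j b]
    · exact Finset.sum_congr rfl fun a _ ↦ by rw [g.christoffel_symm φ a j m, mul_comm]
  · refine Finset.sum_congr rfl fun i _ ↦ ?_
    congr 1
    refine Finset.sum_congr rfl fun k _ ↦ ?_
    rw [riemann, Finset.sum_sub_distrib]
    simp only [g.christoffel_symm φ k i, g.christoffel_symm φ k j]
    ring

end PseudoRiemannianMetric
end Supercotangent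

namespace Supercotangent
variable {n : ℕ}

/-! ### Lie derivatives of `α` and `β` along lifts -/

open Filter Topology

lemma differentiableAt_real_fst {h : Coord n → ℝ} {z : Coord n × Coord n}
    (hh : DifferentiableAt ℝ h z.1) :
    DifferentiableAt ℝ (fun z : Coord n × Coord n ↦ (real (h z.1) : Grassmann n)) z :=
  real_differentiableAt (DifferentiableAt.comp z hh differentiableAt_fst)

lemma differentiableAt_real_snd (i : Fin n) (z : Coord n × Coord n) :
    DifferentiableAt ℝ (fun z : Coord n × Coord n ↦ (real (z.2 i) : Grassmann n)) z :=
  real_differentiableAt (((EuclideanSpace.proj (𝕜 := ℝ) i).differentiableAt).comp z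
    differentiableAt_snd)

lemma dX_congr {F G : SFun n} {z : Coord n × Coord n} (h : F =ᶠ[𝓝 z] G) (i : Fin n) :
    dX i F z = dX i G z := by
  rw [dX, dX, h.fderiv_eq]

lemma dP_congr {F G : SFun n} {z : Coord n × Coord n} (h : F =ᶠ[𝓝 z] G) (i : Fin n) :
    dP i F z = dP i G z := by
  rw [dP, dP, h.fderiv_eq]

lemma fderiv_real_fst {h : Coord n → ℝ} {z : Coord n × Coord n} (hh : DifferentiableAt ℝ h z.1)
    (v : Coord n × Coord n) :
    fderiv ℝ (fun z : Coord n × Coord n ↦ (real (h z.1) : Grassmann n)) z v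
      = real (fderiv ℝ h z.1 v.1) := by
  have h0 : HasFDerivAt (fun z : Coord n × Coord n ↦ h z.1) _ z :=
    hh.hasFDerivAt.comp z hasFDerivAt_fst
  rw [fderiv_real h0.differentiableAt, h0.fderiv]
  rfl

lemma dX_real {h : Coord n → ℝ} {z : Coord n × Coord n} (hh : DifferentiableAt ℝ h z.1)
    (i : Fin n) : dX i (fun z ↦ real (h z.1)) z = real (pd i h z.1) :=
  fderiv_real_fst hh _

lemma dP_real {h : Coord n → ℝ} {z : Coord n × Coord n} (hh : DifferentiableAt ℝ h z.1)
    (i : Fin n) : dP i (fun z ↦ real (h z.1)) z = 0 := by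
  rw [dP, fderiv_real_fst hh, map_zero, real_zero]

lemma fderiv_sum_real_mul_const {ι : Type*} (s : Finset ι) {h : ι → Coord n → ℝ}
    (a : ι → Grassmann n) {z : Coord n × Coord n} (hh : ∀ i, DifferentiableAt ℝ (h i) z.1)
    (v : Coord n × Coord n) :
    fderiv ℝ (fun z : Coord n × Coord n ↦ ∑ i ∈ s, real (h i z.1) * a i) z v
      = ∑ i ∈ s, real (fderiv ℝ (h i) z.1 v.1) * a i := by
  rw [fderiv_fun_sum fun i _ ↦ grassmann_mul_differentiableAt (differentiableAt_real_fst (hh i))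
    (differentiableAt_const (a i)), _root_.sum_apply]
  refine Finset.sum_congr rfl fun i _ ↦ ?_
  rw [fderiv_grassmann_mul (differentiableAt_real_fst (hh i)) (differentiableAt_const (a i)),
    fderiv_real_fst (hh i)]
  simp

lemma dX_sum_real_mul {ι : Type*} (s : Finset ι) {h : ι → Coord n → ℝ} (a : ι → Grassmann n)
    {z : Coord n × Coord n} (hh : ∀ i, DifferentiableAt ℝ (h i) z.1) (j : Fin n) :
    dX j (fun z ↦ ∑ i ∈ s, real (h i z.1) * a i) z = ∑ i ∈ s, real (pd j (h i) z.1) * a i :=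
  fderiv_sum_real_mul_const s a hh _

lemma dP_sum_real_mul {ι : Type*} (s : Finset ι) {h : ι → Coord n → ℝ} (a : ι → Grassmann n)
    {z : Coord n × Coord n} (hh : ∀ i, DifferentiableAt ℝ (h i) z.1) (j : Fin n) :
    dP j (fun z ↦ ∑ i ∈ s, real (h i z.1) * a i) z = 0 := by
  rw [dP, fderiv_sum_real_mul_const s a hh]
  simp [real_zero]

/-- The quadratic element `∑ f_{bm} ξᵇ ξᵐ` of the Grassmann algebra. -/
def quadratic (f : Fin n → Fin n → ℝ) : Grassmann n := ∑ b, ∑ m, real (f b m) * (xi b * xi m)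

lemma quadratic_add (f f' : Fin n → Fin n → ℝ) :
    quadratic (fun b m ↦ f b m + f' b m) = quadratic f + quadratic f' := by
  simp only [quadratic, real_add, add_mul, Finset.sum_add_distrib]

lemma quadratic_sum {ι : Type*} (s : Finset ι) (f : ι → Fin n → Fin n → ℝ) :
    quadratic (fun b m ↦ ∑ i ∈ s, f i b m) = ∑ i ∈ s, quadratic (f i) := by
  simp only [quadratic, real_sum, Finset.sum_mul]
  rw [Finset.sum_comm (s := s)]
  exact Finset.sum_congr rfl fun b _ ↦ Finset.sum_comm

lemma quadratic_mul_real (f : Fin n → Fin n → ℝ) (r : ℝ) :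
    quadratic f * real r = quadratic (fun b m ↦ r * f b m) := by
  simp only [quadratic, Finset.sum_mul]
  refine Finset.sum_congr rfl fun b _ ↦ Finset.sum_congr rfl fun m _ ↦ ?_
  rw [real_mul, real_comm, mul_assoc]

lemma linear_mul_linear (u v : Fin n → ℝ) :
    (∑ b, real (u b) * xi b) * (∑ m, real (v m) * xi m) = quadratic (fun b m ↦ u b * v m) := by
  rw [quadratic, Finset.sum_mul_sum]
  refine Finset.sum_congr rfl fun b _ ↦ Finset.sum_congr rfl fun m _ ↦ ?_
  rw [real_mul, mul_assoc, ← mul_assoc (xi b), real_comm]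
  simp only [mul_assoc]

/-- The action of a linear derivation on a quadratic element. -/
lemma sum_linear_mul_xi (A f : Fin n → Fin n → ℝ) :
    ∑ b, ∑ m, real (f b m) * ((∑ k, real (A b k) * xi k) * xi m
      + xi b * ∑ k, real (A m k) * xi k) =
    quadratic (fun b m ↦ ∑ k, A k b * f k m + ∑ k, f b k * A k m) := by
  rw [quadratic_add]
  simp only [mul_add, Finset.sum_add_distrib]
  congr 1
  · simp only [quadratic, Finset.sum_mul, Finset.mul_sum, real_sum]
    rw [Finset.sum_comm, Finset.sum_comm (γ := Fin n) (s := Finset.univ) (t := Finset.univ)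
      (f := fun b m ↦ ∑ k, real (A k b * f k m) * (xi b * xi m))]
    refine Finset.sum_congr rfl fun m _ ↦ ?_
    rw [Finset.sum_comm]
    refine Finset.sum_congr rfl fun k _ ↦ Finset.sum_congr rfl fun b _ ↦ ?_
    rw [mul_comm (A b k), real_mul]
    simp only [mul_assoc]
  · simp only [quadratic, Finset.sum_mul, Finset.mul_sum, real_sum]
    refine Finset.sum_congr rfl fun b _ ↦ ?_
    rw [Finset.sum_comm]
    refine Finset.sum_congr rfl fun k _ ↦ Finset.sum_congr rfl fun m _ ↦ ?_
    rw [real_mul, ← mul_assoc (xi b), real_comm]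
    simp only [mul_assoc]

namespace LocalField

variable {V : LocalField n} {z : Coord n × Coord n}

lemma apply_real_of_real {x : Fin n → ℝ} (hx : ∀ i, V.x i z = real (x i)) {h : Coord n → ℝ}
    (hh : DifferentiableAt ℝ h z.1) :
    V.apply (fun z ↦ real (h z.1)) z = real (∑ i, x i * pd i h z.1) := by
  rw [V.apply_real hh, real_sum]
  exact Finset.sum_congr rfl fun i _ ↦ by rw [hx, real_mul]

lemma IsEvenAt.apply_real_mul_xi (hV : V.IsEvenAt z) {x : Fin n → ℝ}
    (hx : ∀ i, V.x i z = real (x i)) {h : Coord n → ℝ} (hh : DifferentiableAt ℝ h z.1) (m : Fin n) :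
    V.apply (fun z ↦ real (h z.1) * Supercotangent.xi m) z =
      real (∑ i, x i * pd i h z.1) * Supercotangent.xi m + real (h z.1) * V.xi m z := by
  rw [hV.apply_mul (differentiableAt_real_fst hh) (differentiableAt_const _),
    apply_real_of_real hx hh, apply_xi]

lemma IsEvenAt.apply_sum_real_mul_xi (hV : V.IsEvenAt z) {x : Fin n → ℝ}
    (hx : ∀ i, V.x i z = real (x i)) {h : Fin n → Coord n → ℝ}
    (hh : ∀ m, DifferentiableAt ℝ (h m) z.1) :
    V.apply (fun z ↦ ∑ m, real (h m z.1) * Supercotangent.xi m) z =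
      ∑ m, real (∑ i, x i * pd i (h m) z.1) * Supercotangent.xi m
        + ∑ m, real (h m z.1) * V.xi m z := by
  rw [V.apply_sum _ fun m _ ↦ grassmann_mul_differentiableAt (differentiableAt_real_fst (hh m))
    (differentiableAt_const _), ← Finset.sum_add_distrib]
  exact Finset.sum_congr rfl fun m _ ↦ hV.apply_real_mul_xi hx (hh m) m

lemma IsEvenAt.apply_real_mul_xi_mul_xi (hV : V.IsEvenAt z) {x : Fin n → ℝ}
    (hx : ∀ i, V.x i z = real (x i)) {h : Coord n → ℝ} (hh : DifferentiableAt ℝ h z.1)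
    (b m : Fin n) :
    V.apply (fun z ↦ real (h z.1) * (Supercotangent.xi b * Supercotangent.xi m)) z =
      real (∑ i, x i * pd i h z.1) * (Supercotangent.xi b * Supercotangent.xi m)
        + real (h z.1) * (V.xi b z * Supercotangent.xi m + Supercotangent.xi b * V.xi m z) := by
  rw [hV.apply_mul (differentiableAt_real_fst hh) (differentiableAt_const _),
    apply_real_of_real hx hh,
    hV.apply_mul (differentiableAt_const _) (differentiableAt_const _), apply_xi, apply_xi]

end LocalField

variable {M : Type*} [TopologicalSpace M] [ChartedSpace (Coord n) M] [IsManifold (𝓡 n) ∞ M]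

namespace PseudoRiemannianMetric

variable {g : PseudoRiemannianMetric n M} {φ : Chart n M} {X : VField n M} {lam : M → ℝ}
  {V : LocalField n} {z : Coord n × Coord n} {hbar : ℝ}

lemma alpha_x_eq (l : Fin n) : (g.alpha φ hbar).x l = fun z ↦ real (z.2 l) +
    planck hbar • ∑ i, ∑ k, real (g.christoffelLower φ i k l z.1) * (xi i * xi k) := by
  funext z
  simp only [alpha, christoffelLower]
  congr 2
  refine Finset.sum_congr rfl fun i _ ↦ ?_
  rw [Finset.sum_comm]
  refine Finset.sum_congr rfl fun k _ ↦ ?_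
  rw [real_sum, Finset.sum_mul]
  refine Finset.sum_congr rfl fun j _ ↦ ?_
  rw [real_mul, mul_assoc, ← mul_assoc (xi i), real_comm _ (xi i)]
  simp only [mul_assoc]

/-- Only the x-components of V are prescribed, so that the result can be read as a linear system for
the odd components. -/
lemma lieDeriv_beta_x (hX : IsSmooth X) (hV : V.IsEvenAt z) (hz : z.1 ∈ φ.1.target)
    (hx : ∀ i, V.x i =ᶠ[𝓝 z] fun z ↦ real (vcomp X φ i z.1)) (j : Fin n) :
    (V.lieDeriv (g.beta φ)).x j z =
      ∑ m, real (∑ k, (vcomp X φ k z.1 * pd k (g.coef φ m j) z.1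
        + g.coef φ m k z.1 * pd j (vcomp X φ k) z.1)) * xi m
      + ∑ k, real (g.coef φ k j z.1) * V.xi k z := by
  have hx0 (i : Fin n) : V.x i z = real (vcomp X φ i z.1) := (hx i).eq_of_nhds
  simp only [LocalField.lieDeriv, beta, zero_mul, add_zero]
  rw [hV.apply_sum_real_mul_xi hx0 fun m ↦ differentiableAt_coef hz m j]
  have h1 (i : Fin n) : dX j (V.x i) z = real (pd j (vcomp X φ i) z.1) := by
    rw [dX_congr (hx i), dX_real (differentiableAt_vcomp hX hz i)]
  simp only [h1, Finset.sum_mul]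
  rw [Finset.sum_comm (s := (Finset.univ : Finset (Fin n))) (f := fun i m ↦
    real (g.coef φ m i z.1) * xi m * real (pd j (vcomp X φ i) z.1)), add_right_comm,
    ← Finset.sum_add_distrib]
  congr 1
  refine Finset.sum_congr rfl fun m _ ↦ ?_
  rw [Finset.sum_add_distrib, real_add, add_mul]
  congr 1
  rw [real_sum, Finset.sum_mul]
  refine Finset.sum_congr rfl fun k _ ↦ ?_
  rw [real_comm, real_mul, ← mul_assoc, real_comm]

lemma lieDeriv_beta_p (hX : IsSmooth X) (hz : z.1 ∈ φ.1.target)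
    (hx : ∀ i, V.x i =ᶠ[𝓝 z] fun z ↦ real (vcomp X φ i z.1)) (j : Fin n) :
    (V.lieDeriv (g.beta φ)).p j z = 0 := by
  simp only [LocalField.lieDeriv, beta, zero_mul, add_zero]
  rw [V.apply_const]
  refine (add_eq_right.2 (by simp)).trans (Finset.sum_eq_zero fun i _ ↦ ?_)
  rw [dP_congr (hx i), dP_real (differentiableAt_vcomp hX hz i), mul_zero]

lemma lieDeriv_beta_xi (hx : ∀ i, V.x i =ᶠ[𝓝 z] fun z ↦ real (vcomp X φ i z.1)) (j : Fin n) :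
    (V.lieDeriv (g.beta φ)).xi j z = 0 := by
  simp only [LocalField.lieDeriv, beta, zero_mul, add_zero, sub_zero]
  rw [V.apply_const]
  refine (add_eq_right.2 (by simp)).trans (Finset.sum_eq_zero fun i _ ↦ ?_)
  rw [dXi_apply, (hx i).eq_of_nhds, leftDeriv_real, mul_zero, neg_zero]

/-- The odd components are again left free: combined with the equation for β, this is the constraint
on X itself. Terms with ∂V(xⁱ)/∂ξ disappear because V(xⁱ) is a function of x alone. -/
lemma lieDeriv_alpha_xi (hV : V.IsEvenAt z) (hz : z.1 ∈ φ.1.target)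
    (hx : ∀ i, V.x i =ᶠ[𝓝 z] fun z ↦ real (vcomp X φ i z.1)) (j : Fin n) :
    (V.lieDeriv (g.alpha φ hbar)).xi j z = planck hbar •
      (∑ m, real (∑ k, vcomp X φ k z.1 * pd k (g.coef φ m j) z.1) * xi m
      + ∑ k, real (g.coef φ k j z.1) * V.xi k z
      + ∑ k, (∑ b, real (g.coef φ b k z.1) * xi b) * leftDeriv j (V.xi k z)) := by
  have hx0 (i : Fin n) : V.x i z = real (vcomp X φ i z.1) := (hx i).eq_of_nhds
  have hd (m : Fin n) : DifferentiableAt ℝ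
      (fun z : Coord n × Coord n ↦ (real (g.coef φ m j z.1) * xi m : Grassmann n)) z :=
    grassmann_mul_differentiableAt (differentiableAt_real_fst (differentiableAt_coef hz m j))
      (differentiableAt_const _)
  have h1 (i : Fin n) : dXi j (V.x i) z = 0 := by rw [dXi_apply, hx0, leftDeriv_real]
  simp only [LocalField.lieDeriv, h1]
  simp only [alpha, zero_mul, mul_zero, neg_zero, sub_zero, zero_add]
  rw [V.apply_smul _ (DifferentiableAt.fun_sum fun m _ ↦ hd m),
    hV.apply_sum_real_mul_xi hx0 fun m ↦ differentiableAt_coef hz m j]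
  simp only [smul_mul_assoc, ← Finset.smul_sum, ← smul_add]
  rfl

/-- Neither V(xⁱ) nor V(ξᵏ) depends on the momenta, so the dp part imposes no condition. -/
lemma lieDeriv_alpha_p (hX : IsSmooth X) (hl : ContMDiff (𝓡 n) 𝓘(ℝ, ℝ) ∞ lam)
    (hz : z.1 ∈ φ.1.target)
    (hx : ∀ i, V.x i =ᶠ[𝓝 z] fun z ↦ real (vcomp X φ i z.1))
    (hxi : ∀ k, V.xi k =ᶠ[𝓝 z] fun z ↦ ∑ m, real (confMatrix φ X lam k m z.1) * xi m)
    (j : Fin n) :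
    (V.lieDeriv (g.alpha φ hbar)).p j z = 0 := by
  have h1 (i : Fin n) : dP j (V.x i) z = 0 := by
    rw [dP_congr (hx i), dP_real (differentiableAt_vcomp hX hz i)]
  have h2 (i : Fin n) : dP j (V.xi i) z = 0 := by
    rw [dP_congr (hxi i)]
    exact dP_sum_real_mul _ _ (fun m ↦ differentiableAt_confMatrix hX hl hz i m) j
  simp only [LocalField.lieDeriv, h1, h2]
  simp only [alpha, zero_mul, mul_zero, add_zero, Finset.sum_const_zero]
  rw [V.apply_const]
  simp

/-- V(pₗ) occurs once, undifferentiated and with coefficient 1, from the term pₗ dxˡ. The five sums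
of `lieChristoffel` come from V acting on the two factors ξ, on the coefficient, on dx and on dξ. -/
lemma lieDeriv_alpha_x (hX : IsSmooth X) (hl : ContMDiff (𝓡 n) 𝓘(ℝ, ℝ) ∞ lam)
    (hV : V.IsEvenAt z) (hz : z.1 ∈ φ.1.target)
    (hx : ∀ i, V.x i =ᶠ[𝓝 z] fun z ↦ real (vcomp X φ i z.1))
    (hxi : ∀ k, V.xi k =ᶠ[𝓝 z] fun z ↦ ∑ m, real (confMatrix φ X lam k m z.1) * xi m)
    (l : Fin n) :
    (V.lieDeriv (g.alpha φ hbar)).x l z = V.p l z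
      + ∑ i, real (z.2 i * pd l (vcomp X φ i) z.1)
      + planck hbar • ∑ b, ∑ m, real (g.lieChristoffel φ X lam l b m z.1) * (xi b * xi m) := by
  have hx0 (i : Fin n) : V.x i z = real (vcomp X φ i z.1) := (hx i).eq_of_nhds
  have hxi0 (k : Fin n) : V.xi k z = ∑ m, real (confMatrix φ X lam k m z.1) * xi m :=
    (hxi k).eq_of_nhds
  have hdW (i k l : Fin n) := differentiableAt_christoffelLower (g := g) hz i k l
  have hd (i k : Fin n) : DifferentiableAt ℝ (fun z : Coord n × Coord n ↦
      (real (g.christoffelLower φ i k l z.1) * (xi i * xi k) : Grassmann n)) z :=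
    grassmann_mul_differentiableAt (differentiableAt_real_fst (hdW i k l)) (differentiableAt_const _)
  have hd2 (i : Fin n) := DifferentiableAt.fun_sum (u := Finset.univ) fun k _ ↦ hd i k
  have hd3 := DifferentiableAt.fun_sum (u := Finset.univ) fun i _ ↦ hd2 i
  have h1 (i : Fin n) : dX l (V.x i) z = real (pd l (vcomp X φ i) z.1) := by
    rw [dX_congr (hx i), dX_real (differentiableAt_vcomp hX hz i)]
  have h2 (i : Fin n) : dX l (V.xi i) z = ∑ m, real (pd l (confMatrix φ X lam i m) z.1) * xi m := by
    rw [dX_congr (hxi i)]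
    exact dX_sum_real_mul _ _ (fun m ↦ differentiableAt_confMatrix hX hl hz i m) l
  have h3 : V.apply ((g.alpha φ hbar).x l) z = V.p l z + planck hbar •
      ∑ b, ∑ m, (real (∑ i, vcomp X φ i z.1 * pd i (g.christoffelLower φ b m l) z.1)
          * (xi b * xi m)
        + real (g.christoffelLower φ b m l z.1) * (V.xi b z * xi m + xi b * V.xi m z)) := by
    rw [alpha_x_eq, V.apply_add (differentiableAt_real_snd l z) (hd3.fun_const_smul (planck hbar)),
      V.apply_real_p, V.apply_smul _ hd3, V.apply_sum _ fun i _ ↦ hd2 i]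
    congr 2
    refine Finset.sum_congr rfl fun b _ ↦ ?_
    rw [V.apply_sum _ fun i _ ↦ hd b i]
    exact Finset.sum_congr rfl fun m _ ↦ hV.apply_real_mul_xi_mul_xi hx0 (hdW b m l) b m
  have h4 : ∑ i, (g.alpha φ hbar).x i z * dX l (V.x i) z = ∑ i, real (z.2 i * pd l (vcomp X φ i) z.1)
      + planck hbar • quadratic
        (fun b m ↦ ∑ i, pd l (vcomp X φ i) z.1 * g.christoffelLower φ b m i z.1) := by
    rw [quadratic_sum, Finset.smul_sum, ← Finset.sum_add_distrib]
    refine Finset.sum_congr rfl fun i _ ↦ ?_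
    rw [h1, alpha_x_eq, ← quadratic_mul_real, add_mul, real_mul, smul_mul_assoc]
    rfl
  have h5 : ∑ i, (g.alpha φ hbar).xi i z * dX l (V.xi i) z = planck hbar • quadratic
        (fun b m ↦ ∑ k, g.coef φ b k z.1 * pd l (confMatrix φ X lam k m) z.1) := by
    rw [quadratic_sum, Finset.smul_sum]
    refine Finset.sum_congr rfl fun i _ ↦ ?_
    rw [h2, ← linear_mul_linear, ← smul_mul_assoc]
    rfl
  have h6 : (V.lieDeriv (g.alpha φ hbar)).x l z = V.apply ((g.alpha φ hbar).x l) z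
      + (∑ i, (g.alpha φ hbar).x i z * dX l (V.x i) z
      + ∑ i, (g.alpha φ hbar).xi i z * dX l (V.xi i) z) := by
    rw [← Finset.sum_add_distrib]
    simp only [LocalField.lieDeriv, alpha, zero_mul, add_zero]
  rw [h6, h3, h4, h5]
  simp only [hxi0, Finset.sum_add_distrib (f := fun m ↦ real (∑ i, vcomp X φ i z.1 *
    pd i (g.christoffelLower φ _ m l) z.1) * (xi _ * xi m))]
  rw [Finset.sum_add_distrib, sum_linear_mul_xi]
  have h7 : ∑ b, ∑ m, real (g.lieChristoffel φ X lam l b m z.1) * (xi b * xi m)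
      = quadratic (fun b m ↦ ∑ i, vcomp X φ i z.1 * pd i (g.christoffelLower φ b m l) z.1)
        + quadratic (fun b m ↦ ∑ k, confMatrix φ X lam k b z.1 * g.christoffelLower φ k m l z.1
          + ∑ k, g.christoffelLower φ b k l z.1 * confMatrix φ X lam k m z.1)
        + quadratic (fun b m ↦ ∑ i, pd l (vcomp X φ i) z.1 * g.christoffelLower φ b m i z.1)
        + quadratic (fun b m ↦ ∑ k, g.coef φ b k z.1 * pd l (confMatrix φ X lam k m) z.1) := by
    rw [← quadratic_add, ← quadratic_add, ← quadratic_add, quadratic]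
    refine Finset.sum_congr rfl fun b _ ↦ Finset.sum_congr rfl fun m _ ↦ ?_
    congr 2
    rw [lieChristoffel]
    ring
  rw [h7]
  simp only [smul_add]
  have h8 : ∑ b, ∑ m, real (∑ i, vcomp X φ i z.1 * pd i (g.christoffelLower φ b m l) z.1)
      * (xi b * xi m)
      = quadratic (fun b m ↦ ∑ i, vcomp X φ i z.1 * pd i (g.christoffelLower φ b m l) z.1) := rfl
  rw [h8]
  abel

end PseudoRiemannianMetric
end Supercotangent

namespace Supercotangent
variable {n : ℕ}

/-! ### The conformal lift in natural coordinates -/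

open Filter Topology

/-- The linear element `∑ uₘ ξᵐ` of the Grassmann algebra. -/
def linear (u : Fin n → ℝ) : Grassmann n := ∑ m, real (u m) * xi m

lemma linear_add (u v : Fin n → ℝ) : linear (fun m ↦ u m + v m) = linear u + linear v := by
  simp only [linear, real_add, add_mul, Finset.sum_add_distrib]

lemma linear_sub (u v : Fin n → ℝ) : linear (fun m ↦ u m - v m) = linear u - linear v := by
  simp only [linear, real_sub, sub_mul, Finset.sum_sub_distrib]

lemma linear_zero : linear (fun _ ↦ 0 : Fin n → ℝ) = 0 := by
  simp [linear, real_zero]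

lemma linear_mul (a : ℝ) (u : Fin n → ℝ) : linear (fun m ↦ a * u m) = real a * linear u := by
  simp only [linear, real_mul, Finset.mul_sum, mul_assoc]

lemma sum_real_mul_linear {ι : Type*} (s : Finset ι) (a : ι → ℝ) (A : ι → Fin n → ℝ) :
    ∑ k ∈ s, real (a k) * linear (A k) = linear (fun m ↦ ∑ k ∈ s, a k * A k m) := by
  simp only [linear, Finset.mul_sum, real_sum, Finset.sum_mul]
  rw [Finset.sum_comm]
  simp only [real_mul, mul_assoc]

lemma leftDeriv_linear (j : Fin n) (u : Fin n → ℝ) : leftDeriv j (linear u) = real (u j) := by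
  simp [linear, leftDeriv_real_mul, leftDeriv_xi]

lemma linear_mem_parity (u : Fin n → ℝ) : linear u ∈ parity n 1 := by
  refine Submodule.sum_mem _ fun m _ ↦ ?_
  rw [real_mul_eq_smul]
  exact Submodule.smul_mem _ _ (xi_mem_parity m)

lemma linear_mul_linear_mem_parity (u v : Fin n → ℝ) : linear u * linear v ∈ parity n 0 := by
  have h := mul_mem_parity (linear_mem_parity u) (linear_mem_parity v)
  rwa [show (1 : ZMod 2) + 1 = 0 by decide] at h

lemma linear_anticomm (u v : Fin n → ℝ) : linear u * linear v = -(linear v * linear u) := by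
  rw [odd_mul (linear_mem_parity u), grade_odd (linear_mem_parity v), neg_mul]

lemma linear_mul_linear_eq (u v : Fin n → ℝ) :
    linear u * linear v = quadratic (fun b m ↦ u b * v m) := linear_mul_linear u v

/-- The ξⁱ anticommute, so a quadratic element depends only on the skew part of its coefficients,
and skew-symmetrizing u ⊗ v loses nothing. -/
lemma quadratic_half_antisymm (u v : Fin n → ℝ) :
    quadratic (fun b m ↦ 1 / 2 * (u b * v m - u m * v b)) = linear u * linear v := by
  have h : quadratic (fun b m ↦ u b * v m - u m * v b) + linear v * linear u
      = linear u * linear v := by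
    rw [linear_mul_linear_eq, linear_mul_linear_eq, ← quadratic_add]
    congr
    funext b m
    ring
  rw [← quadratic_mul_real, eq_sub_of_add_eq h, linear_anticomm v u, sub_neg_eq_add, ← two_mul,
    real_comm, ← mul_assoc, show (2 : Grassmann n) = real 2 from (map_ofNat realHom 2).symm, ← real_mul]
  norm_num [real_one]

lemma smul_real_mul (c : ℂ) (r : ℝ) (a : Grassmann n) : c • (real r * a) = (c * r) • a := by
  rw [real_mul_eq_smul, smul_smul]

variable {M : Type*} [TopologicalSpace M] [ChartedSpace (Coord n) M] [IsManifold (𝓡 n) ∞ M]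

namespace PseudoRiemannianMetric

/-- The vector field `X` satisfies `L_X g = lam g` with `lam` smooth. -/
structure IsConformalFactor (g : PseudoRiemannianMetric n M) (X : VField n M) (lam : M → ℝ) :
    Prop where
  smooth : IsSmooth X
  smooth_factor : ContMDiff (𝓡 n) 𝓘(ℝ, ℝ) ∞ lam
  lieCoef_eq : ∀ (φ : Chart n M) (i j : Fin n), ∀ y ∈ φ.1.target,
    g.lieCoef φ X i j y = lam (φ.1.symm y) * g.coef φ i j y

lemma mem_conf_iff {g : PseudoRiemannianMetric n M} {X : VField n M} :
    X ∈ g.conf ↔ ∃ lam, g.IsConformalFactor X lam :=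
  ⟨fun ⟨h1, lam, h2, h3⟩ ↦ ⟨lam, h1, h2, h3⟩, fun ⟨lam, h1, h2, h3⟩ ↦ ⟨h1, lam, h2, h3⟩⟩

/-- The lift of a conformal vector field, in natural coordinates. -/
def confLift (g : PseudoRiemannianMetric n M) (φ : Chart n M) (X : VField n M) (lam : M → ℝ)
    (hbar : ℝ) : LocalField n where
  x i := fun z ↦ real (vcomp X φ i z.1)
  p j := fun z ↦ -∑ i, real (z.2 i * pd j (vcomp X φ i) z.1) - planck hbar •
    (linear (fun b ↦ g.coef φ j b z.1) * linear (fun m ↦ pd m (fun y ↦ lam (φ.1.symm y)) z.1))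
  xi k := fun z ↦ linear (fun m ↦ confMatrix φ X lam k m z.1)

variable {g : PseudoRiemannianMetric n M} {φ : Chart n M} {X : VField n M} {lam : M → ℝ}
  {V : LocalField n} {y : Coord n} {z : Coord n × Coord n} {hbar : ℝ}

/-- The shift by −½λ absorbs the conformal factor: X acting on points together with A acting on ξ
preserves g infinitesimally. This is the dξ part of L_V α = 0. -/
lemma IsConformalFactor.confMatrix_skew (h : g.IsConformalFactor X lam) (hy : y ∈ φ.1.target)
    (m j : Fin n) :
    ∑ k, vcomp X φ k y * pd k (g.coef φ m j) y + ∑ k, g.coef φ k j y * confMatrix φ X lam k m y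
      + ∑ k, g.coef φ m k y * confMatrix φ X lam k j y = 0 := by
  have h1 := h.lieCoef_eq φ m j y hy
  simp only [lieCoef, Finset.sum_add_distrib] at h1
  simp only [confMatrix, mul_sub, mul_ite, mul_zero, Finset.sum_sub_distrib, Finset.sum_ite_eq',
    Finset.mem_univ, if_true]
  linear_combination h1

/-- The coefficient form of L_V β = ½λ β. Of the three terms of L_X g only one involves A, whose
shift removes half of the factor. -/
lemma IsConformalFactor.sum_coef_mul_confMatrix' (h : g.IsConformalFactor X lam)
    (hy : y ∈ φ.1.target) (m j : Fin n) :
    ∑ k, (vcomp X φ k y * pd k (g.coef φ m j) y + g.coef φ m k y * pd j (vcomp X φ k) y)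
      + ∑ k, g.coef φ k j y * confMatrix φ X lam k m y
      = 1 / 2 * lam (φ.1.symm y) * g.coef φ m j y := by
  have h1 := h.lieCoef_eq φ m j y hy
  simp only [lieCoef, Finset.sum_add_distrib] at h1
  simp only [confMatrix, mul_sub, mul_ite, mul_zero, Finset.sum_sub_distrib, Finset.sum_ite_eq',
    Finset.mem_univ, if_true, Finset.sum_add_distrib]
  linear_combination h1

/-- Raising the first index in `sum_coef_mul_confMatrix` expresses A without λ, as the odd part of
the explicit formula requires. -/
lemma IsConformalFactor.confMatrix_eq (h : g.IsConformalFactor X lam) (hy : y ∈ φ.1.target)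
    (k j : Fin n) :
    confMatrix φ X lam k j y = ∑ i, g.inv φ i k y * g.rot φ X i j y
      - ∑ i, vcomp X φ i y * g.christoffel φ k i j y := by
  have h1 (a : Fin n) := sum_coef_mul_confMatrix h.smooth (h.lieCoef_eq φ) hy a j
  have h2 : ∑ a, g.inv φ k a y * ∑ l, g.coef φ a l y * confMatrix φ X lam l j y
      = confMatrix φ X lam k j y := by
    have : ∀ l, (∑ a, g.inv φ k a y * g.coef φ a l y) * confMatrix φ X lam l j y =
        if k = l then confMatrix φ X lam l j y else 0 := fun l ↦ by
      rw [g.sum_inv_mul_coef φ hy, ite_mul, one_mul, zero_mul]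
    simp only [Finset.mul_sum, ← mul_assoc]
    rw [Finset.sum_comm]
    simp only [← Finset.sum_mul, this, Finset.sum_ite_eq, Finset.mem_univ, if_true]
  have h3 (i : Fin n) : ∑ a, g.inv φ k a y * g.christoffelLower φ a j i y
      = g.christoffel φ k i j y := by
    have : ∀ l, (∑ a, g.inv φ k a y * g.coef φ a l y) * g.christoffel φ l j i y =
        if k = l then g.christoffel φ l j i y else 0 := fun l ↦ by
      rw [g.sum_inv_mul_coef φ hy, ite_mul, one_mul, zero_mul]
    simp only [christoffelLower, Finset.mul_sum, ← mul_assoc]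
    rw [Finset.sum_comm]
    simp only [← Finset.sum_mul, this, Finset.sum_ite_eq, Finset.mem_univ, if_true]
    exact g.christoffel_symm φ k j i y
  rw [← h2]
  simp only [h1, mul_sub, Finset.sum_sub_distrib]
  congr 1
  · exact Finset.sum_congr rfl fun i _ ↦ by rw [g.inv_symm φ k i]
  · simp only [Finset.mul_sum, mul_left_comm (g.inv φ k _ y)]
    rw [Finset.sum_comm]
    simp only [← Finset.mul_sum, h3]

lemma IsConformalFactor.quadratic_lieChristoffel (h : g.IsConformalFactor X lam)
    (hy : y ∈ φ.1.target) (l : Fin n) :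
    quadratic (fun b m ↦ g.lieChristoffel φ X lam l b m y) =
      linear (fun b ↦ g.coef φ l b y) * linear (fun m ↦ pd m (fun y ↦ lam (φ.1.symm y)) y) := by
  rw [← quadratic_half_antisymm]
  congr
  funext b m
  rw [lieChristoffel_conformal h.smooth h.smooth_factor (h.lieCoef_eq φ) hy, g.coef_symm φ l b,
    g.coef_symm φ l m]

/-- For a lift with the right odd components, the momentum components are determined by the
invariance of `α`. -/
lemma IsConformalFactor.lieDeriv_alpha_x_eq_zero_iff (h : g.IsConformalFactor X lam)
    (hV : V.IsEvenAt z) (hz : z.1 ∈ φ.1.target)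
    (hx : ∀ i, V.x i =ᶠ[𝓝 z] (g.confLift φ X lam hbar).x i)
    (hxi : ∀ k, V.xi k =ᶠ[𝓝 z] (g.confLift φ X lam hbar).xi k) (l : Fin n) :
    (V.lieDeriv (g.alpha φ hbar)).x l z = 0 ↔ V.p l z = (g.confLift φ X lam hbar).p l z := by
  have h1 := h.quadratic_lieChristoffel hz l
  rw [quadratic] at h1
  rw [lieDeriv_alpha_x h.smooth h.smooth_factor hV hz hx hxi, h1, add_assoc, add_eq_zero_iff_eq_neg,
    neg_add, ← sub_eq_add_neg]
  rfl

lemma IsConformalFactor.lieDeriv_alpha_xi_eq_zero (h : g.IsConformalFactor X lam)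
    (hV : V.IsEvenAt z) (hz : z.1 ∈ φ.1.target)
    (hx : ∀ i, V.x i =ᶠ[𝓝 z] (g.confLift φ X lam hbar).x i)
    (hxi : ∀ k, V.xi k z = (g.confLift φ X lam hbar).xi k z) (j : Fin n) :
    (V.lieDeriv (g.alpha φ hbar)).xi j z = 0 := by
  rw [lieDeriv_alpha_xi hV hz hx]
  simp only [hxi, confLift, leftDeriv_linear, real_comm]
  rw [sum_real_mul_linear]
  have h1 (k : Fin n) : ∑ b, real (g.coef φ b k z.1) * xi b
      = linear (fun b ↦ g.coef φ b k z.1) := rfl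
  have h2 : ∑ m, real (∑ k, vcomp X φ k z.1 * pd k (g.coef φ m j) z.1) * xi m
      = linear (fun m ↦ ∑ k, vcomp X φ k z.1 * pd k (g.coef φ m j) z.1) := rfl
  simp only [h1, h2]
  rw [sum_real_mul_linear, ← linear_add, ← linear_add]
  have h3 (m : Fin n) := h.confMatrix_skew hz m j
  simp only [mul_comm (confMatrix φ X lam _ j z.1), h3, linear_zero, smul_zero]

lemma IsConformalFactor.lieDeriv_beta_x_eq (h : g.IsConformalFactor X lam)
    (hV : V.IsEvenAt z) (hz : z.1 ∈ φ.1.target)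
    (hx : ∀ i, V.x i =ᶠ[𝓝 z] (g.confLift φ X lam hbar).x i)
    (hxi : ∀ k, V.xi k z = (g.confLift φ X lam hbar).xi k z) (j : Fin n) :
    (V.lieDeriv (g.beta φ)).x j z
      = ((1 / 2 * lam (φ.1.symm z.1) : ℝ) : ℂ) • (g.beta φ).x j z := by
  rw [lieDeriv_beta_x h.smooth hV hz hx]
  simp only [hxi, confLift]
  rw [sum_real_mul_linear]
  have h2 : ∑ m, real (∑ k, (vcomp X φ k z.1 * pd k (g.coef φ m j) z.1
      + g.coef φ m k z.1 * pd j (vcomp X φ k) z.1)) * xi m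
      = linear (fun m ↦ ∑ k, (vcomp X φ k z.1 * pd k (g.coef φ m j) z.1
      + g.coef φ m k z.1 * pd j (vcomp X φ k) z.1)) := rfl
  rw [h2, ← linear_add]
  simp only [h.sum_coef_mul_confMatrix' hz]
  rw [linear_mul, real_mul_eq_smul]
  rfl

/-- The conformal lift is given by the explicit formula. -/
lemma IsConformalFactor.confLift_xi (h : g.IsConformalFactor X lam) (hz : z.1 ∈ φ.1.target)
    (k : Fin n) : (g.confLift φ X lam hbar).xi k z = (g.explicitLift φ X hbar).xi k z := by
  simp only [confLift, h.confMatrix_eq hz, explicitLift, linear_sub]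
  simp only [linear, real_sum, Finset.sum_mul]
  congr 1 <;> exact Finset.sum_comm

/-- In the part linear in p, the Christoffel terms of the horizontal lift and of ∇X cancel because
the connection is torsion free. The ξξ-parts agree because both are evaluations of `lieChristoffel`.
-/
lemma IsConformalFactor.confLift_p (h : g.IsConformalFactor X lam) (hz : z.1 ∈ φ.1.target)
    (i : Fin n) : (g.confLift φ X lam hbar).p i z = (g.explicitLift φ X hbar).p i z := by
  simp only [confLift, explicitLift]
  have h1 : ∑ j, ∑ k, vcomp X φ j z.1 * g.christoffel φ k j i z.1 * z.2 k
      - ∑ j, z.2 j * g.nablaX φ X i j z.1 = -∑ j, z.2 j * pd i (vcomp X φ j) z.1 := by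
    rw [Finset.sum_comm, ← Finset.sum_sub_distrib, ← Finset.sum_neg_distrib]
    refine Finset.sum_congr rfl fun j _ ↦ ?_
    rw [nablaX, mul_add, Finset.mul_sum, sub_add_eq_sub_sub, sub_right_comm,
      ← Finset.sum_sub_distrib, Finset.sum_eq_zero, zero_sub]
    intro k _
    rw [g.christoffel_symm φ j k i]
    ring
  have h2 := congrArg (real (n := n)) h1
  simp only [real_sub, real_neg, real_sum] at h2
  rw [← h2, sub_eq_add_neg (_ - _), ← smul_neg]
  congr 2
  rw [← h.quadratic_lieChristoffel hz]
  have h3 : ∑ k, ∑ l, ∑ j, real (g.riemann φ k l i j z.1) * g.xiLower φ k z.1 * xi l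
        * real (vcomp X φ j z.1)
      = quadratic (fun b m ↦ ∑ j, vcomp X φ j z.1 *
        ∑ k, g.coef φ b k z.1 * g.riemann φ k m i j z.1) := by
    have h5 (k l j : Fin n) : real (g.riemann φ k l i j z.1) * g.xiLower φ k z.1 * xi l
        * real (vcomp X φ j z.1) = quadratic (fun b m ↦ if m = l then
          vcomp X φ j z.1 * (g.coef φ k b z.1 * g.riemann φ k l i j z.1) else 0) := by
      simp only [xiLower, quadratic, apply_ite real, real_zero, ite_mul, zero_mul,
        Finset.sum_ite_eq', Finset.mem_univ, if_true]
      rw [real_comm, Finset.mul_sum, Finset.sum_mul, Finset.mul_sum]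
      refine Finset.sum_congr rfl fun b _ ↦ ?_
      simp only [real_mul, ← mul_assoc]
      congr 2
      rw [← real_mul, ← real_mul, ← real_mul, ← real_mul]
      congr 1
      ring
    simp only [h5, ← quadratic_sum]
    congr
    funext b m
    have h6 (k : Fin n) : ∑ l, ∑ j, (if m = l then
        vcomp X φ j z.1 * (g.coef φ k b z.1 * g.riemann φ k l i j z.1) else 0)
        = ∑ j, vcomp X φ j z.1 * (g.coef φ b k z.1 * g.riemann φ k m i j z.1) := by
      rw [Finset.sum_comm]
      simp only [Finset.sum_ite_eq, Finset.mem_univ, if_true, g.coef_symm φ k b]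
    simp only [h6, Finset.mul_sum]
    exact Finset.sum_comm
  have h4 : ∑ k, ∑ l, real (g.nablaRot φ X i k l z.1) * xi k * xi l
      = quadratic (fun b m ↦ g.nablaRot φ X i b m z.1) := by
    simp only [quadratic, mul_assoc]
  rw [h3, h4, eq_sub_iff_add_eq, neg_add_eq_iff_eq_add, ← quadratic_add]
  congr
  funext b m
  rw [lieChristoffel_eq_curvature h.smooth h.smooth_factor (h.lieCoef_eq φ) hz, sub_add_cancel]

end PseudoRiemannianMetric
end Supercotangent

namespace Supercotangent
variable {n : ℕ}

/-! ### Lifts that preserve `α` and the direction of `β` -/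

open Filter Topology

variable {M : Type*} [TopologicalSpace M] [ChartedSpace (Coord n) M]

lemma SuperVectorField.isEvenAt (V : SuperVectorField n M) (φ : Chart n M) (z : Coord n × Coord n) :
    (V.comp φ).IsEvenAt z :=
  ⟨(V.even_x φ · z), (V.even_p φ · z), (V.odd_xi φ · z)⟩

lemma Chart.eventually_domain {φ : Chart n M} {z : Coord n × Coord n} (hz : z ∈ φ.domain) :
    ∀ᶠ w in 𝓝 z, w ∈ φ.domain :=
  φ.isOpen_domain.mem_nhds hz

lemma planck_ne_zero {hbar : ℝ} (h : hbar ≠ 0) : PseudoRiemannianMetric.planck hbar ≠ 0 := by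
  simp [PseudoRiemannianMetric.planck, h]

lemma PseudoRiemannianMetric.IsLift.eventuallyEq {X : VField n M} {V : SuperVectorField n M}
    (h : IsLift X V) {φ : Chart n M} {z : Coord n × Coord n} (hz : z ∈ φ.domain) (i : Fin n) :
    (V.comp φ).x i =ᶠ[𝓝 z] fun z ↦ real (vcomp X φ i z.1) :=
  (Chart.eventually_domain hz).mono fun w hw ↦ h φ i w hw

variable [IsManifold (𝓡 n) ∞ M]

namespace PseudoRiemannianMetric

variable {g : PseudoRiemannianMetric n M} {φ : Chart n M} {X : VField n M} {lam : M → ℝ}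
  {V : LocalField n} {y : Coord n} {z : Coord n × Coord n} {hbar : ℝ}

/-- Lowering the index of Grassmann valued vectors is injective. -/
lemma eq_of_sum_coef_mul_eq (hy : y ∈ φ.1.target) {u v : Fin n → Grassmann n}
    (h : ∀ j, ∑ k, real (g.coef φ k j y) * u k = ∑ k, real (g.coef φ k j y) * v k) : u = v := by
  have key (u : Fin n → Grassmann n) (l : Fin n) :
      u l = ∑ j, real (g.inv φ l j y) * ∑ k, real (g.coef φ k j y) * u k := by
    have h1 (k : Fin n) : (∑ j, real (g.inv φ l j y) * real (g.coef φ k j y)) * u k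
        = if l = k then u k else 0 := by
      simp only [← real_mul, ← real_sum, g.coef_symm φ k, g.sum_inv_mul_coef φ hy]
      split_ifs <;> simp [real_one, real_zero]
    simp only [Finset.mul_sum, ← mul_assoc]
    rw [Finset.sum_comm]
    simp only [← Finset.sum_mul, h1, Finset.sum_ite_eq, Finset.mem_univ, if_true]
  funext l
  rw [key u, key v]
  simp only [h]

/-- The odd components, with lowered index, of a lift that multiplies `β` by `f`. -/
lemma sum_coef_mul_xi_of_lieDeriv_beta (hX : IsSmooth X) (hV : V.IsEvenAt z)
    (hz : z.1 ∈ φ.1.target) (hx : ∀ i, V.x i =ᶠ[𝓝 z] fun z ↦ real (vcomp X φ i z.1)) {f : ℂ}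
    {j : Fin n} (hf : (V.lieDeriv (g.beta φ)).x j z = f • (g.beta φ).x j z) :
    ∑ k, real (g.coef φ k j z.1) * V.xi k z = ∑ m, (f * g.coef φ m j z.1
      - ((∑ k, (vcomp X φ k z.1 * pd k (g.coef φ m j) z.1
        + g.coef φ m k z.1 * pd j (vcomp X φ k) z.1) : ℝ) : ℂ)) • xi m := by
  rw [lieDeriv_beta_x hX hV hz hx] at hf
  rw [eq_sub_of_add_eq' hf]
  simp only [beta, Finset.smul_sum, smul_real_mul, sub_smul, Finset.sum_sub_distrib]
  simp only [real_mul_eq_smul]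

/-- A vector field with a lift that preserves `α` and the direction of `β` is conformal. -/
lemma lieCoef_of_lieDeriv (hh : hbar ≠ 0) (hX : IsSmooth X) (hV : V.IsEvenAt z)
    (hz : z.1 ∈ φ.1.target) (hx : ∀ i, V.x i =ᶠ[𝓝 z] fun z ↦ real (vcomp X φ i z.1)) {f : ℂ}
    (hf : ∀ j, (V.lieDeriv (g.beta φ)).x j z = f • (g.beta φ).x j z)
    {j : Fin n} (hα : (V.lieDeriv (g.alpha φ hbar)).xi j z = 0) (m : Fin n) :
    (g.lieCoef φ X m j z.1 : ℂ) = 2 * f * g.coef φ m j z.1 := by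
  have h1 (j : Fin n) := sum_coef_mul_xi_of_lieDeriv_beta hX hV hz hx (hf j)
  rw [lieDeriv_alpha_xi hV hz hx] at hα
  have h2 := (smul_eq_zero.1 hα).resolve_left (planck_ne_zero hh)
  -- Moving ∂/∂ξʲ outside the contraction with g leaves only the lowered odd components, for which
  -- the β equation gives a formula.
  have h3 : ∑ k, (∑ b, real (g.coef φ b k z.1) * xi b) * leftDeriv j (V.xi k z)
      = ∑ b, xi b * leftDeriv j (∑ k, real (g.coef φ k b z.1) * V.xi k z) := by
    simp only [map_sum, leftDeriv_real_mul, Finset.sum_mul, Finset.mul_sum]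
    rw [Finset.sum_comm]
    refine Finset.sum_congr rfl fun b _ ↦ Finset.sum_congr rfl fun k _ ↦ ?_
    rw [← mul_assoc, real_comm, g.coef_symm φ b k]
  have h4 (c : ℂ) (b : Fin n) : xi b * (c • (1 : Grassmann n)) = c • xi b := by
    rw [mul_smul_comm, mul_one]
  rw [h3] at h2
  simp only [h1] at h2
  simp only [map_sum, map_smul, leftDeriv_xi, smul_ite, smul_zero, Finset.sum_ite_eq,
    Finset.mem_univ, if_true, h4, real_mul_eq_smul, ← Finset.sum_add_distrib, ← add_smul] at h2
  -- The constraint is linear in the ξᵐ, so it can be read coefficient by coefficient.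
  have h5 := sum_real_mul_xi_injective (b := fun _ ↦ 0) (h2.trans (by simp)) m
  simp only [lieCoef, Finset.sum_add_distrib, g.coef_symm φ j] at h5 ⊢
  push_cast at h5 ⊢
  linear_combination -h5

end PseudoRiemannianMetric

open PseudoRiemannianMetric

variable {g : PseudoRiemannianMetric n M} {φ : Chart n M} {X : VField n M} {lam : M → ℝ}
  {V : SuperVectorField n M} {z : Coord n × Coord n} {hbar : ℝ}

namespace PseudoRiemannianMetric.IsConformalLift

lemma mem_conf (h : g.IsConformalLift hbar X V) (hh : hbar ≠ 0) (hX : IsSmooth X) : X ∈ g.conf := by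
  obtain ⟨h1, h2, f, hf, h3⟩ := h
  -- The factor f of β may be complex, but L_X g and g are real, so the real part of L_X g = 2 f g
  -- suffices. The momentum plays no role and is set to 0 below.
  refine ⟨hX, fun q ↦ 2 * (f q).re, ?_, fun φ i j y hy ↦ ?_⟩
  · exact contMDiff_const.mul (Complex.reCLM.contDiff.contMDiff.comp hf)
  · have hz : ((y, 0) : Coord n × Coord n) ∈ φ.domain := ⟨hy, trivial⟩
    have h4 := congrArg Complex.re (lieCoef_of_lieDeriv hh hX (V.isEvenAt φ (y, 0)) hy
      (h1.eventuallyEq hz) (fun j ↦ (h3 φ j _ hz).1) (h2 φ j _ hz).2.2 i)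
    simpa using h4

/-- Both factors are tied to L_X g, so f g = ½λ g entry by entry. The two fields then have the same
lowered odd components, and g is invertible. -/
lemma xi_eq (h : g.IsConformalLift hbar X V) (hh : hbar ≠ 0) (hl : g.IsConformalFactor X lam)
    (hz : z ∈ φ.domain) (k : Fin n) :
    (V.comp φ).xi k z = (g.confLift φ X lam hbar).xi k z := by
  obtain ⟨h1, h2, f, hf, h3⟩ := h
  refine congrFun (eq_of_sum_coef_mul_eq (g := g) hz.1
    (u := fun k ↦ (V.comp φ).xi k z) (v := fun k ↦ (g.confLift φ X lam hbar).xi k z) fun j ↦ ?_) k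
  have h4 (m : Fin n) := lieCoef_of_lieDeriv hh hl.smooth (V.isEvenAt φ z) hz.1
    (h1.eventuallyEq hz) (fun j ↦ (h3 φ j _ hz).1) (h2 φ j _ hz).2.2 m
  simp only [hl.lieCoef_eq φ _ _ _ hz.1] at h4
  rw [sum_coef_mul_xi_of_lieDeriv_beta hl.smooth (V.isEvenAt φ z) hz.1 (h1.eventuallyEq hz)
    (h3 φ j z hz).1]
  simp only [confLift]
  rw [sum_real_mul_linear, linear]
  refine Finset.sum_congr rfl fun m _ ↦ ?_
  rw [real_mul_eq_smul]
  congr 1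
  have h5 := congrArg ((↑) : ℝ → ℂ) (hl.sum_coef_mul_confMatrix' hz.1 m j)
  have h6 := h4 m
  push_cast at h5 h6 ⊢
  linear_combination -h5 - h6 / 2

/-- The Lie derivative differentiates the odd components, so `xi_eq` is needed on a neighbourhood of
the point. -/
lemma p_eq (h : g.IsConformalLift hbar X V) (hh : hbar ≠ 0) (hl : g.IsConformalFactor X lam)
    (hz : z ∈ φ.domain) (k : Fin n) :
    (V.comp φ).p k z = (g.confLift φ X lam hbar).p k z :=
  (hl.lieDeriv_alpha_x_eq_zero_iff (V.isEvenAt φ z) hz.1 (h.1.eventuallyEq hz)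
    (fun k ↦ (Chart.eventually_domain hz).mono fun _ hw ↦ h.xi_eq hh hl hw k) k).1
    (h.2.1 φ k z hz).1

lemma isExplicitLift (h : g.IsConformalLift hbar X V) (hh : hbar ≠ 0) (hX : X ∈ g.conf) :
    g.IsExplicitLift hbar X V := by
  obtain ⟨lam, hl⟩ := mem_conf_iff.1 hX
  exact fun φ i z hz ↦ ⟨h.1 φ i z hz, (h.p_eq hh hl hz i).trans (hl.confLift_p hz.1 i),
    (h.xi_eq hh hl hz i).trans (hl.confLift_xi hz.1 i)⟩

lemma unique {W : SuperVectorField n M} (hV : g.IsConformalLift hbar X V)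
    (hW : g.IsConformalLift hbar X W) (hh : hbar ≠ 0) (hX : X ∈ g.conf) : V = W := by
  obtain ⟨lam, hl⟩ := mem_conf_iff.1 hX
  refine SuperVectorField.ext (funext fun φ ↦ LocalField.ext ?_ ?_ ?_) <;>
    refine funext fun i ↦ funext fun z ↦ ?_ <;> by_cases hz : z ∈ φ.domain
  · rw [hV.1 φ i z hz, hW.1 φ i z hz]
  · rw [V.off_x φ i z hz, W.off_x φ i z hz]
  · rw [hV.p_eq hh hl hz, hW.p_eq hh hl hz]
  · rw [V.off_p φ i z hz, W.off_p φ i z hz]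
  · rw [hV.xi_eq hh hl hz, hW.xi_eq hh hl hz]
  · rw [V.off_xi φ i z hz, W.off_xi φ i z hz]

end PseudoRiemannianMetric.IsConformalLift
end Supercotangent

namespace Supercotangent
variable {n : ℕ}

/-! ### Existence of the conformal lift -/

open Filter Topology

lemma contDiffOn_real_fst {u : Coord n → ℝ} {s : Set (Coord n)} (hu : ContDiffOn ℝ ∞ u s) :
    ContDiffOn ℝ ∞ (fun z : Coord n × Coord n ↦ (real (u z.1) : Grassmann n)) (s ×ˢ Set.univ) :=
  real_contDiffOn (hu.comp contDiffOn_fst fun _ hz ↦ hz.1)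

lemma contDiffOn_linear {u : Fin n → Coord n → ℝ} {s : Set (Coord n)}
    (hu : ∀ m, ContDiffOn ℝ ∞ (u m) s) :
    ContDiffOn ℝ ∞ (fun z : Coord n × Coord n ↦ linear (fun m ↦ u m z.1)) (s ×ˢ Set.univ) :=
  ContDiffOn.sum fun m _ ↦ grassmann_mul_contDiffOn (contDiffOn_real_fst (hu m)) contDiffOn_const

/-- The vector field that agrees with `V` on `s` and is `0` elsewhere. -/
def LocalField.restrict (V : LocalField n) (s : Set (Coord n × Coord n)) : LocalField n where
  x i := s.indicator (V.x i)
  p i := s.indicator (V.p i)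
  xi i := s.indicator (V.xi i)

lemma LocalField.apply_eq_of_eq {V W : LocalField n} {z : Coord n × Coord n}
    (hx : ∀ i, V.x i z = W.x i z) (hp : ∀ i, V.p i z = W.p i z) (hxi : ∀ i, V.xi i z = W.xi i z)
    (F : SFun n) : V.apply F z = W.apply F z := by
  simp only [apply, hx, hp, hxi]

lemma LocalField.restrict_apply (V : LocalField n) {s : Set (Coord n × Coord n)}
    {z : Coord n × Coord n} (hz : z ∈ s) (F : SFun n) : (V.restrict s).apply F z = V.apply F z :=
  apply_eq_of_eq (fun _ ↦ Set.indicator_of_mem hz _) (fun _ ↦ Set.indicator_of_mem hz _)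
    (fun _ ↦ Set.indicator_of_mem hz _) F

lemma indicator_mem_parity {F : SFun n} {s : Set (Coord n × Coord n)} {a : ZMod 2}
    (h : ∀ z ∈ s, F z ∈ parity n a) (z : Coord n × Coord n) : s.indicator F z ∈ parity n a := by
  by_cases hz : z ∈ s
  · rw [Set.indicator_of_mem hz]
    exact h z hz
  · rw [Set.indicator_of_notMem hz]
    exact Submodule.zero_mem _

section Chart

variable {M : Type*} [TopologicalSpace M] [ChartedSpace (Coord n) M]

/-- The substitution `ξ'ⁱ = ∑ⱼ (∂x'ⁱ/∂xʲ) ξʲ`. -/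
def Chart.xiPullback (φ ψ : Chart n M) (y : Coord n) : Grassmann n →ₐ[ℂ] Grassmann n :=
  ExteriorAlgebra.map (Matrix.vecMulLinear ((φ.jacobian ψ y).map ((↑) : ℝ → ℂ)))

variable {φ ψ : Chart n M} {y : Coord n} {z : Coord n × Coord n}

lemma Chart.pullback_apply (F : SFun n) :
    φ.pullback ψ F z = φ.xiPullback ψ z.1 (F (φ.transition ψ z.1,
      WithLp.toLp 2 (Matrix.vecMul z.2.ofLp (ψ.jacobian φ (φ.transition ψ z.1))))) := rfl

lemma Chart.xiPullback_real (r : ℝ) : φ.xiPullback ψ y (real r) = real r :=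
  AlgHom.commutes _ _

lemma iota_eq_sum (v : Fin n → ℂ) : iota v = ∑ j, v j • (xi j : Grassmann n) := by
  simp only [xi_eq_iota, ← map_smul, ← map_sum]
  congr 1
  ext j
  simp [Finset.sum_apply, Pi.single_apply]

lemma Chart.xiPullback_xi (i : Fin n) :
    φ.xiPullback ψ y (xi i) = linear (fun j ↦ φ.jacobian ψ y i j) := by
  have h : φ.xiPullback ψ y (xi i) = iota (Matrix.vecMul (Pi.single i 1)
      ((φ.jacobian ψ y).map ((↑) : ℝ → ℂ))) := ExteriorAlgebra.map_apply_ι _ _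
  rw [h, iota_eq_sum]
  refine Finset.sum_congr rfl fun j _ ↦ ?_
  rw [real_mul_eq_smul, Matrix.single_one_vecMul]
  rfl

lemma Chart.xiPullback_linear (u : Fin n → ℝ) :
    φ.xiPullback ψ y (linear u) = linear (fun j ↦ ∑ i, u i * φ.jacobian ψ y i j) := by
  refine Eq.trans ?_ (sum_real_mul_linear Finset.univ u fun i j ↦ φ.jacobian ψ y i j)
  rw [linear, map_sum]
  exact Finset.sum_congr rfl fun i _ ↦ by rw [map_mul, xiPullback_real, xiPullback_xi]

lemma Chart.pullback_coordX (i : Fin n) :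
    φ.pullback ψ (coordX i) = fun z ↦ real (φ.transition ψ z.1 i) :=
  funext fun _ ↦ Chart.xiPullback_real _

lemma Chart.pullback_coordP (i : Fin n) :
    φ.pullback ψ (coordP i) = fun z ↦ ∑ j, real (z.2 j) *
      real (ψ.jacobian φ (φ.transition ψ z.1) j i) :=
  funext fun z ↦ (Chart.xiPullback_real _).trans (by
    simp only [← real_mul, ← real_sum]
    rfl)

lemma Chart.pullback_coordXi (i : Fin n) :
    φ.pullback ψ (coordXi i) = fun z ↦ ∑ j, real (φ.jacobian ψ z.1 i j) * xi j :=
  funext fun _ ↦ Chart.xiPullback_xi i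

variable [IsManifold (𝓡 n) ∞ M] {X : VField n M} {lam : M → ℝ}

/-- The derivative of the transformation law of the components of a vector field. -/
lemma pd_vcomp_transition (hX : IsSmooth X) (hy : y ∈ φ.overlap ψ) (i m : Fin n) :
    ∑ a, pd a (vcomp X ψ i) (φ.transition ψ y) * φ.jacobian ψ y a m =
      ∑ j, vcomp X φ j y * pd j (fun w ↦ φ.jacobian ψ w i m) y
        + ∑ j, φ.jacobian ψ y i j * pd m (vcomp X φ j) y := by
  have hJ (j : Fin n) : DifferentiableAt ℝ (fun w ↦ φ.jacobian ψ w i j) y :=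
    differentiableAt_of_contDiffOn (φ.isOpen_overlap ψ) (φ.contDiffOn_jacobian ψ i j) hy
  have hv (j : Fin n) : DifferentiableAt ℝ (vcomp X φ j) y :=
    differentiableAt_of_contDiffOn φ.isOpen_target (contDiffOn_vcomp hX φ j)
      (Chart.mem_overlap.1 hy).1
  have h := pd_comp_transition (f := vcomp X ψ i) hy
    (differentiableAt_of_contDiffOn ψ.isOpen_target (contDiffOn_vcomp hX ψ i)
      (Chart.transition_mem_target hy)) (fun w hw ↦ vcomp_transition X hw i) m
  rw [h, pd_sum _ fun j ↦ (hJ j).fun_mul (hv j), ← Finset.sum_add_distrib]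
  refine Finset.sum_congr rfl fun j _ ↦ ?_
  rw [pd_mul (hJ j) (hv j), Chart.pd_jacobian_comm hy, mul_comm (vcomp X φ j y)]

/-- The previous lemma with the two charts exchanged; the derivative of the inverse Jacobian is then
taken along the φ coordinates, since X is the same field in both. It is used for the momenta, which
transform by that inverse. -/
lemma pd_jacobian_transition (hX : IsSmooth X) (hy : y ∈ φ.overlap ψ) (i m : Fin n) :
    ∑ j, pd j (vcomp X φ m) y * ψ.jacobian φ (φ.transition ψ y) j i =
      ∑ j, vcomp X φ j y * pd j (fun w ↦ ψ.jacobian φ (φ.transition ψ w) m i) y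
        + ∑ a, ψ.jacobian φ (φ.transition ψ y) m a *
          pd i (vcomp X ψ a) (φ.transition ψ y) := by
  have hy' := Chart.transition_mem_overlap hy
  have h := pd_vcomp_transition hX hy' m i
  rw [Chart.transition_transition hy] at h
  rw [h]
  congr 1
  have h1 (k : Fin n) := pd_comp_transition (f := fun w ↦ ψ.jacobian φ w m i) hy
    (differentiableAt_of_contDiffOn (ψ.isOpen_overlap φ) (ψ.contDiffOn_jacobian φ m i) hy')
    (fun w _ ↦ rfl) k
  simp only [← h1, vcomp_transition X hy, Finset.sum_mul, Finset.mul_sum]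
  rw [Finset.sum_comm]
  exact Finset.sum_congr rfl fun k _ ↦ Finset.sum_congr rfl fun a _ ↦ by ring

end Chart
end Supercotangent

/-! ### Change of coordinates of the lift and its assembly over all charts -/

namespace Supercotangent
variable {n : ℕ}

open Filter Topology

namespace PseudoRiemannianMetric

variable {M : Type*} [TopologicalSpace M] [ChartedSpace (Coord n) M] [IsManifold (𝓡 n) ∞ M]
  {g : PseudoRiemannianMetric n M} {φ ψ : Chart n M} {X : VField n M} {lam : M → ℝ}
  {y : Coord n} {z : Coord n × Coord n} {hbar : ℝ}

lemma confLift_isEvenAt : (g.confLift φ X lam hbar).IsEvenAt z where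
  x _ := real_mem_parity _
  p _ := Submodule.sub_mem _
    (Submodule.neg_mem _ (Submodule.sum_mem _ fun _ _ ↦ real_mem_parity _))
    (Submodule.smul_mem _ _ (linear_mul_linear_mem_parity _ _))
  xi _ := linear_mem_parity _

lemma contDiffOn_confLift_x (hX : IsSmooth X) (i : Fin n) :
    ContDiffOn ℝ ∞ ((g.confLift φ X lam hbar).x i) φ.domain :=
  contDiffOn_real_fst (contDiffOn_vcomp hX φ i)

lemma contDiffOn_confLift_xi (h : g.IsConformalFactor X lam) (i : Fin n) :
    ContDiffOn ℝ ∞ ((g.confLift φ X lam hbar).xi i) φ.domain :=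
  contDiffOn_linear fun m ↦ contDiffOn_confMatrix h.smooth h.smooth_factor i m

lemma contDiffOn_confLift_p (h : g.IsConformalFactor X lam) (j : Fin n) :
    ContDiffOn ℝ ∞ ((g.confLift φ X lam hbar).p j) φ.domain := by
  refine ContDiffOn.sub (ContDiffOn.neg (ContDiffOn.sum fun i _ ↦ real_contDiffOn
    (ContDiffOn.mul ?_ ?_))) ?_
  · exact ((EuclideanSpace.proj (𝕜 := ℝ) i).contDiff.comp contDiff_snd).contDiffOn
  · exact (contDiffOn_pd φ.isOpen_target (contDiffOn_vcomp h.smooth φ i) j).comp contDiffOn_fst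
      fun _ hz ↦ hz.1
  · exact ContDiffOn.const_smul _ (grassmann_mul_contDiffOn
      (contDiffOn_linear fun b ↦ g.contDiffOn_coef φ j b)
      (contDiffOn_linear fun m ↦ contDiffOn_pd φ.isOpen_target
        (φ.contDiffOn_scalar h.smooth_factor) m))

/-- The scalar shift −½λ commutes with the Jacobian, so A obeys the same inhomogeneous law as ∂X. -/
lemma confMatrix_transition (hX : IsSmooth X) (hy : y ∈ φ.overlap ψ) (i m : Fin n) :
    ∑ a, confMatrix ψ X lam i a (φ.transition ψ y) * φ.jacobian ψ y a m =
      ∑ j, vcomp X φ j y * pd j (fun w ↦ φ.jacobian ψ w i m) y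
        + ∑ j, φ.jacobian ψ y i j * confMatrix φ X lam j m y := by
  simp only [confMatrix, sub_mul, mul_sub, Finset.sum_sub_distrib, pd_vcomp_transition hX hy,
    ite_mul, zero_mul, mul_ite, mul_zero, Finset.sum_ite_eq, Finset.sum_ite_eq', Finset.mem_univ,
    if_true, Chart.symm_transition hy]
  ring

lemma confLift_transform_x (hy : z.1 ∈ φ.overlap ψ) (i : Fin n) :
    (g.confLift φ X lam hbar).apply (φ.pullback ψ (coordX i)) z
      = φ.pullback ψ ((g.confLift ψ X lam hbar).x i) z := by
  rw [Chart.pullback_coordX, LocalField.apply_real_of_real (fun _ ↦ rfl)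
    (h := fun w ↦ φ.transition ψ w i) (differentiableAt_of_contDiffOn (φ.isOpen_overlap ψ)
    (φ.contDiffOn_transition_apply ψ i) hy), Chart.pullback_apply]
  refine Eq.trans ?_ (Chart.xiPullback_real _).symm
  congr 1
  rw [vcomp_transition X hy]
  exact Finset.sum_congr rfl fun j _ ↦ by rw [Chart.jacobian_eq_pd hy, mul_comm]

lemma confLift_transform_xi (h : g.IsConformalFactor X lam) (hy : z.1 ∈ φ.overlap ψ) (i : Fin n) :
    (g.confLift φ X lam hbar).apply (φ.pullback ψ (coordXi i)) z
      = φ.pullback ψ ((g.confLift ψ X lam hbar).xi i) z := by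
  rw [Chart.pullback_coordXi, confLift_isEvenAt.apply_sum_real_mul_xi (fun _ ↦ rfl)
    (h := fun m w ↦ φ.jacobian ψ w i m) (fun m ↦ differentiableAt_of_contDiffOn
    (φ.isOpen_overlap ψ) (φ.contDiffOn_jacobian ψ i m) hy), Chart.pullback_apply]
  refine Eq.trans ?_ (Chart.xiPullback_linear _).symm
  simp only [confMatrix_transition h.smooth hy, linear_add]
  congr 1
  exact sum_real_mul_linear _ _ _

/-- The tensor law of the metric with one of its two Jacobians moved to the other side; it says that
the ξᵢ transform like the momenta. -/
lemma sum_coef_mul_jacobian (hy : y ∈ φ.overlap ψ) (i m : Fin n) :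
    ∑ b, g.coef ψ i b (φ.transition ψ y) * φ.jacobian ψ y b m
      = ∑ j, ψ.jacobian φ (φ.transition ψ y) j i * g.coef φ j m y := by
  have h (a : Fin n) := Chart.jacobian_mul_jacobian' hy a i
  have h1 (a b : Fin n) : ∑ j, ψ.jacobian φ (φ.transition ψ y) j i *
      (g.coef ψ a b (φ.transition ψ y) * φ.jacobian ψ y a j * φ.jacobian ψ y b m) =
      if a = i then g.coef ψ a b (φ.transition ψ y) * φ.jacobian ψ y b m else 0 := by
    have h2 := congrArg
      (fun r ↦ r * (g.coef ψ a b (φ.transition ψ y) * φ.jacobian ψ y b m)) (h a)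
    simp only [Finset.sum_mul, ite_mul, one_mul, zero_mul] at h2
    rw [← h2]
    exact Finset.sum_congr rfl fun j _ ↦ by ring
  have h3 (a : Fin n) : ∑ j, ∑ b, ψ.jacobian φ (φ.transition ψ y) j i *
      (g.coef ψ a b (φ.transition ψ y) * φ.jacobian ψ y a j * φ.jacobian ψ y b m) =
      if a = i then ∑ b, g.coef ψ a b (φ.transition ψ y) * φ.jacobian ψ y b m else 0 := by
    rw [Finset.sum_comm]
    simp only [h1]
    split_ifs <;> simp
  simp only [g.coef_transition hy, Finset.mul_sum]
  rw [Finset.sum_comm (s := Finset.univ (α := Fin n)) (t := Finset.univ (α := Fin n))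
    (f := fun j a ↦ ∑ b, ψ.jacobian φ (φ.transition ψ y) j i *
      (g.coef ψ a b (φ.transition ψ y) * φ.jacobian ψ y a j * φ.jacobian ψ y b m))]
  simp only [h3, Finset.sum_ite_eq', Finset.mem_univ, if_true]

/-- The ξξ-term is the covector ξⱼ times the function ∂ₘλ ξᵐ, hence tensorial (`hxi`, `heta`). The
inhomogeneous part sits in the terms linear in p, where it matches X acting on the inverse Jacobian
(`hreal`). -/
lemma confLift_transform_p (h : g.IsConformalFactor X lam) (hy : z.1 ∈ φ.overlap ψ) (i : Fin n) :
    (g.confLift φ X lam hbar).apply (φ.pullback ψ (coordP i)) z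
      = φ.pullback ψ ((g.confLift ψ X lam hbar).p i) z := by
  have hd (j : Fin n) : DifferentiableAt ℝ
      (fun w ↦ ψ.jacobian φ (φ.transition ψ w) j i) z.1 :=
    (differentiableAt_of_contDiffOn (ψ.isOpen_overlap φ) (ψ.contDiffOn_jacobian φ j i)
      (Chart.transition_mem_overlap hy)).comp z.1
      (differentiableAt_of_contDiffOn (φ.isOpen_overlap ψ) (φ.contDiffOn_transition ψ) hy)
  have hd1 (j : Fin n) : DifferentiableAt ℝ (fun z : Coord n × Coord n ↦
      (real (z.2 j) : Grassmann n)) z := differentiableAt_real_snd j z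
  have hd2 (j : Fin n) := differentiableAt_real_fst (hd j)
  have h1 (j : Fin n) : (g.confLift φ X lam hbar).apply (fun z ↦ real (z.2 j) *
      real (ψ.jacobian φ (φ.transition ψ z.1) j i)) z =
      (g.confLift φ X lam hbar).p j z * real (ψ.jacobian φ (φ.transition ψ z.1) j i)
      + real (z.2 j) * real (∑ k, vcomp X φ k z.1 *
        pd k (fun w ↦ ψ.jacobian φ (φ.transition ψ w) j i) z.1) := by
    rw [confLift_isEvenAt.apply_mul (hd1 j) (hd2 j), LocalField.apply_real_p,
      LocalField.apply_real_of_real (fun _ ↦ rfl) (hd j)]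
  have heta : φ.xiPullback ψ z.1 (linear (fun m ↦ pd m (fun y ↦ lam (ψ.1.symm y))
      (φ.transition ψ z.1))) = linear (fun m ↦ pd m (fun y ↦ lam (φ.1.symm y)) z.1) := by
    rw [Chart.xiPullback_linear]
    congr
    funext m
    exact pd_comp_transition hy (differentiableAt_scalar h.smooth_factor
      (Chart.transition_mem_target hy)) (fun w hw ↦ by rw [Chart.symm_transition hw]) m
  have hxi : φ.xiPullback ψ z.1 (linear (fun b ↦ g.coef ψ i b (φ.transition ψ z.1))) =
      ∑ j, real (ψ.jacobian φ (φ.transition ψ z.1) j i) * linear (fun m ↦ g.coef φ j m z.1) := by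
    rw [Chart.xiPullback_linear, sum_real_mul_linear]
    simp only [sum_coef_mul_jacobian hy]
  have hreal : ∑ a, Matrix.vecMul z.2.ofLp (ψ.jacobian φ (φ.transition ψ z.1)) a *
      pd i (vcomp X ψ a) (φ.transition ψ z.1) =
      ∑ j, (∑ m, z.2 m * pd j (vcomp X φ m) z.1) * ψ.jacobian φ (φ.transition ψ z.1) j i
      - ∑ j, z.2 j * ∑ k, vcomp X φ k z.1 *
        pd k (fun w ↦ ψ.jacobian φ (φ.transition ψ w) j i) z.1 := by
    have h2 (m : Fin n) := eq_sub_of_add_eq' (pd_jacobian_transition h.smooth hy i m).symm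
    simp only [Matrix.vecMul, dotProduct, Finset.sum_mul, mul_assoc]
    rw [Finset.sum_comm]
    simp only [← Finset.mul_sum, h2, mul_sub, Finset.sum_sub_distrib]
    congr 1
    simp only [Finset.mul_sum]
    exact Finset.sum_comm
  rw [Chart.pullback_coordP, LocalField.apply_sum _ _ fun j _ ↦
    grassmann_mul_differentiableAt (hd1 j) (hd2 j), Chart.pullback_apply]
  have h3 (j : Fin n) : (g.confLift φ X lam hbar).p j z *
      real (ψ.jacobian φ (φ.transition ψ z.1) j i) =
      -real ((∑ m, z.2 m * pd j (vcomp X φ m) z.1) * ψ.jacobian φ (φ.transition ψ z.1) j i)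
      - planck hbar • (real (ψ.jacobian φ (φ.transition ψ z.1) j i) *
        linear (fun m ↦ g.coef φ j m z.1) *
        linear (fun m ↦ pd m (fun y ↦ lam (φ.1.symm y)) z.1)) := by
    rw [real_comm, confLift, mul_sub, mul_neg, mul_smul_comm, mul_comm (∑ m, _) (_ : ℝ), real_mul,
      real_sum, mul_assoc]
  simp only [h1, h3]
  simp only [confLift, map_sub, map_neg, map_sum, map_smul, map_mul, Chart.xiPullback_real]
  rw [heta, hxi]
  simp only [← real_sum]
  rw [hreal]
  simp only [Finset.sum_add_distrib, Finset.sum_sub_distrib, Finset.sum_neg_distrib, ← real_mul,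
    ← real_sum, real_sub, ← Finset.sum_mul, ← Finset.smul_sum]
  abel

/-- The lift of a conformal vector field. -/
def IsConformalFactor.lift (h : g.IsConformalFactor X lam) (hbar : ℝ) : SuperVectorField n M where
  comp φ := (g.confLift φ X lam hbar).restrict φ.domain
  smooth_x φ i := (contDiffOn_confLift_x h.smooth i).congr fun _ hz ↦ Set.indicator_of_mem hz _
  smooth_p φ i := (contDiffOn_confLift_p h i).congr fun _ hz ↦ Set.indicator_of_mem hz _
  smooth_xi φ i := (contDiffOn_confLift_xi h i).congr fun _ hz ↦ Set.indicator_of_mem hz _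
  even_x φ i z := indicator_mem_parity (fun _ _ ↦ confLift_isEvenAt.x i) z
  even_p φ i z := indicator_mem_parity (fun _ _ ↦ confLift_isEvenAt.p i) z
  odd_xi φ i z := indicator_mem_parity (fun _ _ ↦ confLift_isEvenAt.xi i) z
  transform_x φ ψ i z hz hψ := by
    have hy := Chart.mem_overlap.2 ⟨hz.1, hψ⟩
    rw [LocalField.restrict_apply _ hz, confLift_transform_x hy, Chart.pullback_apply,
      Chart.pullback_apply]
    exact congrArg _ (Set.indicator_of_mem (s := ψ.domain)
      ⟨Chart.transition_mem_target hy, trivial⟩ _).symm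
  transform_p φ ψ i z hz hψ := by
    have hy := Chart.mem_overlap.2 ⟨hz.1, hψ⟩
    rw [LocalField.restrict_apply _ hz, confLift_transform_p h hy, Chart.pullback_apply,
      Chart.pullback_apply]
    exact congrArg _ (Set.indicator_of_mem (s := ψ.domain)
      ⟨Chart.transition_mem_target hy, trivial⟩ _).symm
  transform_xi φ ψ i z hz hψ := by
    have hy := Chart.mem_overlap.2 ⟨hz.1, hψ⟩
    rw [LocalField.restrict_apply _ hz, confLift_transform_xi h hy, Chart.pullback_apply,
      Chart.pullback_apply]
    exact congrArg _ (Set.indicator_of_mem (s := ψ.domain)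
      ⟨Chart.transition_mem_target hy, trivial⟩ _).symm
  off_x _ _ _ hz := Set.indicator_of_notMem hz _
  off_p _ _ _ hz := Set.indicator_of_notMem hz _
  off_xi _ _ _ hz := Set.indicator_of_notMem hz _

lemma IsConformalFactor.isConformalLift (h : g.IsConformalFactor X lam) (hbar : ℝ) :
    g.IsConformalLift hbar X (h.lift hbar) := by
  have hx {φ : Chart n M} {z : Coord n × Coord n} (hz : z ∈ φ.domain) (i : Fin n) :
      ((h.lift hbar).comp φ).x i =ᶠ[𝓝 z] (g.confLift φ X lam hbar).x i :=
    (Chart.eventually_domain hz).mono fun w hw ↦ Set.indicator_of_mem hw _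
  have hxi {φ : Chart n M} {z : Coord n × Coord n} (hz : z ∈ φ.domain) (i : Fin n) :
      ((h.lift hbar).comp φ).xi i =ᶠ[𝓝 z] (g.confLift φ X lam hbar).xi i :=
    (Chart.eventually_domain hz).mono fun w hw ↦ Set.indicator_of_mem hw _
  -- The factor of β is ½λ: β carries one factor g, which contributes λ, and the shift in
  -- `confMatrix` takes half of it away.
  refine ⟨fun φ i z hz ↦ (hx hz i).eq_of_nhds, fun φ j z hz ↦ ⟨?_, ?_, ?_⟩,
    fun q ↦ ((1 / 2 * lam q : ℝ) : ℂ), ?_, fun φ j z hz ↦ ⟨?_, ?_, ?_⟩⟩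
  · exact (h.lieDeriv_alpha_x_eq_zero_iff ((h.lift hbar).isEvenAt φ z) hz.1 (hx hz) (hxi hz) j).2
      (Set.indicator_of_mem hz _)
  · exact lieDeriv_alpha_p h.smooth h.smooth_factor hz.1 (hx hz) (hxi hz) j
  · exact h.lieDeriv_alpha_xi_eq_zero ((h.lift hbar).isEvenAt φ z) hz.1 (hx hz)
      (fun k ↦ (hxi hz k).eq_of_nhds) j
  · exact Complex.ofRealCLM.contDiff.contMDiff.comp (contMDiff_const.mul h.smooth_factor)
  · exact h.lieDeriv_beta_x_eq ((h.lift hbar).isEvenAt φ z) hz.1 (hx hz)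
      (fun k ↦ (hxi hz k).eq_of_nhds) j
  · rw [lieDeriv_beta_p h.smooth hz.1 (hx hz)]
    exact (smul_zero _).symm
  · rw [lieDeriv_beta_xi (hx hz)]
    exact (smul_zero _).symm

end PseudoRiemannianMetric
end Supercotangent

namespace Supercotangent
variable {n : ℕ}

/-! ### The Lie algebra of conformal vector fields -/

open Filter Topology

variable {M : Type*} [TopologicalSpace M] [ChartedSpace (Coord n) M]

/-- The derivative of a function of the coordinates along a vector field. -/
def lieD (X : VField n M) (φ : Chart n M) (f : Coord n → ℝ) : Coord n → ℝ :=
  fun y ↦ ∑ a, vcomp X φ a y * pd a f y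

section

variable {X Y : VField n M} {φ : Chart n M} {f h : Coord n → ℝ} {y : Coord n}

lemma lieD_congr (e : f =ᶠ[𝓝 y] h) : lieD X φ f y = lieD X φ h y := by
  simp only [lieD, pd_congr e]

lemma lieD_mul (hf : DifferentiableAt ℝ f y) (hh : DifferentiableAt ℝ h y) :
    lieD X φ (fun y ↦ f y * h y) y = lieD X φ f y * h y + f y * lieD X φ h y := by
  simp only [lieD, pd_mul hf hh, Finset.sum_mul, Finset.mul_sum, ← Finset.sum_add_distrib]
  exact Finset.sum_congr rfl fun _ _ ↦ by ring

lemma lieD_add (hf : DifferentiableAt ℝ f y) (hh : DifferentiableAt ℝ h y) :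
    lieD X φ (fun y ↦ f y + h y) y = lieD X φ f y + lieD X φ h y := by
  simp only [lieD, pd_add hf hh, mul_add, Finset.sum_add_distrib]

lemma lieD_const (c : ℝ) : lieD X φ (fun _ ↦ c) y = 0 := by
  simp [lieD, pd_const]

lemma lieD_sum {ι : Type*} (s : Finset ι) {f : ι → Coord n → ℝ}
    (hf : ∀ k, DifferentiableAt ℝ (f k) y) :
    lieD X φ (fun y ↦ ∑ k ∈ s, f k y) y = ∑ k ∈ s, lieD X φ (f k) y := by
  simp only [lieD, pd_sum s hf, Finset.mul_sum]
  exact Finset.sum_comm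

/-- The derivative of a function on `M` along a vector field. -/
def dirDeriv (X : VField n M) (f : M → ℝ) (q : M) : ℝ := mfderiv (𝓡 n) 𝓘(ℝ, ℝ) f q (X q)

lemma dirDeriv_symm {lam : M → ℝ} (hl : ContMDiff (𝓡 n) 𝓘(ℝ, ℝ) ∞ lam)
    (hy : y ∈ φ.1.target) : dirDeriv X lam (φ.1.symm y) =
      lieD X φ (fun y ↦ lam (φ.1.symm y)) y := by
  have h := mfderiv_comp y (hl.mdifferentiableAt (by simp))
    (φ.mdifferentiable.mdifferentiableAt_symm hy)
  rw [mfderiv_eq_fderiv] at h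
  have h2 := congrArg (fun f : Coord n →L[ℝ] ℝ ↦ f (φ.pull (φ.1.symm y) (X (φ.1.symm y)))) h
  have h3 := fderiv_apply_eq_sum (lam ∘ φ.1.symm) y (φ.pull (φ.1.symm y) (X (φ.1.symm y)))
  refine Eq.trans ?_ (h2.symm.trans h3)
  exact congrArg (mfderiv (𝓡 n) 𝓘(ℝ, ℝ) lam (φ.1.symm y)) (φ.push_pull hy _).symm

variable [IsManifold (𝓡 n) ∞ M]

lemma contDiffOn_lieD (hX : IsSmooth X) (hf : ContDiffOn ℝ ∞ f φ.1.target) :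
    ContDiffOn ℝ ∞ (lieD X φ f) φ.1.target :=
  ContDiffOn.sum fun a _ ↦ (contDiffOn_vcomp hX φ a).mul (contDiffOn_pd φ.isOpen_target hf a)

lemma pd_lieD (hX : IsSmooth X) (hf : ContDiffOn ℝ ∞ f φ.1.target) (hy : y ∈ φ.1.target)
    (m : Fin n) : pd m (lieD X φ f) y =
      lieD X φ (pd m f) y + ∑ a, pd m (vcomp X φ a) y * pd a f y := by
  have hp (a : Fin n) := differentiableAt_of_contDiffOn φ.isOpen_target
    (contDiffOn_pd φ.isOpen_target hf a) hy
  have hv (a : Fin n) := PseudoRiemannianMetric.differentiableAt_vcomp hX hy a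
  unfold lieD
  rw [pd_sum _ fun a ↦ (hv a).fun_mul (hp a), ← Finset.sum_add_distrib]
  refine Finset.sum_congr rfl fun a _ ↦ ?_
  rw [pd_mul (hv a) (hp a), pd_comm (hf.contDiffAt (φ.isOpen_target.mem_nhds hy)) m a, add_comm]

lemma vcomp_mlieBracket_eq (hX : IsSmooth X) (hY : IsSmooth Y) (hy : y ∈ φ.1.target) (i : Fin n) :
    vcomp (VectorField.mlieBracket (𝓡 n) X Y) φ i y =
      lieD X φ (vcomp Y φ i) y - lieD Y φ (vcomp X φ i) y := by
  rw [vcomp_mlieBracket hX hY φ i hy, Finset.sum_sub_distrib]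
  rfl

lemma pd_vcomp_mlieBracket (hX : IsSmooth X) (hY : IsSmooth Y) (hy : y ∈ φ.1.target)
    (m k : Fin n) : pd m (vcomp (VectorField.mlieBracket (𝓡 n) X Y) φ k) y =
      lieD X φ (pd m (vcomp Y φ k)) y + ∑ a, pd m (vcomp X φ a) y * pd a (vcomp Y φ k) y
      - (lieD Y φ (pd m (vcomp X φ k)) y + ∑ a, pd m (vcomp Y φ a) y * pd a (vcomp X φ k) y) := by
  have hX' := contDiffOn_vcomp hX φ k
  have hY' := contDiffOn_vcomp hY φ k
  rw [pd_congr ((φ.isOpen_target.eventually_mem hy).mono fun w hw ↦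
    vcomp_mlieBracket_eq hX hY hw k), pd_sub, pd_lieD hX hY' hy, pd_lieD hY hX' hy]
  · exact differentiableAt_of_contDiffOn φ.isOpen_target (contDiffOn_lieD hX hY') hy
  · exact differentiableAt_of_contDiffOn φ.isOpen_target (contDiffOn_lieD hY hX') hy

lemma lieD_mlieBracket (hX : IsSmooth X) (hY : IsSmooth Y) (hf : ContDiffOn ℝ ∞ f φ.1.target)
    (hy : y ∈ φ.1.target) : lieD (VectorField.mlieBracket (𝓡 n) X Y) φ f y =
      lieD X φ (lieD Y φ f) y - lieD Y φ (lieD X φ f) y := by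
  have h1 {X Y : VField n M} (hY : IsSmooth Y) : lieD X φ (lieD Y φ f) y =
      ∑ a, ∑ b, vcomp X φ a y * vcomp Y φ b y * pd a (pd b f) y
        + ∑ b, lieD X φ (vcomp Y φ b) y * pd b f y := by
    rw [lieD]
    simp only [pd_lieD hY hf hy, mul_add, Finset.sum_add_distrib]
    congr 1
    · simp only [lieD, Finset.mul_sum, mul_assoc,
        pd_comm (hf.contDiffAt (φ.isOpen_target.mem_nhds hy))]
    · simp only [lieD, Finset.mul_sum, Finset.sum_mul]
      rw [Finset.sum_comm]
      simp only [mul_assoc]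
  rw [h1 hX, h1 hY, lieD]
  -- The second-order parts of the two composites coincide, by symmetry of second derivatives.
  have h2 : ∑ a, ∑ b, vcomp X φ a y * vcomp Y φ b y * pd a (pd b f) y =
      ∑ a, ∑ b, vcomp Y φ a y * vcomp X φ b y * pd a (pd b f) y := by
    rw [Finset.sum_comm]
    refine Finset.sum_congr rfl fun a _ ↦ Finset.sum_congr rfl fun b _ ↦ ?_
    rw [pd_comm (hf.contDiffAt (φ.isOpen_target.mem_nhds hy)) b a, mul_comm (vcomp X φ b y)]
  simp only [vcomp_mlieBracket_eq hX hY hy, sub_mul, Finset.sum_sub_distrib]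
  linear_combination -h2

lemma contMDiff_of_charts {lam : M → ℝ}
    (h : ∀ φ : Chart n M, ContDiffOn ℝ ∞ (fun y ↦ lam (φ.1.symm y)) φ.1.target) :
    ContMDiff (𝓡 n) 𝓘(ℝ, ℝ) ∞ lam := by
  intro q
  let φ : Chart n M := ⟨chartAt (Coord n) q, IsManifold.chart_mem_maximalAtlas q⟩
  have hq : q ∈ φ.1.source := mem_chart_source _ q
  have h1 := ((h φ).contMDiffOn.comp φ.contMDiffOn fun _ hw ↦ φ.1.map_source hw).contMDiffAt
    (φ.1.open_source.mem_nhds hq)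
  refine h1.congr_of_eventuallyEq ?_
  filter_upwards [φ.1.open_source.mem_nhds hq] with w hw
  exact congrArg lam (φ.1.left_inv hw).symm

end

namespace PseudoRiemannianMetric

/-- `XG` is X applied to G, `XYG` is X applied to Y(G), and so on; the last two hypotheses are the
first two differentiated along the other field. Eliminating every derivative of G leaves a
polynomial identity in noncommuting matrices. -/
lemma bracket_skew {ι : Type*} [Fintype ι] {G A B XG YG XB YA XYG YXG : Matrix ι ι ℝ}
    (hX : XG + A.transpose * G + G * A = 0) (hY : YG + B.transpose * G + G * B = 0)
    (hXY : XYG + (XB.transpose * G + B.transpose * XG) + (XG * B + G * XB) = 0)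
    (hYX : YXG + (YA.transpose * G + A.transpose * YG) + (YG * A + G * YA) = 0) :
    XYG - YXG + (XB - YA + (B * A - A * B)).transpose * G + G * (XB - YA + (B * A - A * B)) = 0 := by
  have h1 : XG = -(A.transpose * G) - G * A := by rw [← sub_eq_zero, ← hX]; abel
  have h2 : YG = -(B.transpose * G) - G * B := by rw [← sub_eq_zero, ← hY]; abel
  have h3 : XYG = -(XB.transpose * G + B.transpose * XG) - (XG * B + G * XB) := by
    rw [← sub_eq_zero, ← hXY]; abel
  have h4 : YXG = -(YA.transpose * G + A.transpose * YG) - (YG * A + G * YA) := by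
    rw [← sub_eq_zero, ← hYX]; abel
  rw [h3, h4, h1, h2]
  simp only [Matrix.transpose_add, Matrix.transpose_sub, Matrix.transpose_mul]
  noncomm_ring

/-- The conformal factor of a bracket. -/
def bracketFactor (X Y : VField n M) (lam mu : M → ℝ) : M → ℝ := fun q ↦
  dirDeriv X mu q - dirDeriv Y lam q

lemma bracketFactor_symm {φ : Chart n M} {X Y : VField n M} {lam mu : M → ℝ} {y : Coord n}
    (hl : ContMDiff (𝓡 n) 𝓘(ℝ, ℝ) ∞ lam)
    (hm : ContMDiff (𝓡 n) 𝓘(ℝ, ℝ) ∞ mu)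
    (hy : y ∈ φ.1.target) : bracketFactor X Y lam mu (φ.1.symm y) =
      lieD X φ (fun y ↦ mu (φ.1.symm y)) y - lieD Y φ (fun y ↦ lam (φ.1.symm y)) y := by
  rw [bracketFactor, dirDeriv_symm hl hy, dirDeriv_symm hm hy]

variable [IsManifold (𝓡 n) ∞ M] {g : PseudoRiemannianMetric n M} {φ : Chart n M} {X Y : VField n M}
  {lam mu : M → ℝ} {y : Coord n}

/-- An identity without any assumption on X, so it can be used both to extract the skew condition
from a conformal field and to prove a bracket conformal. -/
lemma skew_eq (g : PseudoRiemannianMetric n M) (φ : Chart n M) (X : VField n M) (lam : M → ℝ)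
    (m j : Fin n) (y : Coord n) :
    lieD X φ (g.coef φ m j) y + ∑ k, confMatrix φ X lam k m y * g.coef φ k j y
      + ∑ k, g.coef φ m k y * confMatrix φ X lam k j y =
      g.lieCoef φ X m j y - lam (φ.1.symm y) * g.coef φ m j y := by
  simp only [lieCoef, lieD, Finset.sum_add_distrib, confMatrix, sub_mul, mul_sub, ite_mul, mul_ite,
    zero_mul, mul_zero, Finset.sum_sub_distrib, Finset.sum_ite_eq', Finset.mem_univ, if_true]
  simp only [mul_comm (pd m _ y)]
  ring

lemma lieD_confMatrix (hY : IsSmooth Y)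
    (hm : ContMDiff (𝓡 n) 𝓘(ℝ, ℝ) ∞ mu) (hy : y ∈ φ.1.target) (k m : Fin n) :
    lieD X φ (confMatrix φ Y mu k m) y = lieD X φ (pd m (vcomp Y φ k)) y
      - if k = m then 1 / 2 * lieD X φ (fun y ↦ mu (φ.1.symm y)) y else 0 := by
  simp only [lieD, pd_confMatrix hY hm hy, mul_sub, mul_ite, mul_zero, Finset.sum_sub_distrib]
  split_ifs
  · simp only [Finset.mul_sum]
    congr 1
    exact Finset.sum_congr rfl fun _ _ ↦ by ring
  · simp

/-- The derivative of the conformal Killing equation of `Y` along `X`. -/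
lemma IsConformalFactor.lieD_skew (hY : g.IsConformalFactor Y mu)
    (hy : y ∈ φ.1.target) (m j : Fin n) :
    lieD X φ (lieD Y φ (g.coef φ m j)) y
      + (∑ k, lieD X φ (confMatrix φ Y mu k m) y * g.coef φ k j y
        + ∑ k, confMatrix φ Y mu k m y * lieD X φ (g.coef φ k j) y)
      + (∑ k, lieD X φ (g.coef φ m k) y * confMatrix φ Y mu k j y
        + ∑ k, g.coef φ m k y * lieD X φ (confMatrix φ Y mu k j) y) = 0 := by
  have h0 : lieD X φ (fun y ↦ lieD Y φ (g.coef φ m j) y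
      + ∑ k, confMatrix φ Y mu k m y * g.coef φ k j y
      + ∑ k, g.coef φ m k y * confMatrix φ Y mu k j y) y = 0 := by
    rw [lieD_congr ((eventually_target hy).mono fun w hw ↦ (g.skew_eq φ Y mu m j w).trans
      (sub_eq_zero.2 (hY.lieCoef_eq φ m j w hw))), lieD_const]
  have hc (i j : Fin n) : DifferentiableAt ℝ (g.coef φ i j) y := differentiableAt_coef hy i j
  have hm (i j : Fin n) : DifferentiableAt ℝ (confMatrix φ Y mu i j) y :=
    differentiableAt_confMatrix hY.smooth hY.smooth_factor hy i j
  have hd : DifferentiableAt ℝ (lieD Y φ (g.coef φ m j)) y :=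
    differentiableAt_of_contDiffOn φ.isOpen_target
      (contDiffOn_lieD hY.smooth (g.contDiffOn_coef φ m j)) hy
  have h1 (k : Fin n) := (hm k m).fun_mul (hc k j)
  have h2 (k : Fin n) := (hc m k).fun_mul (hm k j)
  rw [lieD_add (hd.fun_add (DifferentiableAt.fun_sum fun k _ ↦ h1 k))
    (DifferentiableAt.fun_sum fun k _ ↦ h2 k),
    lieD_add hd (DifferentiableAt.fun_sum fun k _ ↦ h1 k), lieD_sum _ h1, lieD_sum _ h2] at h0
  simpa only [lieD_mul (hm _ _) (hc _ _), lieD_mul (hc _ _) (hm _ _), Finset.sum_add_distrib]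
    using h0

/-- Scalar matrices commute with everything, so −½λ and −½μ drop out of the matrix commutator. They
survive only through Xμ and Yλ, which is why the factor of the bracket is Xμ − Yλ. -/
lemma confMatrix_mlieBracket (hX : g.IsConformalFactor X lam) (hY : g.IsConformalFactor Y mu)
    (hy : y ∈ φ.1.target) (k m : Fin n) :
    confMatrix φ (VectorField.mlieBracket (𝓡 n) X Y) (bracketFactor X Y lam mu) k m y =
      lieD X φ (confMatrix φ Y mu k m) y - lieD Y φ (confMatrix φ X lam k m) y
      + (∑ a, confMatrix φ Y mu k a y * confMatrix φ X lam a m y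
        - ∑ a, confMatrix φ X lam k a y * confMatrix φ Y mu a m y) := by
  have h1 := pd_vcomp_mlieBracket hX.smooth hY.smooth hy m k
  have h2 : ∑ a, confMatrix φ Y mu k a y * confMatrix φ X lam a m y
      - ∑ a, confMatrix φ X lam k a y * confMatrix φ Y mu a m y =
      ∑ a, pd m (vcomp X φ a) y * pd a (vcomp Y φ k) y
        - ∑ a, pd m (vcomp Y φ a) y * pd a (vcomp X φ k) y := by
    simp only [confMatrix, sub_mul, mul_sub, ite_mul, mul_ite, zero_mul, mul_zero,
      Finset.sum_sub_distrib, Finset.sum_ite_eq, Finset.sum_ite_eq', Finset.mem_univ, if_true,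
      mul_comm (pd m _ y)]
    split_ifs <;> ring
  rw [h2, lieD_confMatrix hY.smooth hY.smooth_factor hy,
    lieD_confMatrix hX.smooth hX.smooth_factor hy, confMatrix, h1,
    bracketFactor_symm hX.smooth_factor hY.smooth_factor hy]
  split_ifs <;> ring

lemma IsConformalFactor.mlieBracket (hX : g.IsConformalFactor X lam)
    (hY : g.IsConformalFactor Y mu) :
    g.IsConformalFactor (VectorField.mlieBracket (𝓡 n) X Y) (bracketFactor X Y lam mu) := by
  refine ⟨hX.smooth.mlieBracket hY.smooth, contMDiff_of_charts fun φ ↦ ?_, fun φ m j y hy ↦ ?_⟩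
  · refine ContDiffOn.congr ?_ fun y hy ↦
      bracketFactor_symm (φ := φ) hX.smooth_factor hY.smooth_factor hy
    exact (contDiffOn_lieD hX.smooth (φ.contDiffOn_scalar hY.smooth_factor)).sub
      (contDiffOn_lieD hY.smooth (φ.contDiffOn_scalar hX.smooth_factor))
  · have hs {X : VField n M} {lam : M → ℝ} (hX : g.IsConformalFactor X lam) (m j : Fin n) :=
      (g.skew_eq φ X lam m j y).trans (sub_eq_zero.2 (hX.lieCoef_eq φ m j y hy))
    have key := bracket_skew
      (G := Matrix.of fun m j ↦ g.coef φ m j y)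
      (A := Matrix.of fun m j ↦ confMatrix φ X lam m j y)
      (B := Matrix.of fun m j ↦ confMatrix φ Y mu m j y)
      (XG := Matrix.of fun m j ↦ lieD X φ (g.coef φ m j) y)
      (YG := Matrix.of fun m j ↦ lieD Y φ (g.coef φ m j) y)
      (XB := Matrix.of fun m j ↦ lieD X φ (confMatrix φ Y mu m j) y)
      (YA := Matrix.of fun m j ↦ lieD Y φ (confMatrix φ X lam m j) y)
      (XYG := Matrix.of fun m j ↦ lieD X φ (lieD Y φ (g.coef φ m j)) y)
      (YXG := Matrix.of fun m j ↦ lieD Y φ (lieD X φ (g.coef φ m j)) y)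
      (Matrix.ext fun m j ↦ hs hX m j) (Matrix.ext fun m j ↦ hs hY m j)
      (Matrix.ext fun m j ↦ hY.lieD_skew hy m j)
      (Matrix.ext fun m j ↦ hX.lieD_skew hy m j)
    -- `skew_eq` is read backwards: the skew condition for the bracket is its Killing equation.
    refine sub_eq_zero.1 ((g.skew_eq φ _ _ m j y).symm.trans ?_)
    simp only [lieD_mlieBracket hX.smooth hY.smooth (g.contDiffOn_coef φ _ _) hy,
      confMatrix_mlieBracket hX hY hy]
    exact congrFun (congrFun key m) j

lemma IsConformalFactor.add (hX : g.IsConformalFactor X lam) (hY : g.IsConformalFactor Y mu) :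
    g.IsConformalFactor (X + Y) (fun q ↦ lam q + mu q) := by
  refine ⟨hX.smooth.add hY.smooth, hX.smooth_factor.add hY.smooth_factor, fun φ i j y hy ↦ ?_⟩
  have hv (k : Fin n) : vcomp (X + Y) φ k = fun y ↦ vcomp X φ k y + vcomp Y φ k y :=
    funext fun y ↦ vcomp_add X Y φ k y
  have h1 (a k : Fin n) : pd a (vcomp (X + Y) φ k) y = pd a (vcomp X φ k) y + pd a (vcomp Y φ k) y := by
    rw [hv, pd_add (differentiableAt_vcomp hX.smooth hy k) (differentiableAt_vcomp hY.smooth hy k)]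
  rw [add_mul, ← hX.lieCoef_eq φ i j y hy, ← hY.lieCoef_eq φ i j y hy]
  simp only [lieCoef, h1, vcomp_add, ← Finset.sum_add_distrib]
  exact Finset.sum_congr rfl fun k _ ↦ by ring

lemma IsConformalFactor.smul (hX : g.IsConformalFactor X lam) (a : ℝ) :
    g.IsConformalFactor (a • X) (fun q ↦ a * lam q) := by
  refine ⟨hX.smooth.smul a, contMDiff_const.mul hX.smooth_factor, fun φ i j y hy ↦ ?_⟩
  have hv (k : Fin n) : vcomp (a • X) φ k = fun y ↦ a * vcomp X φ k y :=
    funext fun y ↦ vcomp_smul a X φ k y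
  have h1 (b k : Fin n) : pd b (vcomp (a • X) φ k) y = a * pd b (vcomp X φ k) y := by
    rw [hv, pd_const_mul _ (differentiableAt_vcomp hX.smooth hy k)]
  rw [mul_assoc, ← hX.lieCoef_eq φ i j y hy]
  simp only [lieCoef, h1, vcomp_smul, Finset.mul_sum]
  exact Finset.sum_congr rfl fun k _ ↦ by ring

end PseudoRiemannianMetric
end Supercotangent

/-! ### The lift as a morphism of Lie algebras -/

namespace Supercotangent
variable {n : ℕ}

open Filter Topology

namespace PseudoRiemannianMetric

variable {M : Type*} [TopologicalSpace M] [ChartedSpace (Coord n) M] [IsManifold (𝓡 n) ∞ M]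
  {g : PseudoRiemannianMetric n M} {φ : Chart n M} {X Y : VField n M} {lam mu : M → ℝ}
  {z : Coord n × Coord n} {hbar : ℝ}

lemma differentiableAt_linear {u : Fin n → Coord n → ℝ} (hu : ∀ m, DifferentiableAt ℝ (u m) z.1) :
    DifferentiableAt ℝ (fun z : Coord n × Coord n ↦ linear (fun m ↦ u m z.1)) z :=
  DifferentiableAt.fun_sum fun m _ ↦ grassmann_mul_differentiableAt
    (differentiableAt_real_fst (hu m)) (differentiableAt_const _)

lemma confLift_apply_real {h : Coord n → ℝ} (hh : DifferentiableAt ℝ h z.1) :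
    (g.confLift φ X lam hbar).apply (fun z ↦ real (h z.1)) z = real (lieD X φ h z.1) :=
  LocalField.apply_real_of_real (fun _ ↦ rfl) hh

lemma confLift_apply_linear {u : Fin n → Coord n → ℝ} (hu : ∀ m, DifferentiableAt ℝ (u m) z.1) :
    (g.confLift φ X lam hbar).apply (fun z ↦ linear (fun m ↦ u m z.1)) z =
      linear (fun m ↦ lieD X φ (u m) z.1 + ∑ k, u k z.1 * confMatrix φ X lam k m z.1) := by
  rw [linear_add, ← sum_real_mul_linear]
  exact confLift_isEvenAt.apply_sum_real_mul_xi (fun _ ↦ rfl) hu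

/-- The skew condition trades X(g) and one A for the other A acting on the free index j. Thus ξⱼ has
weight ½λ, apart from its covector transformation by ∂X. -/
lemma IsConformalFactor.confLift_apply_coef (h : g.IsConformalFactor X lam)
    (hz : z.1 ∈ φ.1.target) (j : Fin n) :
    (g.confLift φ X lam hbar).apply (fun z ↦ linear (fun b ↦ g.coef φ j b z.1)) z =
      real (1 / 2 * lam (φ.1.symm z.1)) * linear (fun b ↦ g.coef φ j b z.1)
      - ∑ k, real (pd j (vcomp X φ k) z.1) * linear (fun b ↦ g.coef φ k b z.1) := by
  rw [confLift_apply_linear fun b ↦ differentiableAt_coef hz j b, sum_real_mul_linear,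
    ← linear_mul, ← linear_sub]
  congr
  funext m
  have h1 := (g.skew_eq φ X lam j m z.1).trans (sub_eq_zero.2 (h.lieCoef_eq φ j m z.1 hz))
  rw [add_right_comm] at h1
  rw [eq_neg_of_add_eq_zero_left h1]
  simp only [confMatrix, sub_mul, ite_mul, zero_mul, Finset.sum_sub_distrib, Finset.sum_ite_eq',
    Finset.mem_univ, if_true]
  ring

/-- Since ∂X acting on ξ in dμ(ξ) completes X(dμ) to d(Xμ), only the shift remains and gives weight
−½λ. -/
lemma confLift_apply_factor (hX : IsSmooth X) (hm : ContMDiff (𝓡 n) 𝓘(ℝ, ℝ) ∞ mu)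
    (hz : z.1 ∈ φ.1.target) :
    (g.confLift φ X lam hbar).apply
      (fun z ↦ linear (fun m ↦ pd m (fun y ↦ mu (φ.1.symm y)) z.1)) z =
      linear (fun m ↦ pd m (lieD X φ fun y ↦ mu (φ.1.symm y)) z.1)
      - real (1 / 2 * lam (φ.1.symm z.1)) *
        linear (fun m ↦ pd m (fun y ↦ mu (φ.1.symm y)) z.1) := by
  rw [confLift_apply_linear fun m ↦ differentiableAt_of_contDiffOn φ.isOpen_target
    (contDiffOn_pd φ.isOpen_target (φ.contDiffOn_scalar hm) m) hz, ← linear_mul, ← linear_sub]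
  congr
  funext m
  rw [pd_lieD hX (φ.contDiffOn_scalar hm) hz]
  simp only [confMatrix, mul_sub, mul_ite, mul_zero, Finset.sum_sub_distrib, Finset.sum_ite_eq',
    Finset.mem_univ, if_true, mul_comm (pd m (vcomp X φ _) z.1)]
  ring

/-- The weights ½λ and −½λ of the two factors cancel in the product ξⱼ dμ(ξ). -/
lemma IsConformalFactor.confLift_apply_coef_mul_factor (h : g.IsConformalFactor X lam)
    (hm : ContMDiff (𝓡 n) 𝓘(ℝ, ℝ) ∞ mu) (hz : z.1 ∈ φ.1.target) (j : Fin n) :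
    (g.confLift φ X lam hbar).apply (fun z ↦ linear (fun b ↦ g.coef φ j b z.1) *
      linear (fun m ↦ pd m (fun y ↦ mu (φ.1.symm y)) z.1)) z =
      linear (fun b ↦ g.coef φ j b z.1) *
        linear (fun m ↦ pd m (lieD X φ fun y ↦ mu (φ.1.symm y)) z.1)
      - ∑ k, real (pd j (vcomp X φ k) z.1) * (linear (fun b ↦ g.coef φ k b z.1) *
        linear (fun m ↦ pd m (fun y ↦ mu (φ.1.symm y)) z.1)) := by
  rw [confLift_isEvenAt.apply_mul (differentiableAt_linear fun b ↦ differentiableAt_coef hz j b)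
    (differentiableAt_linear fun m ↦ differentiableAt_of_contDiffOn φ.isOpen_target
    (contDiffOn_pd φ.isOpen_target (φ.contDiffOn_scalar hm) m) hz), h.confLift_apply_coef hz,
    confLift_apply_factor h.smooth hm hz, sub_mul, mul_sub, ← mul_assoc (linear _) (real _),
    real_comm, Finset.sum_mul]
  simp only [mul_assoc]
  abel

/-- The terms are grouped for antisymmetrization: the two sums with the prefactor ħ/2i are exchanged
when (X, λ) and (Y, μ) are swapped, so the commutator retains only d(Xμ) and d(Yλ). -/
lemma IsConformalFactor.confLift_apply_p (hX : g.IsConformalFactor X lam)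
    (hY : g.IsConformalFactor Y mu) (hz : z.1 ∈ φ.1.target) (j : Fin n) :
    (g.confLift φ X lam hbar).apply ((g.confLift φ Y mu hbar).p j) z =
      real (∑ l, z.2 l * (∑ i, pd i (vcomp X φ l) z.1 * pd j (vcomp Y φ i) z.1
        - lieD X φ (pd j (vcomp Y φ l)) z.1))
      + planck hbar • (∑ i, real (pd j (vcomp Y φ i) z.1) * (linear (fun b ↦ g.coef φ i b z.1) *
          linear (fun m ↦ pd m (fun y ↦ lam (φ.1.symm y)) z.1))
        + ∑ i, real (pd j (vcomp X φ i) z.1) * (linear (fun b ↦ g.coef φ i b z.1) *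
          linear (fun m ↦ pd m (fun y ↦ mu (φ.1.symm y)) z.1))
        - linear (fun b ↦ g.coef φ j b z.1) *
          linear (fun m ↦ pd m (lieD X φ fun y ↦ mu (φ.1.symm y)) z.1)) := by
  have hd1 (i : Fin n) : DifferentiableAt ℝ (fun z : Coord n × Coord n ↦
      (real (z.2 i) : Grassmann n)) z := differentiableAt_real_snd i z
  have hd2 (i : Fin n) := differentiableAt_pd_vcomp hY.smooth hz j i
  have hd3 : DifferentiableAt ℝ (fun z : Coord n × Coord n ↦
      linear (fun b ↦ g.coef φ j b z.1) *
        linear (fun m ↦ pd m (fun y ↦ mu (φ.1.symm y)) z.1)) z :=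
    grassmann_mul_differentiableAt (differentiableAt_linear fun b ↦ differentiableAt_coef hz j b)
      (differentiableAt_linear fun m ↦ differentiableAt_of_contDiffOn φ.isOpen_target
      (contDiffOn_pd φ.isOpen_target (φ.contDiffOn_scalar hY.smooth_factor) m) hz)
  have hd4 (i : Fin n) := grassmann_mul_differentiableAt (hd1 i) (differentiableAt_real_fst (hd2 i))
  have h1 : (g.confLift φ Y mu hbar).p j = fun z ↦
      -∑ i, real (z.2 i) * real (pd j (vcomp Y φ i) z.1) - planck hbar •
        (linear (fun b ↦ g.coef φ j b z.1) *
          linear (fun m ↦ pd m (fun y ↦ mu (φ.1.symm y)) z.1)) := by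
    funext z
    simp only [← real_mul]
    rfl
  have h2 (i : Fin n) : (g.confLift φ X lam hbar).apply
      (fun z ↦ real (z.2 i) * real (pd j (vcomp Y φ i) z.1)) z =
      -real (∑ l, z.2 l * (pd i (vcomp X φ l) z.1 * pd j (vcomp Y φ i) z.1))
      - planck hbar • (real (pd j (vcomp Y φ i) z.1) * (linear (fun b ↦ g.coef φ i b z.1) *
          linear (fun m ↦ pd m (fun y ↦ lam (φ.1.symm y)) z.1)))
      + real (z.2 i * lieD X φ (pd j (vcomp Y φ i)) z.1) := by
    rw [confLift_isEvenAt.apply_mul (hd1 i) (differentiableAt_real_fst (hd2 i)),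
      LocalField.apply_real_p, confLift_apply_real (hd2 i), real_comm, confLift, mul_sub, mul_neg,
      mul_smul_comm, ← real_sum, ← real_mul, ← real_mul, Finset.mul_sum]
    congr 4
    exact Finset.sum_congr rfl fun l _ ↦ by ring
  rw [h1, LocalField.apply_sub _ (DifferentiableAt.fun_sum fun i _ ↦ hd4 i).fun_neg
    (hd3.fun_const_smul _), LocalField.apply_smul _ _ hd3, LocalField.apply_neg,
    LocalField.apply_sum _ _ fun i _ ↦ hd4 i,
    hX.confLift_apply_coef_mul_factor hY.smooth_factor hz]
  simp only [h2, Finset.sum_add_distrib, Finset.sum_sub_distrib, Finset.sum_neg_distrib,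
    ← real_sum, ← Finset.smul_sum, mul_sub, smul_sub, smul_add, real_sub, Finset.mul_sum]
  rw [Finset.sum_comm]
  abel

lemma IsConformalFactor.confLift_diffAt (h : g.IsConformalFactor X lam) (hz : z ∈ φ.domain) :
    (g.confLift φ X lam hbar).DiffAt z where
  x i := differentiableAt_of_contDiffOn φ.isOpen_domain (contDiffOn_confLift_x h.smooth i) hz
  p i := differentiableAt_of_contDiffOn φ.isOpen_domain (contDiffOn_confLift_p h i) hz
  xi i := differentiableAt_of_contDiffOn φ.isOpen_domain (contDiffOn_confLift_xi h i) hz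

lemma IsConformalFactor.confLift_add_apply (hX : g.IsConformalFactor X lam)
    (hY : g.IsConformalFactor Y mu) (hz : z ∈ φ.domain) (F : SFun n) :
    (g.confLift φ (X + Y) (fun q ↦ lam q + mu q) hbar).apply F z =
      (g.confLift φ X lam hbar).apply F z + (g.confLift φ Y mu hbar).apply F z := by
  have hv (k : Fin n) : vcomp (X + Y) φ k = fun y ↦ vcomp X φ k y + vcomp Y φ k y :=
    funext fun y ↦ vcomp_add X Y φ k y
  have h1 (a k : Fin n) : pd a (vcomp (X + Y) φ k) z.1
      = pd a (vcomp X φ k) z.1 + pd a (vcomp Y φ k) z.1 := by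
    rw [hv, pd_add (differentiableAt_vcomp hX.smooth hz.1 k)
      (differentiableAt_vcomp hY.smooth hz.1 k)]
  have h2 (m : Fin n) := pd_add (differentiableAt_scalar hX.smooth_factor hz.1)
    (differentiableAt_scalar hY.smooth_factor hz.1) m
  have h3 (k m : Fin n) : confMatrix φ (X + Y) (fun q ↦ lam q + mu q) k m z.1 =
      confMatrix φ X lam k m z.1 + confMatrix φ Y mu k m z.1 := by
    simp only [confMatrix, h1]
    split_ifs <;> ring
  have hp (j : Fin n) : (g.confLift φ (X + Y) (fun q ↦ lam q + mu q) hbar).p j z =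
      (g.confLift φ X lam hbar).p j z + (g.confLift φ Y mu hbar).p j z := by
    simp only [confLift, h1, h2, linear_add, mul_add, real_add, Finset.sum_add_distrib, smul_add]
    abel
  simp only [LocalField.apply, ← Finset.sum_add_distrib, hp]
  simp only [confLift, h3, vcomp_add, linear_add, real_add]
  refine Finset.sum_congr rfl fun i _ ↦ ?_
  simp only [add_mul]
  abel

lemma IsConformalFactor.confLift_smul_apply (hX : g.IsConformalFactor X lam) (a : ℝ)
    (hz : z ∈ φ.domain) (F : SFun n) :
    (g.confLift φ (a • X) (fun q ↦ a * lam q) hbar).apply F z =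
      a • (g.confLift φ X lam hbar).apply F z := by
  have hv (k : Fin n) : vcomp (a • X) φ k = fun y ↦ a * vcomp X φ k y :=
    funext fun y ↦ vcomp_smul a X φ k y
  have h1 (b k : Fin n) : pd b (vcomp (a • X) φ k) z.1 = a * pd b (vcomp X φ k) z.1 := by
    rw [hv, pd_const_mul _ (differentiableAt_vcomp hX.smooth hz.1 k)]
  have h2 (m : Fin n) := pd_const_mul a (differentiableAt_scalar hX.smooth_factor hz.1) m
  have h3 (k m : Fin n) : confMatrix φ (a • X) (fun q ↦ a * lam q) k m z.1 =
      a * confMatrix φ X lam k m z.1 := by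
    simp only [confMatrix, h1]
    split_ifs <;> ring
  have hp (j : Fin n) : (g.confLift φ (a • X) (fun q ↦ a * lam q) hbar).p j z =
      real a * (g.confLift φ X lam hbar).p j z := by
    have h4 (i : Fin n) : (real (z.2 i * (a * pd j (vcomp X φ i) z.1)) : Grassmann n) =
        real a * real (z.2 i * pd j (vcomp X φ i) z.1) := by
      rw [mul_left_comm, real_mul]
    simp only [confLift, h1, h2, h4, linear_mul, ← Finset.mul_sum, mul_sub, mul_smul_comm, mul_neg]
    rw [← mul_assoc (linear _) (real a), real_comm, mul_assoc]
  rw [real_smul_eq]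
  simp only [LocalField.apply, Finset.mul_sum, hp]
  simp only [confLift, h3, vcomp_smul, linear_mul, real_mul, mul_add, mul_assoc]

/-- By `commutator_apply` only components are compared: x-components give the bracket of X and Y,
odd components `confMatrix_mlieBracket`, and momentum components the antisymmetrization of
`confLift_apply_p`. -/
lemma IsConformalFactor.confLift_mlieBracket_apply (hX : g.IsConformalFactor X lam)
    (hY : g.IsConformalFactor Y mu) (hz : z ∈ φ.domain) {F : SFun n} (hF : ContDiffAt ℝ ∞ F z) :
    (g.confLift φ (VectorField.mlieBracket (𝓡 n) X Y) (bracketFactor X Y lam mu) hbar).apply F z =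
      (g.confLift φ X lam hbar).apply ((g.confLift φ Y mu hbar).apply F) z
      - (g.confLift φ Y mu hbar).apply ((g.confLift φ X lam hbar).apply F) z := by
  have hx (i : Fin n) : (g.confLift φ (VectorField.mlieBracket (𝓡 n) X Y)
      (bracketFactor X Y lam mu) hbar).x i z =
      (g.confLift φ X lam hbar).apply ((g.confLift φ Y mu hbar).x i) z
      - (g.confLift φ Y mu hbar).apply ((g.confLift φ X lam hbar).x i) z := by
    refine Eq.trans ?_ (congrArg₂ (fun a b ↦ a - b)
      (confLift_apply_real (differentiableAt_vcomp hY.smooth hz.1 i))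
      (confLift_apply_real (differentiableAt_vcomp hX.smooth hz.1 i))).symm
    rw [← real_sub, ← vcomp_mlieBracket_eq hX.smooth hY.smooth hz.1]
    rfl
  have hxi (i : Fin n) : (g.confLift φ (VectorField.mlieBracket (𝓡 n) X Y)
      (bracketFactor X Y lam mu) hbar).xi i z =
      (g.confLift φ X lam hbar).apply ((g.confLift φ Y mu hbar).xi i) z
      - (g.confLift φ Y mu hbar).apply ((g.confLift φ X lam hbar).xi i) z := by
    refine Eq.trans ?_ (congrArg₂ (fun a b ↦ a - b)
      (confLift_apply_linear fun m ↦ differentiableAt_confMatrix hY.smooth hY.smooth_factor hz.1 i m)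
      (confLift_apply_linear fun m ↦
        differentiableAt_confMatrix hX.smooth hX.smooth_factor hz.1 i m)).symm
    rw [← linear_sub]
    simp only [confLift, confMatrix_mlieBracket hX hY hz.1]
    congr
    funext m
    ring
  have hp (i : Fin n) : (g.confLift φ (VectorField.mlieBracket (𝓡 n) X Y)
      (bracketFactor X Y lam mu) hbar).p i z =
      (g.confLift φ X lam hbar).apply ((g.confLift φ Y mu hbar).p i) z
      - (g.confLift φ Y mu hbar).apply ((g.confLift φ X lam hbar).p i) z := by
    rw [hX.confLift_apply_p hY hz.1, hY.confLift_apply_p hX hz.1]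
    have h1 (l : Fin n) := pd_vcomp_mlieBracket hX.smooth hY.smooth hz.1 i l
    have h2 (m : Fin n) : pd m (fun y ↦ bracketFactor X Y lam mu (φ.1.symm y)) z.1 =
        pd m (lieD X φ fun y ↦ mu (φ.1.symm y)) z.1
        - pd m (lieD Y φ fun y ↦ lam (φ.1.symm y)) z.1 := by
      rw [pd_congr ((eventually_target hz.1).mono fun w hw ↦
        bracketFactor_symm hX.smooth_factor hY.smooth_factor hw), pd_sub]
      · exact differentiableAt_of_contDiffOn φ.isOpen_target
          (contDiffOn_lieD hX.smooth (φ.contDiffOn_scalar hY.smooth_factor)) hz.1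
      · exact differentiableAt_of_contDiffOn φ.isOpen_target
          (contDiffOn_lieD hY.smooth (φ.contDiffOn_scalar hX.smooth_factor)) hz.1
    have h3 : -∑ l, z.2 l * pd i (vcomp (VectorField.mlieBracket (𝓡 n) X Y) φ l) z.1 =
        ∑ l, z.2 l * (∑ k, pd k (vcomp X φ l) z.1 * pd i (vcomp Y φ k) z.1
          - lieD X φ (pd i (vcomp Y φ l)) z.1)
        - ∑ l, z.2 l * (∑ k, pd k (vcomp Y φ l) z.1 * pd i (vcomp X φ k) z.1
          - lieD Y φ (pd i (vcomp X φ l)) z.1) := by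
      rw [← Finset.sum_neg_distrib, ← Finset.sum_sub_distrib]
      refine Finset.sum_congr rfl fun l _ ↦ ?_
      rw [h1]
      simp only [mul_comm (pd i _ z.1)]
      ring
    simp only [confLift, h2, linear_sub, ← real_sum]
    rw [← real_neg, h3, real_sub, mul_sub, smul_sub]
    simp only [smul_sub, smul_add]
    abel
  rw [confLift_isEvenAt.commutator_apply confLift_isEvenAt (hX.confLift_diffAt hz)
    (hY.confLift_diffAt hz) hF, LocalField.apply]
  simp only [hx, hp, hxi]

namespace IsConformalLift

variable {V W U : SuperVectorField n M}

lemma apply_eq (h : g.IsConformalLift hbar X V) (hh : hbar ≠ 0) (hl : g.IsConformalFactor X lam)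
    (hz : z ∈ φ.domain) (F : SFun n) :
    (V.comp φ).apply F z = (g.confLift φ X lam hbar).apply F z :=
  LocalField.apply_eq_of_eq (h.1 φ · z hz) (h.p_eq hh hl hz) (h.xi_eq hh hl hz) F

/-- The outer field differentiates the inner result, so the inner equality is needed on a
neighbourhood, which the open domain provides. -/
lemma apply_apply_eq (hV : g.IsConformalLift hbar X V) (hW : g.IsConformalLift hbar Y W)
    (hh : hbar ≠ 0) (hl : g.IsConformalFactor X lam) (hm : g.IsConformalFactor Y mu)
    (hz : z ∈ φ.domain) (F : SFun n) :
    (V.comp φ).apply ((W.comp φ).apply F) z =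
      (g.confLift φ X lam hbar).apply ((g.confLift φ Y mu hbar).apply F) z := by
  rw [hV.apply_eq hh hl hz]
  exact LocalField.apply_congr _ ((Chart.eventually_domain hz).mono fun w hw ↦
    hW.apply_eq hh hm hw F)

end IsConformalLift

variable (g) in
lemma zero_mem_conf : (0 : VField n M) ∈ g.conf := by
  have hv (φ : Chart n M) (k : Fin n) : vcomp (0 : VField n M) φ k = fun _ ↦ 0 := by
    funext y
    simp only [vcomp_eq, Pi.zero_apply, map_zero]
  refine ⟨Bundle.contMDiff_zeroSection ℝ (TangentSpace (𝓡 n) : M → Type _), fun _ ↦ 0,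
    contMDiff_const, fun φ i j y _ ↦ ?_⟩
  simp [lieCoef, hv, pd_const]

variable (g) in
/-- A lift of every vector field, which is the conformal lift of the conformal ones. -/
lemma exists_lift (hbar : ℝ) : ∃ L : VField n M → SuperVectorField n M,
    ∀ X ∈ g.conf, g.IsConformalLift hbar X (L X) := by
  have h (X : VField n M) : ∃ V : SuperVectorField n M, X ∈ g.conf → g.IsConformalLift hbar X V := by
    by_cases hX : X ∈ g.conf
    · obtain ⟨lam, hl⟩ := mem_conf_iff.1 hX
      exact ⟨hl.lift hbar, fun _ ↦ hl.isConformalLift hbar⟩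
    -- Outside `conf` the value is irrelevant; the lift of the zero field serves as a default.
    · obtain ⟨lam, hl⟩ := mem_conf_iff.1 g.zero_mem_conf
      exact ⟨hl.lift hbar, fun h ↦ absurd h hX⟩
  choose L hL using h
  exact ⟨L, hL⟩

end PseudoRiemannianMetric
end Supercotangent

end

theorem theorem3p5 {n : ℕ} {M : Type*} [TopologicalSpace M]
    [ChartedSpace (EuclideanSpace ℝ (Fin n)) M] [IsManifold (𝓡 n) ∞ M]
    (g : Supercotangent.PseudoRiemannianMetric n M) (hbar : ℝ) (hbar_ne : hbar ≠ 0) :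
    -- a smooth vector field has a lift preserving `α` and the direction of `β` iff it is conformal
    (∀ X : Supercotangent.VField n M, Supercotangent.IsSmooth X →
      ((∃ V, g.IsConformalLift hbar X V) ↔ X ∈ g.conf)) ∧
    -- the lift is unique and given by the explicit formula
    (∀ X ∈ g.conf, (∃! V, g.IsConformalLift hbar X V) ∧
      ∀ V, g.IsConformalLift hbar X V → g.IsExplicitLift hbar X V) ∧
    -- `conf(M,g)` is a Lie algebra, and the lift is a morphism of Lie algebras
    (∃ L : Supercotangent.VField n M → Supercotangent.SuperVectorField n M,
      (∀ X ∈ g.conf, g.IsConformalLift hbar X (L X)) ∧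
      ∀ X ∈ g.conf, ∀ Y ∈ g.conf, ∀ a : ℝ,
        X + Y ∈ g.conf ∧ a • X ∈ g.conf ∧ VectorField.mlieBracket (𝓡 n) X Y ∈ g.conf ∧
        ∀ (φ : Supercotangent.Chart n M) (F : Supercotangent.SFun n),
          ContDiffOn ℝ ∞ F φ.domain → ∀ z ∈ φ.domain,
          ((L (X + Y)).comp φ).apply F z
            = ((L X).comp φ).apply F z + ((L Y).comp φ).apply F z ∧
          ((L (a • X)).comp φ).apply F z = a • ((L X).comp φ).apply F z ∧
          ((L (VectorField.mlieBracket (𝓡 n) X Y)).comp φ).apply F z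
            = ((L X).comp φ).apply (((L Y).comp φ).apply F) z
              - ((L Y).comp φ).apply (((L X).comp φ).apply F) z) := by
  obtain ⟨L, hL⟩ := g.exists_lift hbar
  refine ⟨fun X hX ↦ ⟨fun ⟨V, hV⟩ ↦ hV.mem_conf hbar_ne hX, fun h ↦ ⟨L X, hL X h⟩⟩,
    fun X hX ↦ ⟨⟨L X, hL X hX, fun V hV ↦ hV.unique (hL X hX) hbar_ne hX⟩,
      fun V hV ↦ hV.isExplicitLift hbar_ne hX⟩, L, hL, fun X hX Y hY a ↦ ?_⟩
  -- Any conformal factors will do: by uniqueness each `L X` acts as `confLift` for whichever factor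
  -- is chosen, so the factors of the sum, multiple and bracket can be the natural ones.
  obtain ⟨lam, hl⟩ := Supercotangent.PseudoRiemannianMetric.mem_conf_iff.1 hX
  obtain ⟨mu, hm⟩ := Supercotangent.PseudoRiemannianMetric.mem_conf_iff.1 hY
  have hadd : X + Y ∈ g.conf := Supercotangent.PseudoRiemannianMetric.mem_conf_iff.2 ⟨_, hl.add hm⟩
  have hsmul : a • X ∈ g.conf := Supercotangent.PseudoRiemannianMetric.mem_conf_iff.2 ⟨_, hl.smul a⟩
  have hbr : VectorField.mlieBracket (𝓡 n) X Y ∈ g.conf := Supercotangent.PseudoRiemannianMetric.mem_conf_iff.2 ⟨_, hl.mlieBracket hm⟩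
  refine ⟨hadd, hsmul, hbr, fun φ F hF z hz ↦ ⟨?_, ?_, ?_⟩⟩
  · rw [(hL _ hadd).apply_eq hbar_ne (hl.add hm) hz, (hL X hX).apply_eq hbar_ne hl hz,
      (hL Y hY).apply_eq hbar_ne hm hz, hl.confLift_add_apply hm hz]
  · rw [(hL _ hsmul).apply_eq hbar_ne (hl.smul a) hz, (hL X hX).apply_eq hbar_ne hl hz,
      hl.confLift_smul_apply a hz]
  · rw [(hL _ hbr).apply_eq hbar_ne (hl.mlieBracket hm) hz,
      (hL X hX).apply_apply_eq (hL Y hY) hbar_ne hl hm hz,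
      (hL Y hY).apply_apply_eq (hL X hX) hbar_ne hm hl hz]
    exact hl.confLift_mlieBracket_apply hm hz (hF.contDiffAt (φ.isOpen_domain.mem_nhds hz))
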